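/- Let $E$ be an elliptic curve over $\mathbb{Q}$, given by a Weierstrass equation, and let $Q=(x_0,y_0)\in E(\mathbb{Q})$ be an affine rational point (a rational point other than the point at infinity). Then $E$ has a Weierstrass equation with integer coefficients $$Y^2+a_1XY+a_3Y=X^3+a_2X^2+a_4X \qquad (*)$$ in which $Q$ is the origin $(0,0)$, and even one with $a_1=0$. Fix any such equation $(*)$, let $\Delta$ be its discriminant, and call a prime $p$ good if $p$ divides neither $\Delta$ nor any nonzero coefficient $a_i$; all but finitely many primes are good. For a good prime $p$ let $E(\mathbb{F}_p)$ be the set of points of the reduction of $(*)$ in $\mathbb{P}^2(\mathbb{F}_p)$, including the point at infinity. There exist an infinite torsion-free nilpotent group $G$ of class exactly $2$ and a Lie ring $L$, associated to each other as follows: $G$ is generated by nine elements $x_1,\dots,x_9$, every element of $G$ is $x_1^{n_1}\cdots x_9^{n_9}$ for unique integers $n_k$, and there are integers $c_{ij}^k$ with $[x_i,x_j]=\prod_k x_k^{c_{ij}^k}$, where $x_k$ is central whenever some $c_{ij}^k\neq 0$; and $L$ is free as a $\mathbb{Z}$-module on $e_1,\dots,e_9$ with $(e_i,e_j)=\sum_k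 c_{ij}^k e_k$. There exist moreover two distinct lines $M_1,M_2$ in $\mathbb{P}^2$ over $\mathbb{Q}$, each given by a linear form with coprime integer coefficients, and rational functions $P_1,\dots,P_5\in\mathbb{Q}(X,Y)$ with $P_2\neq 0$, such that for every good prime $p$ (hence for almost all primes) and every $s\in\mathbb{C}$ with $\operatorname{Re}(s)>9$ the series $$\zeta^{\triangleleft}_{G,p}(s)=\sum_{H\triangleleft G,\ |G:H|\text{ a power of }p}|G:H|^{-s},\qquad \zeta^{\triangleleft}_{L,p}(s)=\sum_{I\text{ ideal of }L,\ |L:I|\text{ a power of }p}|L:I|^{-s}$$ converge absolutely, the functions $P_1,\dots,P_5$ are defined at $(p,p^{-s})$, and $$\zeta^{\triangleleft}_{G,p}(s)=\zeta^{\triangleleft}_{L,p}(s)=P_1(p,p^{-s})+|E(\mathbb{F}_p)|\,P_2(p,p^{-s})+|M_1\cap E(\mathbb{F}_p)|\,P_3(p,p^{-s})+|M_2\cap E(\mathbb{F}_p)|\,P_4(p,p^{-s})+|M_1\cap M_2\cap E(\mathbb{F}_p)|\,P_5(p,p^{-s}),$$ where $M_1,M_2$ are reduced modulo $p$. -/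

import Mathlib

open scoped LinearAlgebra.Projectivization

/-! ### Integral Weierstrass equations centred at a rational point -/

/-- `W₀` is a Weierstrass equation with integer coefficients for the curve `W` over `ℚ`, in
coordinates in which the point `(x, y)` is the origin. The substitution attached to
`C = (u, r, s, t)` is `(X, Y) ↦ (u² X + r, u³ Y + u² s X + t)`, which maps the origin to `(r, t)`. -/
def IsIntegralModelAt (W : WeierstrassCurve ℚ) (x y : ℚ) (W₀ : WeierstrassCurve ℤ) : Prop :=
  ∃ C : WeierstrassCurve.VariableChange ℚ,
    C • W = W₀.map (Int.castRingHom ℚ) ∧ C.r = x ∧ C.t = y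

/-- `p` divides neither the discriminant nor any of the nonzero coefficients of `W₀`. -/
def IsGoodPrime (W₀ : WeierstrassCurve ℤ) (p : ℕ) : Prop :=
  ¬ (p : ℤ) ∣ W₀.Δ ∧
    ∀ c ∈ ({W₀.a₁, W₀.a₂, W₀.a₃, W₀.a₄, W₀.a₆} : Set ℤ), c ≠ 0 → ¬ (p : ℤ) ∣ c

/-! ### Points over finite fields -/

/-- The points in the projective plane over `F` of the projective closure of a Weierstrass curve
(the point at infinity included). -/
def curvePoints {F : Type*} [Field F] (W : WeierstrassCurve F) : Set (ℙ F (Fin 3 → F)) :=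
  {P | W.toProjective.Equation P.rep}

/-- The points of the projective line `m₀ X + m₁ Y + m₂ Z = 0`. -/
def linePoints {F : Type*} [Field F] (m : Fin 3 → F) : Set (ℙ F (Fin 3 → F)) :=
  {P | m ⬝ᵥ P.rep = 0}

/-- The `𝔽_p`-points of the reduction of an integral Weierstrass equation. -/
def redCurve (p : ℕ) [Fact p.Prime] (W₀ : WeierstrassCurve ℤ) :
    Set (ℙ (ZMod p) (Fin 3 → ZMod p)) :=
  curvePoints (W₀.map (Int.castRingHom (ZMod p)))

/-- The `𝔽_p`-points of the reduction of a line with integer coefficients. -/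
def redLine (p : ℕ) [Fact p.Prime] (m : Fin 3 → ℤ) : Set (ℙ (ZMod p) (Fin 3 → ZMod p)) :=
  linePoints fun i => (m i : ZMod p)

/-- The coefficient vector of a line in the projective plane over `ℚ`, normalised to have coprime
integer entries (so that it also defines a line modulo every prime). -/
def IsPrimitiveVec (m : Fin 3 → ℤ) : Prop :=
  Finset.univ.gcd m = 1

/-! ### Rational functions in two variables -/

/-- The field `ℚ(X, Y)`. -/
abbrev RatFunc₂ : Type := FractionRing (MvPolynomial (Fin 2) ℚ)

/-- The rational function `P` is defined at `(u, v)` and takes the value `z` there. -/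
def HasValueAt (P : RatFunc₂) (u v z : ℂ) : Prop :=
  ∃ f g : MvPolynomial (Fin 2) ℚ,
    P * algebraMap (MvPolynomial (Fin 2) ℚ) RatFunc₂ g =
        algebraMap (MvPolynomial (Fin 2) ℚ) RatFunc₂ f ∧
      MvPolynomial.aeval ![u, v] g ≠ 0 ∧
      z = MvPolynomial.aeval ![u, v] f / MvPolynomial.aeval ![u, v] g

/-! ### Nilpotent groups, Lie rings and their normal zeta functions -/

/-- `G` is an infinite torsion-free nilpotent group of nilpotency class exactly two. -/
def IsTorsionFreeClassTwo (G : Type*) [Group G] : Prop :=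
  Infinite G ∧ (∀ g : G, g ≠ 1 → ¬ IsOfFinOrder g) ∧
    ∃ _ : Group.IsNilpotent G, Group.nilpotencyClass G = 2

/-- `L` is the Lie ring associated to the class-two group `G` through Mal'cev bases of length `d`:
`G` is generated by `x₁, …, x_d`, every element is `x₁ ^ n₁ ⋯ x_d ^ n_d` for unique integers `n_k`,
the commutators are `[x_i, x_j] = ∏ x_k ^ a_{ijk}` with only central `x_k` occurring, and `L` is
free over `ℤ` on `e₁, …, e_d` with `(e_i, e_j) = ∑ a_{ijk} e_k`. -/
def IsAssociatedLieRing (d : ℕ) (G L : Type*) [Group G] [LieRing L] : Prop :=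
  ∃ (x : Fin d → G) (e : Module.Basis (Fin d) ℤ L) (a : Fin d → Fin d → Fin d → ℤ),
    Subgroup.closure (Set.range x) = ⊤ ∧
    Function.Bijective (fun n : Fin d → ℤ => (List.ofFn fun k => x k ^ n k).prod) ∧
    (∀ i j, x i * x j * (x i)⁻¹ * (x j)⁻¹ = (List.ofFn fun k => x k ^ a i j k).prod) ∧
    (∀ i j k, a i j k ≠ 0 → x k ∈ Subgroup.center G) ∧
    (∀ i j, ⁅e i, e j⁆ = ∑ k, a i j k • e k)

/-- The local normal zeta function of `G` at `p`, the sum of `|G : H| ^ (-s)` over the normal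
subgroups `H` of `p`-power index, converges absolutely at `s` to `z`. -/
def HasGroupZeta (p : ℕ) (G : Type*) [Group G] (s z : ℂ) : Prop :=
  HasSum (fun H : {H : Subgroup G // H.Normal ∧ ∃ n : ℕ, H.index = p ^ n} =>
    (H.1.index : ℂ) ^ (-s)) z

/-- The local ideal zeta function of `L` at `p`, the sum of `|L : I| ^ (-s)` over the ideals `I` of
`p`-power index, converges absolutely at `s` to `z`. -/
def HasLieZeta (p : ℕ) (L : Type*) [LieRing L] (s z : ℂ) : Prop :=
  HasSum (fun I : {I : LieIdeal ℤ L // ∃ n : ℕ, I.toSubmodule.toAddSubgroup.index = p ^ n} =>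
    (I.1.toSubmodule.toAddSubgroup.index : ℂ) ^ (-s)) z

/-! Since `a₆ = 0`, the plane cubic F is, up to sign, the determinant of a 3 × 3 matrix M(x) of
linear forms (`cubicMatrix`). Let β be the bilinear map with x · β(u, v) = uᵀ M(x) v
(`cubicPairing`). The Lie ring is ℤ⁶ ⊕ ℤ³, where (u, v) and (u', v') have bracket β(u, v') - β(u',
v) in the central ℤ³; the group is the matching central extension of ℤ⁶ by ℤ³. Ideals and normal
subgroups are the same lattices with the same indices (`lieIdealEquiv`, `CubicGroup.normalEquiv`),
so one count serves both.

A lattice in ℤ⁶ ⊕ ℤ³ amounts to its trace Λ on ℤ³, its image J in ℤ⁶ and a homomorphism J → ℤ³/Λ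
(`gluedSubgroup_bijective`). It is an ideal exactly when J lies in X(Λ), the pairs (u, v) central
modulo Λ (`annihilator`). For every J there are |ℤ³ : Λ|⁶ homomorphisms. With T = p^(-s), the zeta
function is therefore ∏ (1 - pⁱT)⁻¹ over i < 6, the zeta function of ℤ⁶, times the sum over Λ of |ℤ³
: Λ|^(6-s) |ℤ⁶ : X(Λ)|^(-s) (`hasGF_fibration`).

That sum is split by the exponent pⁿ of ℤ³/Λ and its number k of generators. If k ≥ 2, the reduction
of Λ modulo p is at most a line, whereas a nonzero u modulo p pairs onto at least a plane; hence
X(Λ) = p X(Λ'), where Λ' = `pDiv p Λ` (`annihilator_eq_pMul`), and linear recursions in n result. If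
k = 1, Λ is given by x · z ≡ 0 modulo pᵃ with x primitive, and X(Λ) consists of the kernels of M(x)
and its transpose modulo pᵃ. Smoothness modulo p keeps the corank of M(x) at most one, so the index
of X(Λ) depends only on the valuation of F(x) truncated at a (`indexExp_annihilator_dvdLattice`).
Hensel lifting counts the x with each valuation from |E(𝔽_p)| alone (`card_lift_zeros`).

Geometric summation gives an explicit rational function of p and T, affine in |E(𝔽_p)|
(`zetaValue_eq`). -/

/-! ### Weighted generating functions -/

/-- On the disc of radius `r` the series `∑ c x * T ^ w x` over `X` converges to `g T`. -/
def HasGF (r : ℝ) {X : Type*} (c w : X → ℕ) (g : ℂ → ℂ) : Prop :=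
  ∀ T : ℂ, ‖T‖ < r → HasSum (fun x => (c x : ℂ) * T ^ w x) (g T)

theorem hasSum_re_of_ofReal {X : Type*} {f : X → ℝ} {a : ℂ}
    (h : HasSum (fun x => (f x : ℂ)) a) : HasSum f a.re := by
  simpa using Complex.hasSum_re h

/-- The coefficients are nonnegative, so the hypotheses at the real point `‖T‖` yield absolute
summability over the total space. This is why `HasGF` speaks of a whole disc. -/
theorem HasGF.sigma {r : ℝ} {ι : Type*} {κ : ι → Type*} {c w : (Σ i, κ i) → ℕ}
    {g : ι → ℂ → ℂ} {G : ℂ → ℂ}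
    (h : ∀ i, HasGF r (fun k => c ⟨i, k⟩) (fun k => w ⟨i, k⟩) (g i))
    (hG : ∀ T : ℂ, ‖T‖ < r → HasSum (fun i => g i T) (G T)) : HasGF r c w G := by
  intro T hT
  have hT' : ‖((‖T‖ : ℝ) : ℂ)‖ < r := by simpa using hT
  have hs : Summable (fun x : Σ i, κ i => ‖(c x : ℂ) * T ^ w x‖) := by
    have key : ∀ i, HasSum (fun k => ‖(c ⟨i, k⟩ : ℂ) * T ^ w ⟨i, k⟩‖) (g i (‖T‖ : ℝ)).re := by
      intro i
      apply hasSum_re_of_ofReal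
      have := h i _ hT'
      convert this using 2 with k
      simp
    rw [summable_sigma_of_nonneg (fun _ => norm_nonneg _)]
    refine ⟨fun i => (key i).summable, ?_⟩
    have : Summable fun i => (g i (‖T‖ : ℝ)).re := (Complex.hasSum_re (hG _ hT')).summable
    convert this using 2 with i
    exact (key i).tsum_eq
  have h1 := hs.of_norm.hasSum
  have h2 := h1.sigma (fun i => h i T hT)
  rwa [h2.unique (hG T hT)] at h1

theorem HasGF.equiv {r : ℝ} {X Y : Type*} {c w : X → ℕ} {g : ℂ → ℂ} (e : Y ≃ X)
    (h : HasGF r c w g) : HasGF r (c ∘ e) (w ∘ e) g :=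
  fun T hT => (e.hasSum_iff (f := fun x => (c x : ℂ) * T ^ w x)).2 (h T hT)

theorem HasGF.congr {r : ℝ} {X : Type*} {c w c' w' : X → ℕ} {g g' : ℂ → ℂ} (h : HasGF r c w g)
    (hc : ∀ x, c' x = c x) (hw : ∀ x, w' x = w x) (hg : ∀ T, g' T = g T) : HasGF r c' w' g' := by
  obtain rfl := funext hc
  obtain rfl := funext hw
  obtain rfl := funext hg
  exact h

theorem HasGF.mono {r r' : ℝ} {X : Type*} {c w : X → ℕ} {g : ℂ → ℂ} (h : HasGF r c w g)
    (hr : r' ≤ r) : HasGF r' c w g :=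
  fun T hT => h T (hT.trans_le hr)

/-! ### Subgroups of a product of two abelian groups -/

section Fibration

variable {A C : Type*} [AddCommGroup A] [AddCommGroup C]

/-- The subgroup of `A × C` with image `J` in `A`, trace `Λ` on `C` and gluing map `φ`. -/
def gluedSubgroup (J : AddSubgroup A) (Λ : AddSubgroup C) (φ : J →+ C ⧸ Λ) :
    AddSubgroup (A × C) where
  carrier := {x | ∃ h : x.1 ∈ J, φ ⟨x.1, h⟩ = (x.2 : C ⧸ Λ)}
  zero_mem' := ⟨J.zero_mem, by
    have : (⟨(0 : A × C).1, J.zero_mem⟩ : J) = 0 := rfl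
    rw [this]; simp⟩
  add_mem' := by
    rintro x y ⟨hx, hx'⟩ ⟨hy, hy'⟩
    refine ⟨J.add_mem hx hy, ?_⟩
    have : (⟨(x + y).1, J.add_mem hx hy⟩ : J) = ⟨x.1, hx⟩ + ⟨y.1, hy⟩ := rfl
    rw [this, map_add, hx', hy']; rfl
  neg_mem' := by
    rintro x ⟨hx, hx'⟩
    refine ⟨J.neg_mem hx, ?_⟩
    have : (⟨(-x).1, J.neg_mem hx⟩ : J) = -⟨x.1, hx⟩ := rfl
    rw [this, map_neg, hx']; rfl

theorem mem_gluedSubgroup {J : AddSubgroup A} {Λ : AddSubgroup C} {φ : J →+ C ⧸ Λ} {x : A × C} :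
    x ∈ gluedSubgroup J Λ φ ↔ ∃ h : x.1 ∈ J, φ ⟨x.1, h⟩ = (x.2 : C ⧸ Λ) := Iff.rfl

theorem gluedSubgroup_map_fst (J : AddSubgroup A) (Λ : AddSubgroup C) (φ : J →+ C ⧸ Λ) :
    (gluedSubgroup J Λ φ).map (AddMonoidHom.fst A C) = J := by
  ext a
  constructor
  · rintro ⟨x, ⟨h, -⟩, rfl⟩; exact h
  · intro h
    obtain ⟨c, hc⟩ := QuotientAddGroup.mk_surjective (φ ⟨a, h⟩)
    exact ⟨(a, c), ⟨h, hc.symm⟩, rfl⟩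

theorem gluedSubgroup_comap_inr (J : AddSubgroup A) (Λ : AddSubgroup C) (φ : J →+ C ⧸ Λ) :
    (gluedSubgroup J Λ φ).comap (AddMonoidHom.inr A C) = Λ := by
  ext c
  simp only [AddSubgroup.mem_comap, mem_gluedSubgroup, AddMonoidHom.inr_apply]
  have : (⟨0, J.zero_mem⟩ : J) = 0 := rfl
  simp only [J.zero_mem, this, map_zero, exists_true_left]
  rw [eq_comm, QuotientAddGroup.eq_zero_iff]

/-- A Goursat-type description: an element `a` of the image has a lift `(a, c)` in `I`, with `c`
unique modulo the trace `Λ`, and `a ↦ c` is the gluing map. -/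
theorem gluedSubgroup_bijective : Function.Bijective
    (fun t : Σ Λ : AddSubgroup C, Σ J : AddSubgroup A, J →+ C ⧸ Λ =>
      gluedSubgroup t.2.1 t.1 t.2.2) := by
  constructor
  · rintro ⟨Λ, J, φ⟩ ⟨Λ', J', φ'⟩ h
    dsimp only at h
    obtain rfl : Λ = Λ' := by
      rw [← gluedSubgroup_comap_inr J Λ φ, h, gluedSubgroup_comap_inr]
    obtain rfl : J = J' := by
      rw [← gluedSubgroup_map_fst J Λ φ, h, gluedSubgroup_map_fst]
    congr 2
    ext ⟨a, ha⟩
    obtain ⟨c, hc⟩ := QuotientAddGroup.mk_surjective (φ ⟨a, ha⟩)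
    have h1 : (a, c) ∈ gluedSubgroup J Λ φ := ⟨ha, hc.symm⟩
    rw [h] at h1
    obtain ⟨_, h2⟩ := h1
    exact hc.symm.trans h2.symm
  · intro I
    let Λ := I.comap (AddMonoidHom.inr A C)
    let J := I.map (AddMonoidHom.fst A C)
    have hc : ∀ a : J, ∃ c, ((a : A), c) ∈ I := by
      rintro ⟨a, ⟨x, hx, rfl⟩⟩
      exact ⟨x.2, hx⟩
    choose c hc using hc
    have hmk : ∀ (a : J) (d : C), ((a : A), d) ∈ I ↔ ((c a : C) : C ⧸ Λ) = (d : C ⧸ Λ) := by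
      intro a d
      rw [QuotientAddGroup.eq]
      have : (0, -c a + d) = -((a : A), c a) + ((a : A), d) := by simp
      change _ ↔ (0, -c a + d) ∈ I
      rw [this]
      exact (AddSubgroup.add_mem_cancel_left I (I.neg_mem (hc a))).symm
    refine ⟨⟨Λ, J, AddMonoidHom.mk' (fun a => ((c a : C) : C ⧸ Λ)) ?_⟩, ?_⟩
    · intro a b
      rw [← QuotientAddGroup.mk_add, ← hmk]
      exact I.add_mem (hc a) (hc b)
    · ext ⟨a, d⟩
      rw [mem_gluedSubgroup]
      constructor
      · rintro ⟨h, h'⟩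
        exact (hmk ⟨a, h⟩ d).2 h'
      · intro h
        exact ⟨⟨_, h, rfl⟩, (hmk ⟨a, ⟨_, h, rfl⟩⟩ d).1 h⟩

/-- Pass through `I + C`: the index above it is that of the image, and by the second isomorphism
theorem the index of `I` in it is that of the trace. -/
theorem index_eq_map_fst_mul_comap_inr (I : AddSubgroup (A × C)) :
    I.index = (I.map (AddMonoidHom.fst A C)).index * (I.comap (AddMonoidHom.inr A C)).index := by
  have hr : (AddMonoidHom.inr A C).range = (AddMonoidHom.fst A C).ker := by
    ext x
    simp only [AddMonoidHom.mem_range, AddMonoidHom.mem_ker, AddMonoidHom.inr_apply]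
    exact ⟨by rintro ⟨y, rfl⟩; rfl, fun h => ⟨x.2, Prod.ext h.symm rfl⟩⟩
  rw [AddSubgroup.index_map, AddSubgroup.index_comap, hr,
    AddMonoidHom.range_eq_top.2 Prod.fst_surjective, AddSubgroup.index_top, mul_one, mul_comm,
    ← AddSubgroup.relIndex_mul_index (le_sup_left : I ≤ I ⊔ (AddMonoidHom.fst A C).ker),
    AddSubgroup.relIndex_sup_left]

theorem gluedSubgroup_index (J : AddSubgroup A) (Λ : AddSubgroup C) (φ : J →+ C ⧸ Λ) :
    (gluedSubgroup J Λ φ).index = J.index * Λ.index := by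
  rw [index_eq_map_fst_mul_comap_inr, gluedSubgroup_map_fst, gluedSubgroup_comap_inr]

end Fibration

/-! ### Counting subgroups of `p`-power index -/

/-- `H` has `p`-power index. -/
def HasPIndex (p : ℕ) {A : Type*} [AddGroup A] (H : AddSubgroup A) : Prop :=
  ∃ n : ℕ, H.index = p ^ n

/-- The exponent of `p` in the index of `H`. -/
noncomputable def indexExp (p : ℕ) {A : Type*} [AddGroup A] (H : AddSubgroup A) : ℕ :=
  padicValNat p H.index

theorem indexExp_map_equiv {p : ℕ} {A B : Type*} [AddCommGroup A] [AddCommGroup B] (e : A ≃+ B)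
    (H : AddSubgroup A) : indexExp p (H.map e.toAddMonoidHom) = indexExp p H := by
  rw [indexExp, indexExp, AddSubgroup.index_map_of_bijective e.bijective]

theorem HasGF.subgroups_congr {p : ℕ} {A B : Type*} [AddCommGroup A] [AddCommGroup B]
    {r : ℝ} {g : ℂ → ℂ} (e : A ≃+ B)
    (h : HasGF r (fun _ : {H : AddSubgroup B // HasPIndex p H} => 1) (fun H => indexExp p H.1) g) :
    HasGF r (fun _ : {H : AddSubgroup A // HasPIndex p H} => 1) (fun H => indexExp p H.1) g := by
  let E : {H : AddSubgroup A // HasPIndex p H} ≃ {H : AddSubgroup B // HasPIndex p H} :=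
    e.mapAddSubgroup.toEquiv.subtypeEquiv fun H => by
      change _ ↔ HasPIndex p (H.map e.toAddMonoidHom)
      rw [HasPIndex, HasPIndex, AddSubgroup.index_map_of_bijective e.bijective]
  exact (h.equiv E).congr (fun _ => rfl) (fun H => (indexExp_map_equiv e H.1).symm) (fun _ => rfl)

section PIndex

variable {p : ℕ} [hp : Fact p.Prime] {A B C : Type*} [AddCommGroup A] [AddCommGroup B]
  [AddCommGroup C]

theorem indexExp_eq {H : AddSubgroup A} {n : ℕ} (h : H.index = p ^ n) : indexExp p H = n := by
  rw [indexExp, h, padicValNat.prime_pow]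

theorem HasPIndex.index_eq {H : AddSubgroup A} (h : HasPIndex p H) :
    H.index = p ^ indexExp p H := by
  obtain ⟨n, hn⟩ := h
  rw [indexExp_eq hn, hn]

theorem HasPIndex.index_ne_zero {H : AddSubgroup A} (h : HasPIndex p H) : H.index ≠ 0 := by
  rw [h.index_eq]; exact pow_ne_zero _ hp.out.ne_zero

theorem HasPIndex.of_dvd {H : AddSubgroup A} {n : ℕ} (h : H.index ∣ p ^ n) : HasPIndex p H := by
  obtain ⟨k, -, hk⟩ := (Nat.dvd_prime_pow hp.out).1 h
  exact ⟨k, hk⟩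

theorem indexExp_eq_add {H : AddSubgroup A} {K : AddSubgroup B} {D : AddSubgroup C}
    (hK : HasPIndex p K) (hD : HasPIndex p D) (h : H.index = K.index * D.index) :
    indexExp p H = indexExp p K + indexExp p D := by
  apply indexExp_eq
  rw [h, hK.index_eq, hD.index_eq, pow_add]

theorem hasPIndex_and_of_mul {H : AddSubgroup A} {K : AddSubgroup B} {D : AddSubgroup C}
    (h : H.index = K.index * D.index) : HasPIndex p H ↔ HasPIndex p K ∧ HasPIndex p D := by
  constructor
  · rintro ⟨n, hn⟩
    rw [h] at hn
    exact ⟨.of_dvd (Dvd.intro _ hn), .of_dvd (Dvd.intro_left _ hn)⟩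
  · rintro ⟨⟨n, hn⟩, ⟨m, hm⟩⟩
    exact ⟨n + m, by rw [h, hn, hm, pow_add]⟩

/-- Counts gluing maps. A finite-index `J` is again free of rank `n`, so the count will not depend
on `J`. -/
theorem card_addMonoidHom_of_free {n : ℕ} (e : A ≃+ (Fin n → ℤ)) (Q : Type*) [AddCommGroup Q] :
    Nat.card (A →+ Q) = Nat.card Q ^ n := by
  let b : Module.Basis (Fin n) ℤ A := Module.Basis.ofEquivFun e.toIntLinearEquiv
  rw [← Nat.card_congr (addMonoidHomLequivInt (A := A) (B := Q) ℤ).symm.toEquiv,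
    ← Nat.card_congr (b.constr ℤ (M' := Q)).toEquiv, Nat.card_fun]
  simp

theorem finite_addMonoidHom_of_free {n : ℕ} (e : A ≃+ (Fin n → ℤ)) (Q : Type*) [AddCommGroup Q]
    [Finite Q] : Finite (A →+ Q) := by
  apply Nat.finite_of_card_ne_zero
  rw [card_addMonoidHom_of_free e]
  exact pow_ne_zero _ Nat.card_pos.ne'

theorem nonempty_addEquiv_of_index_ne_zero {n : ℕ} (e : A ≃+ (Fin n → ℤ)) {H : AddSubgroup A}
    (h : H.index ≠ 0) : Nonempty (H ≃+ (Fin n → ℤ)) := by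
  have h' : (H.map e.toAddMonoidHom).index ≠ 0 := by
    rwa [AddSubgroup.index_map_of_bijective e.bijective]
  obtain ⟨f⟩ := Int.addSubgroup_index_ne_zero_iff.1 h'
  exact ⟨(e.addSubgroupMap H).trans f⟩

/-- Transport of a count of subgroups along an inclusion `X ≤ A`. -/
theorem HasGF.subgroups_le {r : ℝ} {g : ℂ → ℂ} {X : AddSubgroup A} (hX : HasPIndex p X)
    (h : HasGF r (fun _ : {H : AddSubgroup X // HasPIndex p H} => 1) (fun H => indexExp p H.1) g) :
    HasGF r (fun _ : {H : AddSubgroup A // HasPIndex p H ∧ H ≤ X} => 1)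
      (fun H => indexExp p H.1) (fun T => T ^ indexExp p X * g T) := by
  have hidx : ∀ H : AddSubgroup X, (H.map X.subtype).index = H.index * X.index := by
    intro H
    rw [AddSubgroup.index_map_of_injective H X.subtype_injective, X.range_subtype]
  let e : {H : AddSubgroup X // HasPIndex p H} ≃ {H : AddSubgroup A // HasPIndex p H ∧ H ≤ X} :=
    Equiv.ofBijective (fun H => ⟨H.1.map X.subtype,
      (hasPIndex_and_of_mul (hidx H.1)).2 ⟨H.2, hX⟩, AddSubgroup.map_subtype_le _⟩) <| by
      constructor
      · intro H K hHK
        exact Subtype.ext (AddSubgroup.map_injective X.subtype_injective (Subtype.ext_iff.1 hHK))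
      · rintro ⟨H, hH, hle⟩
        have hmap : (H.addSubgroupOf X).map X.subtype = H := by
          rw [AddSubgroup.addSubgroupOf_map_subtype, inf_eq_left.2 hle]
        refine ⟨⟨H.addSubgroupOf X, ?_⟩, Subtype.ext hmap⟩
        have := hidx (H.addSubgroupOf X)
        rw [hmap] at this
        exact ((hasPIndex_and_of_mul this).1 hH).1
  intro T hT
  rw [← e.hasSum_iff]
  refine ((h T hT).mul_left (T ^ indexExp p X)).congr_fun fun H => ?_
  have : indexExp p (e H).1 = indexExp p H.1 + indexExp p X :=
    indexExp_eq_add H.2 hX (hidx H.1)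
  simp [this, pow_add, mul_comm]

theorem hasPIndex_gluedSubgroup_iff (J : AddSubgroup A) (Λ : AddSubgroup C) (φ : J →+ C ⧸ Λ) :
    HasPIndex p (gluedSubgroup J Λ φ) ↔ HasPIndex p J ∧ HasPIndex p Λ :=
  hasPIndex_and_of_mul (K := J) (D := Λ) (gluedSubgroup_index J Λ φ)

/-- Subgroups of `A × C` of `p`-power index whose image in `A` is bounded in terms of their trace
on `C`, described by gluing data. -/
noncomputable def gluedEquiv (X : AddSubgroup C → AddSubgroup A) :
    (Σ Λ : {Λ : AddSubgroup C // HasPIndex p Λ},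
      Σ J : {J : AddSubgroup A // HasPIndex p J ∧ J ≤ X Λ.1}, J.1 →+ C ⧸ Λ.1) ≃
      {I : AddSubgroup (A × C) // HasPIndex p I ∧
        I.map (AddMonoidHom.fst A C) ≤ X (I.comap (AddMonoidHom.inr A C))} :=
  Equiv.ofBijective (fun t => ⟨gluedSubgroup t.2.1.1 t.1.1 t.2.2,
        (hasPIndex_gluedSubgroup_iff _ _ _).2 ⟨t.2.1.2.1, t.1.2⟩, by
          rw [gluedSubgroup_map_fst, gluedSubgroup_comap_inr]; exact t.2.1.2.2⟩) <| by
    constructor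
    · rintro ⟨⟨Λ, hΛ⟩, ⟨J, hJ⟩, φ⟩ ⟨⟨Λ', hΛ'⟩, ⟨J', hJ'⟩, φ'⟩ h
      have h0 : gluedSubgroup J Λ φ = gluedSubgroup J' Λ' φ' := congrArg Subtype.val h
      have := @gluedSubgroup_bijective A C _ _ |>.1 (a₁ := ⟨Λ, J, φ⟩) (a₂ := ⟨Λ', J', φ'⟩) h0
      cases this
      rfl
    · rintro ⟨I, hI, hle⟩
      obtain ⟨⟨Λ, J, φ⟩, rfl⟩ := gluedSubgroup_bijective.2 I
      dsimp only at hI hle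
      rw [gluedSubgroup_map_fst, gluedSubgroup_comap_inr] at hle
      rw [hasPIndex_gluedSubgroup_iff] at hI
      exact ⟨⟨⟨Λ, hI.2⟩, ⟨J, hI.1, hle⟩, φ⟩, rfl⟩

/-- The generating function of the subgroups `I` of `A × C` whose image in `A` lies in `X Λ`, where
`Λ` is the trace of `I` on `C`. -/
theorem hasGF_fibration {n : ℕ} (eA : A ≃+ (Fin n → ℤ)) {r : ℝ} {z g : ℂ → ℂ}
    (X : AddSubgroup C → AddSubgroup A) (hX : ∀ Λ, HasPIndex p Λ → HasPIndex p (X Λ))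
    (hz : ∀ (B : AddSubgroup A), HasPIndex p B →
      HasGF r (fun _ : {H : AddSubgroup B // HasPIndex p H} => 1) (fun H => indexExp p H.1) z)
    (hg : HasGF r (fun Λ : {Λ : AddSubgroup C // HasPIndex p Λ} => p ^ (n * indexExp p Λ.1))
      (fun Λ => indexExp p Λ.1 + indexExp p (X Λ.1)) g) :
    HasGF r (fun _ : {I : AddSubgroup (A × C) // HasPIndex p I ∧
        I.map (AddMonoidHom.fst A C) ≤ X (I.comap (AddMonoidHom.inr A C))} => 1)
      (fun I => indexExp p I.1) (fun T => g T * z T) := by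
  let E := gluedEquiv (p := p) X
  have main : HasGF r (fun _ : (Σ Λ : {Λ : AddSubgroup C // HasPIndex p Λ},
      Σ J : {J : AddSubgroup A // HasPIndex p J ∧ J ≤ X Λ.1}, J.1 →+ C ⧸ Λ.1) => 1)
      (fun t => indexExp p t.1.1 + indexExp p t.2.1.1) (fun T => g T * z T) := by
    refine HasGF.sigma
      -- The gluing maps are summed innermost, then `J`, then `Λ`; the sum over `J ≤ X Λ` is the
      -- zeta function `z` of a lattice, shifted by the index of `X Λ`.
      (g := fun Λ T => (p : ℂ) ^ (n * indexExp p Λ.1) * T ^ indexExp p Λ.1 *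
        (T ^ indexExp p (X Λ.1) * z T)) (fun Λ => ?_) (fun T hT => ?_)
    · refine HasGF.sigma
        (g := fun J T => (p : ℂ) ^ (n * indexExp p Λ.1) * T ^ indexExp p Λ.1 *
          T ^ indexExp p J.1) (fun J => ?_) (fun T hT => ?_)
      · intro T hT
        obtain ⟨eJ⟩ := nonempty_addEquiv_of_index_ne_zero eA J.2.1.index_ne_zero
        have : Finite (C ⧸ Λ.1) :=
          @AddSubgroup.finite_quotient_of_finiteIndex _ _ _ ⟨Λ.2.index_ne_zero⟩
        have := finite_addMonoidHom_of_free eJ (C ⧸ Λ.1)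
        have := Fintype.ofFinite (J.1 →+ C ⧸ Λ.1)
        have hc : Fintype.card (J.1 →+ C ⧸ Λ.1) = p ^ (n * indexExp p Λ.1) := by
          rw [← Nat.card_eq_fintype_card, card_addMonoidHom_of_free eJ,
            ← AddSubgroup.index_eq_card, Λ.2.index_eq, ← pow_mul, mul_comm]
        have hs := hasSum_fintype (fun _ : J.1 →+ C ⧸ Λ.1 =>
          ((1 : ℕ) : ℂ) * T ^ (indexExp p Λ.1 + indexExp p J.1))
        rw [Finset.sum_const, Finset.card_univ, hc] at hs
        convert hs using 1
        simp [pow_add, mul_assoc]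
      · have := ((hz (X Λ.1) (hX _ Λ.2)).subgroups_le (hX _ Λ.2)) T hT
        refine (this.mul_left ((p : ℂ) ^ (n * indexExp p Λ.1) * T ^ indexExp p Λ.1)).congr_fun
          fun J => ?_
        simp
    · refine ((hg T hT).mul_right (z T)).congr_fun fun Λ => ?_
      push_cast
      ring
  refine (main.equiv E.symm).congr (fun _ => rfl) (fun I => ?_) (fun _ => rfl)
  obtain ⟨t, rfl⟩ := E.surjective I
  have ht : indexExp p (E t).1 = indexExp p t.2.1.1 + indexExp p t.1.1 :=
    indexExp_eq_add t.2.1.2.1 t.1.2 (gluedSubgroup_index _ _ _)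
  rw [ht, Function.comp_apply, E.symm_apply_apply, add_comm]

/-- The subgroup `p ^ k ℤ` contributes `(p ^ n T) ^ k`. The zero summand `indexExp p ⊤` gives the
statement the shape that `hasGF_fibration` expects for the constant bound `X = ⊤`. -/
theorem hasGF_int_subgroups (n : ℕ) :
    HasGF (((p : ℝ) ^ n)⁻¹) (fun Λ : {Λ : AddSubgroup ℤ // HasPIndex p Λ} =>
      p ^ (n * indexExp p Λ.1)) (fun Λ => indexExp p Λ.1 +
        indexExp p (⊤ : AddSubgroup A)) (fun T => (1 - (p : ℂ) ^ n * T)⁻¹) := by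
  have hz : ∀ k : ℕ, (AddSubgroup.zmultiples ((p : ℤ) ^ k)).index = p ^ k := by
    intro k
    rw [Int.index_zmultiples, Int.natAbs_pow, Int.natAbs_natCast]
  let E : ℕ ≃ {Λ : AddSubgroup ℤ // HasPIndex p Λ} :=
    Equiv.ofBijective (fun k => ⟨AddSubgroup.zmultiples ((p : ℤ) ^ k), k, hz k⟩) <| by
      constructor
      · intro k l hkl
        have := congrArg (fun H => H.1.index) hkl
        simp only [hz] at this
        exact Nat.pow_right_injective hp.out.two_le this
      · rintro ⟨Λ, k, hk⟩
        refine ⟨k, Subtype.ext ?_⟩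
        change AddSubgroup.zmultiples ((p : ℤ) ^ k) = Λ
        obtain ⟨a, rfl⟩ := Int.subgroup_cyclic Λ
        rw [← AddSubgroup.zmultiples_eq_closure] at hk ⊢
        rw [Int.index_zmultiples] at hk
        rw [← Int.zmultiples_natAbs a, hk]
        push_cast
        rfl
  intro T hT
  rw [← E.hasSum_iff]
  have hlt : ‖(p : ℂ) ^ n * T‖ < 1 := by
    have hpos : (0 : ℝ) < (p : ℝ) ^ n := pow_pos (by exact_mod_cast hp.out.pos) _
    rw [norm_mul, norm_pow, Complex.norm_natCast]
    rwa [mul_comm, ← lt_div_iff₀ hpos, one_div]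
  refine (hasSum_geometric_of_norm_lt_one hlt).congr_fun fun k => ?_
  have h1 : indexExp p (E k).1 = k := indexExp_eq (hz k)
  have h2 : indexExp p (⊤ : AddSubgroup A) = 0 := by simp [indexExp]
  simp [h1, h2, mul_pow, pow_mul]

/-- The local zeta function of `ℤⁿ`. Fibring `ℤⁿ⁺¹ = ℤⁿ × ℤ` with no restriction on the image adds
the factor `(1 - pⁿ T)⁻¹`. -/
theorem hasGF_subgroups (n : ℕ) : ∀ {A : Type} [AddCommGroup A] (_ : A ≃+ (Fin n → ℤ)),
    HasGF (((p : ℝ) ^ n)⁻¹) (fun _ : {H : AddSubgroup A // HasPIndex p H} => 1)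
      (fun H => indexExp p H.1) (fun T => ∏ i ∈ Finset.range n, (1 - (p : ℂ) ^ i * T)⁻¹) := by
  induction n with
  | zero =>
    intro A _ e T hT
    have : Subsingleton A := e.toEquiv.subsingleton
    have hu : ∀ H : {H : AddSubgroup A // HasPIndex p H}, H = ⟨⊤, 0, by simp⟩ :=
      fun H => Subtype.ext (Subsingleton.elim _ _)
    let : Unique {H : AddSubgroup A // HasPIndex p H} := ⟨⟨⟨⊤, 0, by simp⟩⟩, hu⟩
    have hs := hasSum_unique (fun H : {H : AddSubgroup A // HasPIndex p H} =>
      ((1 : ℕ) : ℂ) * T ^ indexExp p H.1)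
    rw [hu default] at hs
    simpa [indexExp] using hs
  | succ n ih =>
    intro A _ e
    have hle : ((p : ℝ) ^ (n + 1))⁻¹ ≤ ((p : ℝ) ^ n)⁻¹ := by
      have hp1 : (1 : ℝ) ≤ p := by exact_mod_cast hp.out.one_le
      gcongr
      · exact n.le_succ
    let e' : A ≃+ (Fin n → ℤ) × ℤ := e.trans
      { (Fin.snocEquiv (n := n) (fun _ => ℤ)).symm.trans (Equiv.prodComm _ _) with
        map_add' := fun _ _ => rfl }
    refine HasGF.subgroups_congr e' ?_
    have := hasGF_fibration (p := p) (AddEquiv.refl (Fin n → ℤ)) (C := ℤ) (fun _ => ⊤)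
      (fun _ _ => ⟨0, by simp⟩)
      (fun B hB => ih (nonempty_addEquiv_of_index_ne_zero (AddEquiv.refl _)
        hB.index_ne_zero).some) (hasGF_int_subgroups n)
    let E : {I : AddSubgroup ((Fin n → ℤ) × ℤ) // HasPIndex p I} ≃
        {I : AddSubgroup ((Fin n → ℤ) × ℤ) // HasPIndex p I ∧
        I.map (AddMonoidHom.fst (Fin n → ℤ) ℤ) ≤ ⊤} :=
      Equiv.subtypeEquivRight fun I => by simp
    refine ((this.equiv E).mono hle).congr (fun _ => rfl) (fun _ => rfl) (fun T => ?_)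
    rw [Finset.prod_range_succ, mul_comm]

end PIndex

/-! ### Division of lattices by `p` -/

section Lattice

variable {A : Type*} [AddCommGroup A]

/-- The elements `z` with `p • z ∈ Φ`. -/
def pDiv (p : ℕ) (Φ : AddSubgroup A) : AddSubgroup A := Φ.comap (nsmulAddMonoidHom p)

/-- The multiples `p • z` with `z ∈ Λ`. -/
def pMul (p : ℕ) (Λ : AddSubgroup A) : AddSubgroup A := Λ.map (nsmulAddMonoidHom p)

/-- The index of `Φ + p A` in `A`. -/
noncomputable def residueIndex (p : ℕ) (Φ : AddSubgroup A) : ℕ := (Φ ⊔ pMul p ⊤).index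

theorem mem_pDiv {p : ℕ} {Φ : AddSubgroup A} {z : A} : z ∈ pDiv p Φ ↔ p • z ∈ Φ := Iff.rfl

theorem le_pDiv (p : ℕ) (Φ : AddSubgroup A) : Φ ≤ pDiv p Φ := fun _ hz => Φ.nsmul_mem hz p

theorem pMul_mono {p : ℕ} {Φ Λ : AddSubgroup A} (h : Φ ≤ Λ) : pMul p Φ ≤ pMul p Λ :=
  AddSubgroup.map_mono h

theorem pMul_le (p : ℕ) (Λ : AddSubgroup A) : pMul p Λ ≤ Λ := by
  rintro _ ⟨z, hz, rfl⟩
  exact Λ.nsmul_mem hz p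

theorem pMul_pDiv (p : ℕ) (Φ : AddSubgroup A) : pMul p (pDiv p Φ) = Φ ⊓ pMul p ⊤ := by
  rw [pMul, pDiv, AddSubgroup.map_comap_eq, pMul, ← AddMonoidHom.range_eq_map, inf_comm]

/-- `(Φ + pA)/Φ` is isomorphic to `pA/(Φ ∩ pA)`, and multiplication by `p` identifies the latter
with `A / pDiv p Φ`. -/
theorem index_eq_residueIndex_mul (p : ℕ) (Φ : AddSubgroup A) :
    Φ.index = residueIndex p Φ * (pDiv p Φ).index := by
  rw [pDiv, AddSubgroup.index_comap, residueIndex,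
    ← AddSubgroup.relIndex_mul_index (le_sup_left : Φ ≤ Φ ⊔ pMul p ⊤),
    AddSubgroup.relIndex_sup_left, mul_comm, pMul, AddMonoidHom.range_eq_map]

theorem residueIndex_dvd (p : ℕ) (Φ : AddSubgroup A) :
    residueIndex p Φ ∣ (pMul p (⊤ : AddSubgroup A)).index :=
  AddSubgroup.index_dvd_of_le le_sup_right

variable {p : ℕ} [hp : Fact p.Prime]

theorem index_pMul_top {n : ℕ} (e : A ≃+ (Fin n → ℤ)) :
    (pMul p (⊤ : AddSubgroup A)).index = p ^ n := by
  have : Module.Free ℤ A := Module.Free.of_equiv e.toIntLinearEquiv.symm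
  have : Module.Finite ℤ A := Module.Finite.equiv e.toIntLinearEquiv.symm
  have hr : Module.finrank ℤ A = n := by
    rw [e.toIntLinearEquiv.finrank_eq]; simp
  have h := ModN.natCard_eq A p
  rw [hr] at h
  rw [← h, AddSubgroup.index_eq_card]
  refine Nat.card_congr (QuotientAddGroup.quotientAddEquivOfEq ?_).toEquiv
  ext z
  simp [pMul]

theorem nsmul_injective_of_equiv {n : ℕ} (e : A ≃+ (Fin n → ℤ)) :
    Function.Injective (nsmulAddMonoidHom p : A →+ A) := by
  intro x y h
  apply e.injective
  have h' := congrArg e h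
  simp only [nsmulAddMonoidHom_apply, map_nsmul] at h'
  exact smul_right_injective _ hp.out.ne_zero h'

theorem pDiv_pMul {n : ℕ} (e : A ≃+ (Fin n → ℤ)) (Λ : AddSubgroup A) : pDiv p (pMul p Λ) = Λ :=
  AddSubgroup.comap_map_eq_self_of_injective (nsmul_injective_of_equiv e) Λ

theorem index_pMul {n : ℕ} (e : A ≃+ (Fin n → ℤ)) (Λ : AddSubgroup A) :
    (pMul p Λ).index = p ^ n * Λ.index := by
  rw [pMul, AddSubgroup.index_map_of_injective _ (nsmul_injective_of_equiv e),
    AddMonoidHom.range_eq_map, mul_comm]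
  congr 1
  exact index_pMul_top e

theorem HasPIndex.pow_nsmul_mem {Λ : AddSubgroup A} (h : HasPIndex p Λ) (z : A) :
    p ^ indexExp p Λ • z ∈ Λ := by
  rw [← h.index_eq]
  exact AddSubgroup.nsmul_index_mem Λ z

theorem HasPIndex.pDiv {Φ : AddSubgroup A} (h : HasPIndex p Φ) : HasPIndex p (pDiv p Φ) := by
  obtain ⟨n, hn⟩ := h
  exact .of_dvd (n := n) (hn ▸ Dvd.intro_left _ (index_eq_residueIndex_mul p Φ).symm)

/-- A form of Nakayama's lemma: `Φ + pA = A` makes `Φ` and `pDiv p Φ` equal by comparing indices, so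
the finite `p`-group `A/Φ` has no `p`-torsion. -/
theorem eq_top_of_residueIndex_eq_one {Φ : AddSubgroup A} (h : HasPIndex p Φ)
    (h1 : residueIndex p Φ = 1) : Φ = ⊤ := by
  have hidx : Φ.index = (_root_.pDiv p Φ).index := by
    rw [index_eq_residueIndex_mul p Φ, h1, one_mul]
  have hrel : Φ.relIndex (_root_.pDiv p Φ) = 1 := by
    have := AddSubgroup.relIndex_mul_index (le_pDiv p Φ)
    rw [← hidx] at this
    exact (Nat.mul_eq_right h.index_ne_zero).1 this
  have hle : _root_.pDiv p Φ ≤ Φ := AddSubgroup.relIndex_eq_one.1 hrel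
  have key : ∀ (n : ℕ) (z : A), p ^ n • z ∈ Φ → z ∈ Φ := by
    intro n
    induction n with
    | zero => intro z hz; simpa using hz
    | succ n ih =>
      intro z hz
      rw [pow_succ, mul_smul] at hz
      exact hle (ih _ hz)
  exact top_unique fun z _ => key _ z (h.pow_nsmul_mem z)

theorem residueIndex_eq_pow {n : ℕ} (e : A ≃+ (Fin n → ℤ)) (Φ : AddSubgroup A) :
    ∃ k ≤ n, residueIndex p Φ = p ^ k :=
  (Nat.dvd_prime_pow hp.out).1 (index_pMul_top (p := p) e ▸ residueIndex_dvd p Φ)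

theorem hasPIndex_of_pDiv {n : ℕ} (e : A ≃+ (Fin n → ℤ)) {Φ : AddSubgroup A}
    (h : HasPIndex p (pDiv p Φ)) : HasPIndex p Φ := by
  obtain ⟨k, -, hk⟩ := residueIndex_eq_pow (p := p) e Φ
  obtain ⟨m, hm⟩ := h
  exact ⟨k + m, by rw [index_eq_residueIndex_mul p Φ, hk, hm, pow_add]⟩

theorem indexExp_of_residueIndex {Φ : AddSubgroup A} (h : HasPIndex p (pDiv p Φ)) {k : ℕ}
    (hk : residueIndex p Φ = p ^ k) : indexExp p Φ = k + indexExp p (pDiv p Φ) := by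
  apply indexExp_eq
  rw [index_eq_residueIndex_mul p Φ, hk, h.index_eq, pow_add]

theorem le_pMul_top_iff {n : ℕ} (e : A ≃+ (Fin n → ℤ)) {Φ : AddSubgroup A} :
    Φ ≤ pMul p ⊤ ↔ residueIndex p Φ = p ^ n := by
  rw [residueIndex, ← index_pMul_top (p := p) e]
  constructor
  · intro h
    rw [sup_eq_right.2 h]
  · intro h
    have hne : (pMul p (⊤ : AddSubgroup A)).index ≠ 0 := by
      rw [index_pMul_top (p := p) e]; exact pow_ne_zero _ hp.out.ne_zero
    have := AddSubgroup.relIndex_mul_index (le_sup_right : pMul p ⊤ ≤ Φ ⊔ pMul p ⊤)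
    rw [h] at this
    have h1 := AddSubgroup.relIndex_eq_one.1 ((Nat.mul_eq_right hne).1 this)
    exact le_sup_left.trans h1

/-! ### The level of a lattice -/

/-- `Λ` has exponent exactly `p ^ n`: dividing it by `p` first gives everything after `n` steps. -/
def IsLevel (p : ℕ) : ℕ → AddSubgroup A → Prop
  | 0, Λ => Λ = ⊤
  | n + 1, Λ => IsLevel p n (pDiv p Λ) ∧ Λ ≠ ⊤

theorem IsLevel.unique {p m n : ℕ} {Λ : AddSubgroup A} (hm : IsLevel p m Λ) (hn : IsLevel p n Λ) :
    m = n := by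
  induction m generalizing n Λ with
  | zero =>
    cases n with
    | zero => rfl
    | succ n => exact absurd hm hn.2
  | succ m ih =>
    cases n with
    | zero => exact absurd hn hm.2
    | succ n => rw [ih hm.1 hn.1]

theorem exists_isLevel {Λ : AddSubgroup A} (h : HasPIndex p Λ) : ∃ n, IsLevel p n Λ := by
  have key : ∀ (k : ℕ) (Λ : AddSubgroup A), (∀ z, p ^ k • z ∈ Λ) → ∃ n, IsLevel p n Λ := by
    intro k
    induction k with
    | zero => exact fun Λ h => ⟨0, top_unique fun z _ => by simpa using h z⟩
    | succ k ih =>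
      intro Λ h
      by_cases ht : Λ = ⊤
      · exact ⟨0, ht⟩
      · obtain ⟨n, hn⟩ := ih (pDiv p Λ) fun z => by
          rw [mem_pDiv, ← mul_smul, ← pow_succ']; exact h z
        exact ⟨n + 1, hn, ht⟩
  exact key _ Λ h.pow_nsmul_mem

theorem IsLevel.pow_nsmul_mem {p n : ℕ} {Λ : AddSubgroup A} (h : IsLevel p n Λ) (z : A) :
    p ^ n • z ∈ Λ := by
  induction n generalizing Λ with
  | zero => rw [show Λ = ⊤ from h]; trivial
  | succ n ih => rw [pow_succ', mul_smul]; exact ih h.1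

theorem IsLevel.hasPIndex {m n : ℕ} (e : A ≃+ (Fin m → ℤ)) {Λ : AddSubgroup A}
    (h : IsLevel p n Λ) : HasPIndex p Λ := by
  induction n generalizing Λ with
  | zero => exact ⟨0, by rw [show Λ = ⊤ from h]; simp⟩
  | succ n ih => exact hasPIndex_of_pDiv e (ih h.1)

theorem hasPIndex_of_pow_nsmul_mem {m n : ℕ} (e : A ≃+ (Fin m → ℤ)) {Λ : AddSubgroup A}
    (h : ∀ z, p ^ n • z ∈ Λ) : HasPIndex p Λ := by
  induction n generalizing Λ with
  | zero => exact ⟨0, by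
      rw [show Λ = ⊤ from top_unique fun z _ => by simpa using h z]; simp⟩
  | succ n ih =>
    exact hasPIndex_of_pDiv e (ih fun z => by
      rw [mem_pDiv, ← mul_smul, ← pow_succ']; exact h z)

/-- Lattices of level `n` contain `p ^ n A`, hence come from subgroups of a finite quotient. -/
theorem finite_setOf_isLevel {m : ℕ} (e : A ≃+ (Fin m → ℤ)) (n : ℕ) :
    {Λ : AddSubgroup A | IsLevel p n Λ}.Finite := by
  let N : AddSubgroup A := (nsmulAddMonoidHom (p ^ n) : A →+ A).range
  have hN : HasPIndex p N := hasPIndex_of_pow_nsmul_mem (n := n) e fun z => ⟨z, rfl⟩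
  have : Finite (A ⧸ N) := @AddSubgroup.finite_quotient_of_finiteIndex _ _ _ ⟨hN.index_ne_zero⟩
  have : Finite (AddSubgroup (A ⧸ N)) :=
    Finite.of_injective (fun H : AddSubgroup (A ⧸ N) => (H : Set (A ⧸ N))) SetLike.coe_injective
  refine Set.Finite.of_injOn (f := fun Λ => Λ.map (QuotientAddGroup.mk' N)) (t := Set.univ)
    (fun _ _ => Set.mem_univ _) ?_ Set.finite_univ
  intro Λ hΛ Λ' hΛ' h
  have hle : ∀ {Λ : AddSubgroup A}, IsLevel p n Λ → N ≤ Λ := by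
    rintro Λ hΛ _ ⟨z, rfl⟩
    exact IsLevel.pow_nsmul_mem hΛ z
  have h' := congrArg (AddSubgroup.comap (QuotientAddGroup.mk' N)) h
  simpa [AddSubgroup.comap_map_eq, hle hΛ, hle hΛ'] using h'

/-! ### Lattices with a one-dimensional reduction -/

theorem nsmul_mem_of_coprime {H : AddSubgroup A} {z : A} (hz : p • z ∈ H) {k : ℤ}
    (hk : ¬ (p : ℤ) ∣ k) (h : k • z ∈ H) : z ∈ H := by
  obtain ⟨a, b, hab⟩ : IsCoprime (p : ℤ) k :=
    (Nat.prime_iff_prime_int.1 hp.out).coprime_iff_not_dvd.2 hk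
  have : z = a • (p • z) + b • (k • z) := by
    rw [← natCast_zsmul, smul_smul, smul_smul, ← add_smul, hab, one_smul]
  rw [this]
  exact H.add_mem (H.zsmul_mem hz a) (H.zsmul_mem h b)

/-- The lattices `Φ` with given `pDiv p Φ = Λ` whose reduction modulo `p` is a line. -/
theorem card_setOf_pDiv_eq {n : ℕ} (e : A ≃+ (Fin (n + 1) → ℤ)) {Λ : AddSubgroup A}
    (hΛ : HasPIndex p Λ) :
    {Φ : AddSubgroup A | pDiv p Φ = Λ ∧ residueIndex p Φ = p ^ n}.ncard * (p - 1) =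
      p ^ (n + 1) - residueIndex p Λ := by
  classical
  -- The lattices sought satisfy `Φ ∩ pA = pΛ = N` and `|Φ : N| = p`. They correspond to the lines
  -- of the `𝔽_p`-space `Λ/N` that meet `(Λ ∩ pA)/N` trivially; generators of such lines are
  -- counted, `p - 1` for each line.
  let N := pMul p Λ
  let π := QuotientAddGroup.mk' N
  have hker : π.ker = N := QuotientAddGroup.ker_mk' N
  have hppos := hp.out.pos
  have hNidx : N.index = p ^ (n + 1) * Λ.index := index_pMul e Λ
  have hNne : N.index ≠ 0 := by
    rw [hNidx]; exact mul_ne_zero (pow_ne_zero _ hp.out.ne_zero) hΛ.index_ne_zero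
  have hfin : Finite (A ⧸ N) := @AddSubgroup.finite_quotient_of_finiteIndex _ _ _ ⟨hNne⟩
  have := Fintype.ofFinite (A ⧸ N)
  have hNΛ : N ≤ Λ := pMul_le p Λ
  have hN0 : N ≤ pMul p ⊤ := pMul_mono le_top
  have hcardΛ : Nat.card (Λ.map π) = p ^ (n + 1) := by
    rw [← AddSubgroup.relIndex_ker, hker]
    have := AddSubgroup.relIndex_mul_index hNΛ
    rw [hNidx] at this
    exact Nat.eq_of_mul_eq_mul_right (Nat.pos_of_ne_zero hΛ.index_ne_zero) this
  -- `Λ ∩ pA` is `p` times `pDiv p Λ`, so its quotient by `pΛ` is `pDiv p Λ / Λ`, whose order is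
  -- given by `index_eq_residueIndex_mul`.
  have hcardI : Nat.card ((Λ ⊓ pMul p ⊤).map π) = residueIndex p Λ := by
    rw [← AddSubgroup.relIndex_ker, hker, ← pMul_pDiv]
    have h1 : N.relIndex (pMul p (pDiv p Λ)) = Λ.relIndex (pDiv p Λ) :=
      AddSubgroup.relIndex_map_map_of_injective _ _ (nsmul_injective_of_equiv e)
    rw [h1]
    have := AddSubgroup.relIndex_mul_index (le_pDiv p Λ)
    rw [index_eq_residueIndex_mul p Λ] at this
    exact Nat.eq_of_mul_eq_mul_right (Nat.pos_of_ne_zero hΛ.pDiv.index_ne_zero) this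
  let V : Finset (A ⧸ N) := Finset.univ.filter fun w => w ∈ Λ.map π ∧ w ∉ (Λ ⊓ pMul p ⊤).map π
  have hV : V.card = p ^ (n + 1) - residueIndex p Λ := by
    have h1 : V = (Finset.univ.filter fun w => w ∈ Λ.map π) \
        (Finset.univ.filter fun w => w ∈ (Λ ⊓ pMul p ⊤).map π) := by
      ext w; simp [V]
    have h2 : (Finset.univ.filter fun w => w ∈ (Λ ⊓ pMul p ⊤).map π) ⊆
        (Finset.univ.filter fun w => w ∈ Λ.map π) := by
      intro w
      simp only [Finset.mem_filter, Finset.mem_univ, true_and]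
      exact fun h => AddSubgroup.map_mono inf_le_left h
    rw [h1, Finset.card_sdiff_of_subset h2, ← Fintype.card_subtype, ← Fintype.card_subtype,
      ← Nat.card_eq_fintype_card, ← Nat.card_eq_fintype_card]
    congr 1
  have hVmem : ∀ w ∈ V, ∃ z ∈ Λ, z ∉ pMul p ⊤ ∧ π z = w := by
    intro w hw
    obtain ⟨⟨z, hz, rfl⟩, hw2⟩ := (Finset.mem_filter.1 hw).2
    exact ⟨z, hz, fun h => hw2 ⟨z, ⟨hz, h⟩, rfl⟩, rfl⟩
  let S := {Φ : AddSubgroup A | pDiv p Φ = Λ ∧ residueIndex p Φ = p ^ n}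
  have hSN : ∀ Φ ∈ S, Φ ⊓ pMul p ⊤ = N := fun Φ hΦ => by rw [← pMul_pDiv, hΦ.1]
  have hSle : ∀ Φ ∈ S, N ≤ Φ := fun Φ hΦ => hSN Φ hΦ ▸ inf_le_left
  have hScard : ∀ Φ ∈ S, Nat.card (Φ.map π) = p := by
    intro Φ hΦ
    rw [← AddSubgroup.relIndex_ker, hker]
    have h1 := AddSubgroup.relIndex_mul_index (hSle Φ hΦ)
    rw [hNidx, index_eq_residueIndex_mul p Φ, hΦ.1, hΦ.2, pow_succ', mul_assoc] at h1
    exact Nat.eq_of_mul_eq_mul_right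
      (Nat.mul_pos (pow_pos hppos n) (Nat.pos_of_ne_zero hΛ.index_ne_zero)) h1
  have hScomap : ∀ Φ ∈ S, (Φ.map π).comap π = Φ := by
    intro Φ hΦ
    rw [AddSubgroup.comap_map_eq, hker, sup_eq_left.2 (hSle Φ hΦ)]
  have hSfin : S.Finite := by
    have : Finite (AddSubgroup (A ⧸ N)) :=
      Finite.of_injective (fun H : AddSubgroup (A ⧸ N) => (H : Set (A ⧸ N))) SetLike.coe_injective
    refine Set.Finite.of_injOn (f := fun Φ => Φ.map π) (t := Set.univ)
      (fun _ _ => Set.mem_univ _) ?_ Set.finite_univ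
    intro Φ hΦ Φ' hΦ' h
    rw [← hScomap Φ hΦ, ← hScomap Φ' hΦ', show Φ.map π = Φ'.map π from h]
  let f : A ⧸ N → AddSubgroup A := fun w => (AddSubgroup.zmultiples w).comap π
  have hmaps : ∀ w ∈ V, f w ∈ hSfin.toFinset := by
    intro w hw
    obtain ⟨z, hz, hz0, rfl⟩ := hVmem w hw
    rw [Set.Finite.mem_toFinset]
    have hdiv : pDiv p (f (π z)) = Λ := by
      ext y
      rw [mem_pDiv]
      constructor
      · intro hy
        obtain ⟨k, hk⟩ := AddSubgroup.mem_zmultiples_iff.1 (AddSubgroup.mem_comap.1 hy)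
        have hk' : p • y - k • z ∈ N := by
          rw [← hker, AddMonoidHom.mem_ker, map_sub, map_zsmul, hk, sub_self]
        obtain ⟨l, hl, hl'⟩ := hk'
        have hkz : k • z ∈ pMul p ⊤ := by
          refine ⟨y - l, trivial, ?_⟩
          rw [map_sub, hl']
          simp
        -- If `k` were prime to `p`, then `k z ∈ pA` would put `z` itself into `pA`.
        have hpk : (p : ℤ) ∣ k := by
          by_contra hnd
          exact hz0 (nsmul_mem_of_coprime ⟨z, trivial, rfl⟩ hnd hkz)
        obtain ⟨k', rfl⟩ := hpk
        have : y = k' • z + l := by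
          apply nsmul_injective_of_equiv (p := p) e
          simp only [nsmulAddMonoidHom_apply, smul_add] at hl' ⊢
          rw [hl', ← natCast_zsmul (k' • z), smul_smul]
          abel
        rw [this]
        exact Λ.add_mem (Λ.zsmul_mem hz k') hl
      · intro hy
        have : π (p • y) = 0 := by
          rw [← AddMonoidHom.mem_ker, hker]
          exact ⟨y, hy, rfl⟩
        exact AddSubgroup.mem_comap.2 (this ▸ AddSubgroup.zero_mem _)
    refine ⟨hdiv, ?_⟩
    have hne : π z ≠ 0 := by
      intro h0
      rw [← AddMonoidHom.mem_ker, hker] at h0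
      exact hz0 (hN0 h0)
    have hord : addOrderOf (π z) = p := by
      apply addOrderOf_eq_prime _ hne
      rw [← map_nsmul, ← AddMonoidHom.mem_ker, hker]
      exact ⟨z, hz, rfl⟩
    have h1 : (f (π z)).index = (AddSubgroup.zmultiples (π z)).index :=
      AddSubgroup.index_comap_of_surjective _ (QuotientAddGroup.mk'_surjective N)
    have h2 := AddSubgroup.card_mul_index (AddSubgroup.zmultiples (π z))
    rw [Nat.card_zmultiples, hord, ← h1, ← AddSubgroup.index_eq_card, hNidx,
      index_eq_residueIndex_mul p, hdiv, pow_succ', mul_assoc] at h2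
    exact Nat.eq_of_mul_eq_mul_right (Nat.pos_of_ne_zero hΛ.index_ne_zero)
      (Nat.eq_of_mul_eq_mul_left hppos h2)
  have hfib : ∀ Φ ∈ hSfin.toFinset, (V.filter fun w => f w = Φ).card = p - 1 := by
    intro Φ hΦ
    rw [Set.Finite.mem_toFinset] at hΦ
    have h1 : (V.filter fun w => f w = Φ) =
        (Finset.univ.filter fun w => w ∈ Φ.map π).erase 0 := by
      ext w
      simp only [Finset.mem_filter, Finset.mem_erase, Finset.mem_univ, true_and]
      constructor
      · rintro ⟨hw, rfl⟩
        obtain ⟨z, hz, hz0, rfl⟩ := hVmem w hw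
        refine ⟨fun h0 => ?_, z, ?_, rfl⟩
        · rw [← AddMonoidHom.mem_ker, hker] at h0
          exact hz0 (hN0 h0)
        · exact AddSubgroup.mem_comap.2 (AddSubgroup.mem_zmultiples _)
      · rintro ⟨hw0, z, hz, rfl⟩
        have hz0 : z ∉ pMul p ⊤ := by
          intro h
          apply hw0
          rw [← AddMonoidHom.mem_ker, hker, ← hSN Φ hΦ]
          exact ⟨hz, h⟩
        refine ⟨Finset.mem_filter.2 ⟨Finset.mem_univ _, ⟨z, hΦ.1 ▸ le_pDiv p Φ hz, rfl⟩, ?_⟩, ?_⟩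
        · rintro ⟨y, ⟨-, hy⟩, hyz⟩
          have : z - y ∈ N := by
            rw [← hker, AddMonoidHom.mem_ker, map_sub, hyz, sub_self]
          exact hz0 (by simpa using (pMul p ⊤).add_mem (hN0 this) hy)
        · have hle : AddSubgroup.zmultiples (π z) ≤ Φ.map π := by
            rw [AddSubgroup.zmultiples_le]; exact ⟨z, hz, rfl⟩
          have heq : AddSubgroup.zmultiples (π z) = Φ.map π := by
            refine AddSubgroup.eq_of_le_of_card_ge hle ?_
            rw [hScard Φ hΦ, Nat.card_zmultiples]
            refine ge_of_eq ?_
            apply addOrderOf_eq_prime _ hw0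
            rw [← map_nsmul, ← AddMonoidHom.mem_ker, hker]
            exact ⟨z, hΦ.1 ▸ le_pDiv p Φ hz, rfl⟩
          change (AddSubgroup.zmultiples (π z)).comap π = Φ
          rw [heq, hScomap Φ hΦ]
    rw [h1, Finset.card_erase_of_mem (Finset.mem_filter.2 ⟨Finset.mem_univ _, (Φ.map π).zero_mem⟩),
      ← Fintype.card_subtype, ← Nat.card_eq_fintype_card]
    congr 1
    exact hScard Φ hΦ
  have := Finset.card_eq_sum_card_fiberwise hmaps
  rw [Finset.sum_congr rfl hfib, Finset.sum_const, hV, smul_eq_mul] at this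
  rw [this, Set.ncard_eq_toFinset_card _ hSfin]

end Lattice

/-! ### A determinantal representation of a Weierstrass cubic through the origin -/

section Determinantal

variable {R : Type*} [CommRing R]

/-- A matrix of linear forms in `x = (X, Y, Z)` whose determinant is, up to sign, the Weierstrass
cubic when `a₆ = 0`. -/
def cubicMatrix (W : WeierstrassCurve R) (x : Fin 3 → R) : Matrix (Fin 3) (Fin 3) R :=
  !![x 0 + W.a₂ * x 2, W.a₄ * x 2, x 1 + W.a₁ * x 0 + W.a₃ * x 2;
     -x 2, x 0, 0;
     0, x 1, x 0]

/-- The determinant of `cubicMatrix`. -/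
def cubicForm (W : WeierstrassCurve R) (x : Fin 3 → R) : R :=
  x 0 * (x 0 ^ 2 + W.a₂ * x 0 * x 2 + W.a₄ * x 2 ^ 2) -
    x 1 * x 2 * (x 1 + W.a₁ * x 0 + W.a₃ * x 2)

/-- The coefficients of `u ᵥ* cubicMatrix W x ⬝ᵥ v` as a linear form in `x`. -/
def cubicPairing (W : WeierstrassCurve R) (u v : Fin 3 → R) : Fin 3 → R :=
  ![u 0 * v 0 + W.a₁ * u 0 * v 2 + u 1 * v 1 + u 2 * v 2,
    u 0 * v 2 + u 2 * v 1,
    W.a₂ * u 0 * v 0 + W.a₄ * u 0 * v 1 + W.a₃ * u 0 * v 2 - u 1 * v 0]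

theorem det_cubicMatrix (W : WeierstrassCurve R) (x : Fin 3 → R) :
    (cubicMatrix W x).det = cubicForm W x := by
  simp [cubicMatrix, cubicForm, Matrix.det_fin_three]
  ring

theorem equation_iff_cubicForm {W : WeierstrassCurve R} (h6 : W.a₆ = 0) (x : Fin 3 → R) :
    W.toProjective.Equation x ↔ cubicForm W x = 0 := by
  rw [WeierstrassCurve.Projective.equation_iff, cubicForm, h6]
  constructor <;> intro h <;> linear_combination -h

theorem cubicMatrix_map {S : Type*} [CommRing S] (f : R →+* S) (W : WeierstrassCurve R)
    (x : Fin 3 → R) : cubicMatrix (W.map f) (f ∘ x) = (cubicMatrix W x).map f := by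
  ext i j
  fin_cases i <;> fin_cases j <;> simp [cubicMatrix]

theorem cubicForm_map {S : Type*} [CommRing S] (f : R →+* S) (W : WeierstrassCurve R)
    (x : Fin 3 → R) : cubicForm (W.map f) (f ∘ x) = f (cubicForm W x) := by
  simp [cubicForm]

/-- The link between the commutator form and the determinant: centrality modulo the lattice cut out
by `x` becomes a statement about the kernels of `cubicMatrix W x` and its transpose. -/
theorem dotProduct_cubicPairing (W : WeierstrassCurve R) (x u v : Fin 3 → R) :
    x ⬝ᵥ cubicPairing W u v = u ⬝ᵥ (cubicMatrix W x).mulVec v := by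
  simp [cubicPairing, cubicMatrix, dotProduct, Matrix.mulVec, Fin.sum_univ_three]
  ring

theorem cubicPairing_add_left (W : WeierstrassCurve R) (u u' v : Fin 3 → R) :
    cubicPairing W (u + u') v = cubicPairing W u v + cubicPairing W u' v := by
  ext i; fin_cases i <;> simp [cubicPairing] <;> ring

theorem cubicPairing_add_right (W : WeierstrassCurve R) (u v v' : Fin 3 → R) :
    cubicPairing W u (v + v') = cubicPairing W u v + cubicPairing W u v' := by
  ext i; fin_cases i <;> simp [cubicPairing] <;> ring

theorem cubicPairing_smul_left (W : WeierstrassCurve R) (c : R) (u v : Fin 3 → R) :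
    cubicPairing W (c • u) v = c • cubicPairing W u v := by
  ext i; fin_cases i <;> simp [cubicPairing] <;> ring

theorem cubicPairing_smul_right (W : WeierstrassCurve R) (c : R) (u v : Fin 3 → R) :
    cubicPairing W u (c • v) = c • cubicPairing W u v := by
  ext i; fin_cases i <;> simp [cubicPairing] <;> ring

theorem cubicPairing_zero_left (W : WeierstrassCurve R) (v : Fin 3 → R) :
    cubicPairing W 0 v = 0 := by
  ext i; fin_cases i <;> simp [cubicPairing]

theorem cubicPairing_zero_right (W : WeierstrassCurve R) (u : Fin 3 → R) :
    cubicPairing W u 0 = 0 := by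
  ext i; fin_cases i <;> simp [cubicPairing]

theorem cubicPairing_neg_left (W : WeierstrassCurve R) (u v : Fin 3 → R) :
    cubicPairing W (-u) v = -cubicPairing W u v := by
  ext i; fin_cases i <;> simp [cubicPairing] <;> ring

theorem cubicPairing_neg_right (W : WeierstrassCurve R) (u v : Fin 3 → R) :
    cubicPairing W u (-v) = -cubicPairing W u v := by
  ext i; fin_cases i <;> simp [cubicPairing] <;> ring

/-- On a nonsingular cubic the matrix has corank at most one at every point of the plane. -/
theorem exists_minor_ne_zero {F : Type*} [Field F] {W : WeierstrassCurve F} (h6 : W.a₆ = 0)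
    (hΔ : W.Δ ≠ 0) {x : Fin 3 → F} (hx : x ≠ 0) :
    ∃ i j : Fin 3, ((cubicMatrix W x).submatrix i.succAbove j.succAbove).det ≠ 0 := by
  by_contra! h
  have h00 := h 0 0
  have h02 := h 0 2
  have h21 := h 2 1
  have h10 := h 1 0
  have h22 := h 2 2
  simp [cubicMatrix, Matrix.det_fin_two, Fin.succAbove] at h00 h02 h21 h10 h22
  simp only [h00, mul_zero, add_zero, zero_add, zero_sub, neg_eq_zero] at h21 h10 h22
  by_cases hz : x 2 = 0
  · simp only [hz, mul_zero, add_zero, mul_self_eq_zero] at h10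
    exact hx (by ext i; fin_cases i <;> simp [h00, h10, hz])
  -- The only possible corank-two point is the origin, and there `a₃ = a₄ = 0`, so the cubic is
  -- singular at it.
  · have h1 : x 1 = 0 := h02.resolve_left hz
    have h3 : W.a₃ = 0 := by simpa [h1, hz] using h21
    have h4 : W.a₄ = 0 := by simpa [hz] using h22
    apply hΔ
    simp [WeierstrassCurve.Δ, WeierstrassCurve.b₂, WeierstrassCurve.b₄, WeierstrassCurve.b₆,
      WeierstrassCurve.b₈, h3, h4, h6]

/-- All values `cubicPairing W u v` with `u` fixed and nonzero span at least a plane. -/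
theorem eq_zero_of_minors_left {F : Type*} [Field F] {W : WeierstrassCurve F} {u : Fin 3 → F}
    (h : ∀ v v' : Fin 3 → F, ∀ i j, cubicPairing W u v i * cubicPairing W u v' j =
      cubicPairing W u v j * cubicPairing W u v' i) : u = 0 := by
  have h1 := h ![1, 0, 0] ![0, 0, 1] 0 1
  have h2 := h ![1, 0, 0] ![0, 1, 0] 0 2
  have h3 := h ![0, 1, 0] ![0, 0, 1] 0 1
  simp [cubicPairing] at h1
  simp [cubicPairing, h1] at h2
  simp [cubicPairing, h1, h2] at h3
  ext i; fin_cases i <;> simp [*]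

/-- The mirror image of `eq_zero_of_minors_left`. Letting `u` run through the basis vectors already
forces every coordinate of `v` to vanish, on any Weierstrass cubic. -/
theorem eq_zero_of_minors_right {F : Type*} [Field F] {W : WeierstrassCurve F} {v : Fin 3 → F}
    (h : ∀ u u' : Fin 3 → F, ∀ i j, cubicPairing W u v i * cubicPairing W u' v j =
      cubicPairing W u v j * cubicPairing W u' v i) : v = 0 := by
  have h1 := h ![0, 1, 0] ![0, 0, 1] 0 1
  have h2 := h ![0, 1, 0] ![0, 0, 1] 0 2
  have h3 := h ![1, 0, 0] ![0, 1, 0] 0 2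
  have h4 := h ![1, 0, 0] ![0, 0, 1] 0 1
  simp [cubicPairing] at h1
  simp [cubicPairing, h1] at h2 
  simp [cubicPairing, h1] at h3
  simp [cubicPairing, h1] at h4
  have h0 : v 0 = 0 := by
    rcases h2 with h2 | h2
    · exact h2
    · simpa [h2] using h3
  ext i; fin_cases i <;> simp [*]

end Determinantal

/-! ### Annihilators modulo a lattice -/

section Annihilator

variable (W : WeierstrassCurve ℤ)

/-- The vectors `u` with `cubicPairing W u v ∈ Λ` for all `v`. -/
def leftAnnihilator (Λ : AddSubgroup (Fin 3 → ℤ)) : AddSubgroup (Fin 3 → ℤ) where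
  carrier := {u | ∀ v, cubicPairing W u v ∈ Λ}
  zero_mem' v := by rw [cubicPairing_zero_left]; exact Λ.zero_mem
  add_mem' hu hu' v := by rw [cubicPairing_add_left]; exact Λ.add_mem (hu v) (hu' v)
  neg_mem' hu v := by rw [cubicPairing_neg_left]; exact Λ.neg_mem (hu v)

/-- The vectors `v` with `cubicPairing W u v ∈ Λ` for all `u`. -/
def rightAnnihilator (Λ : AddSubgroup (Fin 3 → ℤ)) : AddSubgroup (Fin 3 → ℤ) where
  carrier := {v | ∀ u, cubicPairing W u v ∈ Λ}
  zero_mem' v := by rw [cubicPairing_zero_right]; exact Λ.zero_mem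
  add_mem' hu hu' v := by rw [cubicPairing_add_right]; exact Λ.add_mem (hu v) (hu' v)
  neg_mem' hu v := by rw [cubicPairing_neg_right]; exact Λ.neg_mem (hu v)

/-- The pairs `(u, v)` that commute with everything modulo `Λ`. -/
def annihilator (Λ : AddSubgroup (Fin 3 → ℤ)) : AddSubgroup ((Fin 3 → ℤ) × (Fin 3 → ℤ)) :=
  (leftAnnihilator W Λ).prod (rightAnnihilator W Λ)

variable {W} {p : ℕ} [hp : Fact p.Prime]

/-- The image of `Φ` in `𝔽_p³` has order dividing `p`, hence is cyclic, so any two of its vectors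
are proportional. -/
theorem dvd_minor_of_residueIndex {Φ : AddSubgroup (Fin 3 → ℤ)} {k : ℕ} (hk : 2 ≤ k)
    (h : residueIndex p Φ = p ^ k) {x y : Fin 3 → ℤ} (hx : x ∈ Φ) (hy : y ∈ Φ) (i j : Fin 3) :
    (p : ℤ) ∣ x i * y j - x j * y i := by
  let N : AddSubgroup (Fin 3 → ℤ) := pMul p ⊤
  let π := QuotientAddGroup.mk' N
  have hker : π.ker = N := QuotientAddGroup.ker_mk' N
  have hcard : Nat.card (Φ.map π) ∣ p := by
    rw [← AddSubgroup.relIndex_ker, hker]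
    have h1 := AddSubgroup.relIndex_mul_index (le_sup_right : N ≤ Φ ⊔ N)
    rw [AddSubgroup.relIndex_sup_right, show (Φ ⊔ N).index = p ^ k from h,
      show N.index = p ^ 3 from index_pMul_top (AddEquiv.refl _)] at h1
    have h2 : N.relIndex Φ * p ^ 2 ∣ p * p ^ 2 := by
      rw [← pow_succ', ← h1]
      exact mul_dvd_mul_left _ (pow_dvd_pow _ hk)
    exact Nat.dvd_of_mul_dvd_mul_right (pow_pos hp.out.pos 2) h2
  have hcyc : IsAddCyclic (Φ.map π) := isAddCyclic_of_card_dvd_prime hcard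
  obtain ⟨⟨_, w, hw, rfl⟩, hgen⟩ := hcyc.exists_generator
  have key : ∀ z ∈ Φ, ∃ (c : ℤ) (t : Fin 3 → ℤ), z = c • w + (p : ℤ) • t := by
    intro z hz
    obtain ⟨c, hc⟩ := AddSubgroup.mem_zmultiples_iff.1 (hgen ⟨π z, z, hz, rfl⟩)
    have hc' : c • π w = π z := congrArg Subtype.val hc
    have : z - c • w ∈ N := by
      rw [← hker, AddMonoidHom.mem_ker, map_sub, map_zsmul, hc', sub_self]
    obtain ⟨t, -, ht⟩ := this
    refine ⟨c, t, ?_⟩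
    rw [natCast_zsmul]
    have ht' : p • t = z - c • w := ht
    rw [ht']; abel
  obtain ⟨c, t, rfl⟩ := key x hx
  obtain ⟨d, s, rfl⟩ := key y hy
  refine ⟨c * w i * s j + t i * d * w j + p * t i * s j -
    (c * w j * s i + t j * d * w i + p * t j * s i), ?_⟩
  simp
  ring

theorem mem_pMul_top_of_cast_eq_zero {x : Fin 3 → ℤ} (h : (fun i => (x i : ZMod p)) = 0) :
    ∃ y : Fin 3 → ℤ, p • y = x := by
  have : ∀ i, ∃ c, x i = p * c := fun i => (ZMod.intCast_zmod_eq_zero_iff_dvd _ _).1 (congrFun h i)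
  choose y hy using this
  exact ⟨y, by ext i; simp [hy]⟩

theorem cubicPairing_intCast (u v : Fin 3 → ℤ) (i : Fin 3) :
    cubicPairing (W.map (Int.castRingHom (ZMod p))) (fun i => (u i : ZMod p))
      (fun i => (v i : ZMod p)) i = ((cubicPairing W u v i : ℤ) : ZMod p) := by
  fin_cases i <;> simp [cubicPairing]

theorem exists_intCast_lift (v : Fin 3 → ZMod p) :
    ∃ v' : Fin 3 → ℤ, (fun i => (v' i : ZMod p)) = v := by
  refine ⟨fun i => (v i).val, ?_⟩
  ext i
  simp

/-- If `u` annihilates modulo `Φ`, all its pairings are proportional modulo `p`, which by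
`eq_zero_of_minors_left` forces `u ≡ 0`; likewise for `v`. Dividing by `p` replaces `Φ` by `pDiv p
Φ`. -/
theorem annihilator_eq_pMul {Φ : AddSubgroup (Fin 3 → ℤ)} {k : ℕ} (hk : 2 ≤ k)
    (h : residueIndex p Φ = p ^ k) :
    annihilator W Φ = pMul p (annihilator W (pDiv p Φ)) := by
  have hm : ∀ {x y : Fin 3 → ℤ}, x ∈ Φ → y ∈ Φ → ∀ i j,
      (x i : ZMod p) * (y j : ZMod p) = (x j : ZMod p) * (y i : ZMod p) := by
    intro x y hx hy i j
    have := (ZMod.intCast_zmod_eq_zero_iff_dvd _ p).2 (dvd_minor_of_residueIndex hk h hx hy i j)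
    push_cast at this
    exact sub_eq_zero.1 this
  ext ⟨u, v⟩
  constructor
  · rintro ⟨hu, hv⟩
    obtain ⟨u', rfl⟩ := mem_pMul_top_of_cast_eq_zero (p := p) (x := u) <|
      eq_zero_of_minors_left (W := W.map (Int.castRingHom (ZMod p))) fun v v' i j => by
        obtain ⟨v, rfl⟩ := exists_intCast_lift v
        obtain ⟨v', rfl⟩ := exists_intCast_lift v'
        simp only [cubicPairing_intCast]
        exact hm (hu v) (hu v') i j
    obtain ⟨v', rfl⟩ := mem_pMul_top_of_cast_eq_zero (p := p) (x := v) <|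
      eq_zero_of_minors_right (W := W.map (Int.castRingHom (ZMod p))) fun u u' i j => by
        obtain ⟨u, rfl⟩ := exists_intCast_lift u
        obtain ⟨u', rfl⟩ := exists_intCast_lift u'
        simp only [cubicPairing_intCast]
        exact hm (hv u) (hv u') i j
    refine ⟨(u', v'), ⟨fun w => ?_, fun w => ?_⟩, rfl⟩
    · rw [mem_pDiv, ← natCast_zsmul, ← cubicPairing_smul_left, natCast_zsmul]
      exact hu w
    · rw [mem_pDiv, ← natCast_zsmul, ← cubicPairing_smul_right, natCast_zsmul]
      exact hv w
  · rintro ⟨⟨u', v'⟩, ⟨hu, hv⟩, h⟩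
    obtain ⟨rfl, rfl⟩ := Prod.mk.inj h
    refine ⟨fun w => ?_, fun w => ?_⟩
    · change cubicPairing W (p • u') w ∈ Φ
      rw [← natCast_zsmul, cubicPairing_smul_left, natCast_zsmul]
      exact hu w
    · change cubicPairing W w (p • v') ∈ Φ
      rw [← natCast_zsmul, cubicPairing_smul_right, natCast_zsmul]
      exact hv w

/-- `ℤ³ × ℤ³ ≃ ℤ⁶`. -/
def prodVecEquiv : ((Fin 3 → ℤ) × (Fin 3 → ℤ)) ≃+ (Fin 6 → ℤ) :=
  { Fin.appendEquiv 3 3 with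
    map_add' := fun x y => by
      ext i
      change Fin.append (x.1 + y.1) (x.2 + y.2) i = Fin.append x.1 x.2 i + Fin.append y.1 y.2 i
      refine Fin.addCases (m := 3) (n := 3) (fun i => ?_) (fun i => ?_) i
      · simp only [Fin.append_left, Pi.add_apply]
      · simp only [Fin.append_right, Pi.add_apply] }

theorem hasPIndex_annihilator {Λ : AddSubgroup (Fin 3 → ℤ)} (h : HasPIndex p Λ) :
    HasPIndex p (annihilator W Λ) := by
  refine hasPIndex_of_pow_nsmul_mem prodVecEquiv (n := indexExp p Λ) fun z =>
    ⟨fun v => ?_, fun u => ?_⟩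
  · change cubicPairing W (p ^ indexExp p Λ • z.1) v ∈ Λ
    rw [← natCast_zsmul, cubicPairing_smul_left, natCast_zsmul]
    exact h.pow_nsmul_mem _
  · change cubicPairing W u (p ^ indexExp p Λ • z.2) ∈ Λ
    rw [← natCast_zsmul, cubicPairing_smul_right, natCast_zsmul]
    exact h.pow_nsmul_mem _

theorem indexExp_annihilator {Φ : AddSubgroup (Fin 3 → ℤ)} {k : ℕ} (hk : 2 ≤ k)
    (h : residueIndex p Φ = p ^ k) (hΦ : HasPIndex p Φ) :
    indexExp p (annihilator W Φ) = 6 + indexExp p (annihilator W (pDiv p Φ)) := by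
  apply indexExp_eq
  rw [annihilator_eq_pMul hk h, index_pMul prodVecEquiv, pow_add,
    (hasPIndex_annihilator hΦ.pDiv).index_eq]

end Annihilator

/-! ### Kernels of matrices of corank at most one -/

/-- If some maximal proper minor of `M` is invertible, then the kernel of `M` is isomorphic to the
kernel of multiplication by `det M`. -/
theorem card_ker_mulVec {R : Type*} [CommRing R] {n : ℕ} (M : Matrix (Fin (n + 1)) (Fin (n + 1)) R)
    {i j : Fin (n + 1)} (h : IsUnit (M.submatrix i.succAbove j.succAbove).det) :
    Nat.card {v // M.mulVec v = 0} = Nat.card {r : R // M.det * r = 0} := by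
  have hadj : IsUnit (M.adjugate j i) := by
    rw [Matrix.adjugate_fin_succ_eq_det_submatrix]
    exact (IsUnit.pow _ isUnit_one.neg).mul h
  obtain ⟨c, hc⟩ := hadj
  -- The isomorphism is `v ↦ v j`. It lands in the kernel of `det M` since `adj M * M = det M`. It
  -- is injective since the invertible minor determines the other coordinates. It is surjective
  -- through the multiples of column `i` of the adjugate, whose entry `j` is a unit.
  refine Nat.card_congr (Equiv.ofBijective (fun v => ⟨v.1 j, ?_⟩) ⟨?_, ?_⟩)
  · have h1 : M.adjugate.mulVec (M.mulVec v.1) = 0 := by rw [v.2, Matrix.mulVec_zero]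
    rw [Matrix.mulVec_mulVec, Matrix.adjugate_mul, Matrix.smul_mulVec, Matrix.one_mulVec] at h1
    exact congrFun h1 j
  · intro v w hvw
    apply Subtype.ext
    rw [← sub_eq_zero]
    have h0 : (v.1 - w.1) j = 0 := sub_eq_zero.2 (Subtype.ext_iff.1 hvw)
    have h1 : M.mulVec (v.1 - w.1) = 0 := by rw [Matrix.mulVec_sub, v.2, w.2, sub_zero]
    have h2 : (M.submatrix i.succAbove j.succAbove).mulVec ((v.1 - w.1) ∘ j.succAbove) = 0 := by
      ext k
      have := congrFun h1 (i.succAbove k)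
      rw [Matrix.mulVec, dotProduct, Fin.sum_univ_succAbove _ j, h0, mul_zero, zero_add] at this
      exact this
    have h3 : (v.1 - w.1) ∘ j.succAbove = 0 := by
      have hu := (Matrix.isUnit_iff_isUnit_det _).2 h
      exact Matrix.mulVec_injective_of_isUnit hu (by rw [h2, Matrix.mulVec_zero])
    ext k
    rcases Fin.eq_self_or_eq_succAbove j k with rfl | ⟨l, rfl⟩
    · exact h0
    · exact congrFun h3 l
  · rintro ⟨r, hr⟩
    refine ⟨⟨((c⁻¹ : Rˣ) * r : R) • M.adjugate.mulVec (Pi.single i 1), ?_⟩, Subtype.ext ?_⟩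
    · rw [Matrix.mulVec_smul, Matrix.mulVec_mulVec, Matrix.mul_adjugate, Matrix.smul_mulVec,
        smul_smul, mul_assoc, mul_comm r, hr, mul_zero, zero_smul]
    · change ((c⁻¹ : Rˣ) * r : R) * M.adjugate.mulVec (Pi.single i 1) j = r
      rw [Matrix.mulVec_single_one, Matrix.col_apply, ← hc, mul_right_comm, Units.inv_mul, one_mul]

theorem ZMod.card_ker_mul {N : ℕ} [NeZero N] (d : ℤ) :
    Nat.card {r : ZMod N // (d : ZMod N) * r = 0} = Int.gcd d N := by
  have hk := AddSubgroup.card_mul_index (AddMonoidHom.mulLeft (d : ZMod N)).ker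
  rw [AddSubgroup.index_ker] at hk
  have hr : (AddMonoidHom.mulLeft (d : ZMod N)).range = AddSubgroup.zmultiples (d : ZMod N) := by
    ext x
    rw [AddMonoidHom.mem_range, AddSubgroup.mem_zmultiples_iff]
    constructor
    · rintro ⟨y, rfl⟩
      obtain ⟨k, rfl⟩ := ZMod.intCast_surjective y
      exact ⟨k, by simp [mul_comm]⟩
    · rintro ⟨k, rfl⟩
      exact ⟨k, by simp [mul_comm]⟩
  have ho : addOrderOf (d : ZMod N) = N / Int.gcd d N := by
    have h1 := ZMod.addOrderOf_coe d.natAbs (NeZero.ne N)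
    rw [Int.gcd_comm, Int.gcd, Int.natAbs_natCast, ← h1]
    rcases Int.natAbs_eq d with h | h
    · conv_lhs => rw [h]
      rw [Int.cast_natCast]
    · conv_lhs => rw [h]
      rw [Int.cast_neg, Int.cast_natCast, addOrderOf_neg]
  have hpos : 0 < Int.gcd d N := Int.gcd_pos_of_ne_zero_right _ (by exact_mod_cast NeZero.ne N)
  have hdvd : Int.gcd d N ∣ N := by exact_mod_cast Int.gcd_dvd_right d N
  rw [hr, Nat.card_zmultiples, ho, Nat.card_zmod] at hk
  have hpos' : 0 < N / Int.gcd d N := Nat.div_pos (Nat.le_of_dvd (NeZero.pos N) hdvd) hpos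
  have := hk.trans (Nat.mul_div_cancel' hdvd).symm
  exact Nat.eq_of_mul_eq_mul_right hpos' this

/-! ### Lattices with cyclic quotient -/

/-- The vectors `z` with `x ⬝ᵥ z` divisible by `N`. -/
def dvdLattice (N : ℕ) (x : Fin 3 → ℤ) : AddSubgroup (Fin 3 → ℤ) where
  carrier := {z | (N : ℤ) ∣ x ⬝ᵥ z}
  zero_mem' := by simp
  add_mem' hz hw := by simpa [dotProduct_add] using dvd_add hz hw
  neg_mem' hz := by simpa using hz

theorem mem_dvdLattice {N : ℕ} {x z : Fin 3 → ℤ} : z ∈ dvdLattice N x ↔ (N : ℤ) ∣ x ⬝ᵥ z := Iff.rfl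

section Cyclic

variable {p : ℕ} [hp : Fact p.Prime]

/-- Some coordinate of `x` is prime to `p`. -/
def IsPrimitiveMod (p : ℕ) (x : Fin 3 → ℤ) : Prop := ∃ i, ¬ (p : ℤ) ∣ x i

theorem IsPrimitiveMod.exists_dotProduct {x : Fin 3 → ℤ} (hx : IsPrimitiveMod p x) (a : ℕ) (c : ℤ) :
    ∃ z : Fin 3 → ℤ, ((p ^ a : ℕ) : ℤ) ∣ x ⬝ᵥ z - c := by
  obtain ⟨i, hi⟩ := hx
  have hc : IsCoprime ((p : ℤ) ^ a) (x i) :=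
    (((Nat.prime_iff_prime_int.1 hp.out).coprime_iff_not_dvd.2 hi)).pow_left
  obtain ⟨s, t, hst⟩ := hc
  refine ⟨Pi.single i (t * c), -(s * c), ?_⟩
  rw [dotProduct_single]
  push_cast
  linear_combination c * hst

theorem index_dvdLattice {x : Fin 3 → ℤ} (hx : IsPrimitiveMod p x) (a : ℕ) :
    (dvdLattice (p ^ a) x).index = p ^ a := by
  let f : (Fin 3 → ℤ) →+ ZMod (p ^ a) :=
    AddMonoidHom.mk' (fun z => ((x ⬝ᵥ z : ℤ) : ZMod (p ^ a))) fun z w => by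
      rw [dotProduct_add, Int.cast_add]
  have hf : dvdLattice (p ^ a) x = f.ker := by
    ext z
    rw [mem_dvdLattice, AddMonoidHom.mem_ker]
    exact (ZMod.intCast_zmod_eq_zero_iff_dvd _ _).symm
  have hs : Function.Surjective f := by
    intro c
    obtain ⟨c, rfl⟩ := ZMod.intCast_surjective c
    obtain ⟨z, hz⟩ := hx.exists_dotProduct a c
    refine ⟨z, ?_⟩
    rw [← ZMod.intCast_zmod_eq_zero_iff_dvd, Int.cast_sub, sub_eq_zero] at hz
    exact hz
  rw [hf, AddSubgroup.index_ker, AddMonoidHom.range_eq_top.2 hs]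
  simp

theorem pDiv_dvdLattice (x : Fin 3 → ℤ) (a : ℕ) :
    pDiv p (dvdLattice (p ^ (a + 1)) x) = dvdLattice (p ^ a) x := by
  ext z
  rw [mem_pDiv, mem_dvdLattice, mem_dvdLattice, dotProduct_smul, nsmul_eq_mul, pow_succ',
    Nat.cast_mul]
  exact mul_dvd_mul_iff_left (by exact_mod_cast hp.out.ne_zero)

theorem isLevel_dvdLattice {x : Fin 3 → ℤ} (hx : IsPrimitiveMod p x) (a : ℕ) :
    IsLevel p a (dvdLattice (p ^ a) x) := by
  induction a with
  | zero =>
    refine top_unique fun z _ => ?_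
    simp [mem_dvdLattice]
  | succ a ih =>
    refine ⟨by rwa [pDiv_dvdLattice], fun h => ?_⟩
    have := index_dvdLattice hx (a + 1)
    rw [h, AddSubgroup.index_top] at this
    exact absurd this (Nat.one_lt_pow (Nat.succ_ne_zero a) hp.out.one_lt).ne

theorem residueIndex_dvdLattice {x : Fin 3 → ℤ} (hx : IsPrimitiveMod p x) (a : ℕ) :
    residueIndex p (dvdLattice (p ^ (a + 1)) x) = p := by
  have := index_eq_residueIndex_mul p (dvdLattice (p ^ (a + 1)) x)
  rw [pDiv_dvdLattice, index_dvdLattice hx, index_dvdLattice hx] at this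
  exact (Nat.eq_of_mul_eq_mul_right (pow_pos hp.out.pos a) ((pow_succ' p a).symm.trans this)).symm

/-- By Nakayama the quotient is cyclic, so `Φ` is the kernel of a surjection `z ↦ x ⬝ᵥ z` onto
`ℤ/pⁿ`. Surjectivity makes `x` primitive, and uniqueness of the level gives `n = a`. -/
theorem exists_eq_dvdLattice {Φ : AddSubgroup (Fin 3 → ℤ)} {a : ℕ} (ha : IsLevel p a Φ)
    (h : residueIndex p Φ = p) : ∃ x, IsPrimitiveMod p x ∧ Φ = dvdLattice (p ^ a) x := by
  have hΦ : HasPIndex p Φ := ha.hasPIndex (AddEquiv.refl _)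
  have hne : Φ ⊔ pMul p ⊤ ≠ ⊤ := by
    intro ht
    rw [residueIndex, ht, AddSubgroup.index_top] at h
    exact hp.out.one_lt.ne h
  obtain ⟨z, hz⟩ : ∃ z, z ∉ Φ ⊔ pMul p ⊤ := by
    by_contra! hall
    exact hne (top_unique fun z _ => hall z)
  have htop : Φ ⊔ AddSubgroup.zmultiples z = ⊤ := by
    have hP : HasPIndex p (Φ ⊔ AddSubgroup.zmultiples z) := by
      obtain ⟨n, hn⟩ := hΦ
      exact .of_dvd (n := n) (hn ▸ AddSubgroup.index_dvd_of_le le_sup_left)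
    refine eq_top_of_residueIndex_eq_one hP ?_
    have hle : Φ ⊔ pMul p ⊤ ≤ (Φ ⊔ AddSubgroup.zmultiples z) ⊔ pMul p ⊤ :=
      sup_le_sup_right le_sup_left _
    have hd : residueIndex p (Φ ⊔ AddSubgroup.zmultiples z) ∣ p := by
      have := AddSubgroup.index_dvd_of_le hle
      rwa [← residueIndex, ← residueIndex, h] at this
    refine ((Nat.dvd_prime hp.out).1 hd).resolve_right fun hp' => hz ?_
    have h1 := AddSubgroup.relIndex_mul_index hle
    rw [← residueIndex, ← residueIndex, h, hp'] at h1
    have h2 := AddSubgroup.relIndex_eq_one.1 ((Nat.mul_eq_right hp.out.ne_zero).1 h1)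
    exact h2 (le_sup_left (a := Φ ⊔ _) (le_sup_right (a := Φ) (AddSubgroup.mem_zmultiples z)))
  let π := QuotientAddGroup.mk' Φ
  have hcyc : IsAddCyclic ((Fin 3 → ℤ) ⧸ Φ) := by
    refine ⟨π z, fun y => ?_⟩
    obtain ⟨y, rfl⟩ := QuotientAddGroup.mk'_surjective Φ y
    have hy : y ∈ Φ ⊔ AddSubgroup.zmultiples z := htop ▸ AddSubgroup.mem_top y
    obtain ⟨f, hf, w, hw, rfl⟩ := AddSubgroup.mem_sup.1 hy
    obtain ⟨k, rfl⟩ := AddSubgroup.mem_zmultiples_iff.1 hw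
    refine AddSubgroup.mem_zmultiples_iff.2 ⟨k, ?_⟩
    have hf0 : QuotientAddGroup.mk' Φ f = 0 := (QuotientAddGroup.eq_zero_iff f).2 hf
    rw [map_add, hf0, zero_add, map_zsmul]
  obtain ⟨n, hn⟩ := hΦ
  have hcard : Nat.card ((Fin 3 → ℤ) ⧸ Φ) = p ^ n := by rw [← AddSubgroup.index_eq_card, hn]
  let g : (Fin 3 → ℤ) ⧸ Φ ≃+ ZMod (p ^ n) :=
    (hcard ▸ (zmodAddCyclicAddEquiv hcyc).symm :)
  have hn0 : n ≠ 0 := by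
    rintro rfl
    rw [pow_zero, AddSubgroup.index_eq_one] at hn
    apply hne
    rw [hn, top_sup_eq]
  choose x hx using fun i => ZMod.intCast_surjective (g (π (Pi.single i 1)))
  have hgx : ∀ z, g (π z) = ((x ⬝ᵥ z : ℤ) : ZMod (p ^ n)) := by
    intro z
    have hz : z = ∑ i, z i • (Pi.single i 1 : Fin 3 → ℤ) := by
      ext j
      simp [Finset.sum_apply, Pi.single_apply]
    conv_lhs => rw [hz]
    rw [map_sum, map_sum, dotProduct, Int.cast_sum]
    refine Finset.sum_congr rfl fun i _ => ?_
    rw [map_zsmul, map_zsmul, ← hx, Int.cast_mul, zsmul_eq_mul, mul_comm]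
  have hprim : IsPrimitiveMod p x := by
    by_contra hnp
    have hall : ∀ i, (p : ℤ) ∣ x i := by simpa [IsPrimitiveMod] using hnp
    obtain ⟨y, hy⟩ := g.surjective 1
    obtain ⟨y, rfl⟩ := QuotientAddGroup.mk'_surjective Φ y
    rw [show g (QuotientAddGroup.mk' Φ y) = _ from hgx y] at hy
    have h1 : ((x ⬝ᵥ y - 1 : ℤ) : ZMod (p ^ n)) = 0 := by
      rw [Int.cast_sub, hy, Int.cast_one, sub_self]
    have h2 : (p : ℤ) ∣ x ⬝ᵥ y - 1 := by
      refine dvd_trans ?_ ((ZMod.intCast_zmod_eq_zero_iff_dvd _ _).1 h1)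
      exact_mod_cast dvd_pow_self p hn0
    have h3 : (p : ℤ) ∣ x ⬝ᵥ y := Finset.dvd_sum fun i _ => (hall i).mul_right _
    have h4 : (p : ℤ) ∣ 1 := by simpa using dvd_sub h3 h2
    exact (Nat.prime_iff_prime_int.1 hp.out).not_isUnit (isUnit_of_dvd_one h4)
  have hΦx : Φ = dvdLattice (p ^ n) x := by
    ext y
    rw [mem_dvdLattice, ← ZMod.intCast_zmod_eq_zero_iff_dvd, ← hgx, map_eq_zero_iff _ g.injective]
    exact (QuotientAddGroup.eq_zero_iff y).symm
  have hna : n = a := (isLevel_dvdLattice hprim n).unique (hΦx ▸ ha)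
  exact ⟨x, hprim, hna ▸ hΦx⟩

/-- Two primitive vectors define the same lattice iff they are proportional by a unit. -/
theorem dvdLattice_eq_iff {x y : Fin 3 → ℤ} (hx : IsPrimitiveMod p x) (hy : IsPrimitiveMod p y)
    (a : ℕ) : dvdLattice (p ^ a) x = dvdLattice (p ^ a) y ↔
      ∃ c : (ZMod (p ^ a))ˣ, ∀ i, (y i : ZMod (p ^ a)) = c * (x i : ZMod (p ^ a)) := by
  have hmem : ∀ x z : Fin 3 → ℤ,
      z ∈ dvdLattice (p ^ a) x ↔ ∑ i, (x i : ZMod (p ^ a)) * (z i : ZMod (p ^ a)) = 0 := by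
    intro x z
    rw [mem_dvdLattice, ← ZMod.intCast_zmod_eq_zero_iff_dvd, dotProduct]
    push_cast
    rfl
  constructor
  · intro h
    obtain ⟨z, hz⟩ := hx.exists_dotProduct a 1
    rw [← ZMod.intCast_zmod_eq_zero_iff_dvd, Int.cast_sub, sub_eq_zero, Int.cast_one] at hz
    -- Modulo the common kernel every `w` is `(x ⬝ᵥ w) z`, so the two functionals differ by the
    -- factor `y ⬝ᵥ z`.
    have key : ∀ w : Fin 3 → ℤ, ((y ⬝ᵥ w : ℤ) : ZMod (p ^ a)) =
        ((y ⬝ᵥ z : ℤ) : ZMod (p ^ a)) * ((x ⬝ᵥ w : ℤ) : ZMod (p ^ a)) := by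
      intro w
      have h1 : w - (x ⬝ᵥ w) • z ∈ dvdLattice (p ^ a) x := by
        rw [mem_dvdLattice, ← ZMod.intCast_zmod_eq_zero_iff_dvd, dotProduct_sub, dotProduct_smul,
          smul_eq_mul, Int.cast_sub, Int.cast_mul, hz, mul_one, sub_self]
      rw [h, mem_dvdLattice, ← ZMod.intCast_zmod_eq_zero_iff_dvd, dotProduct_sub, dotProduct_smul,
        smul_eq_mul, Int.cast_sub, Int.cast_mul, sub_eq_zero] at h1
      rw [h1, mul_comm]
    have hu : IsUnit ((y ⬝ᵥ z : ℤ) : ZMod (p ^ a)) := by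
      obtain ⟨w, hw⟩ := hy.exists_dotProduct a 1
      rw [← ZMod.intCast_zmod_eq_zero_iff_dvd, Int.cast_sub, sub_eq_zero, Int.cast_one, key] at hw
      exact .of_mul_eq_one _ hw
    refine ⟨hu.unit, fun i => ?_⟩
    simpa using key (Pi.single i 1)
  · rintro ⟨c, hc⟩
    ext z
    rw [hmem, hmem]
    simp only [hc, mul_assoc, ← Finset.mul_sum]
    exact (Units.mul_right_eq_zero c).symm

/-! ### Annihilators modulo a lattice with cyclic quotient -/

theorem forall_dvd_dotProduct_iff {N : ℤ} {w : Fin 3 → ℤ} :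
    (∀ u : Fin 3 → ℤ, N ∣ u ⬝ᵥ w) ↔ ∀ i, N ∣ w i :=
  ⟨fun h i => by simpa using h (Pi.single i 1), fun h u => Finset.dvd_sum fun i _ =>
    (h i).mul_left _⟩

/-- `H` is the kernel of `v ↦ M v` into `(ℤ/pᵃ)³`, so its index is the order of the image of `M`
modulo `pᵃ`. The kernel there has the order of the kernel of `det M`, by `card_ker_mulVec`. -/
theorem index_of_mem_iff_dvd_mulVec (M : Matrix (Fin 3) (Fin 3) ℤ) (a : ℕ) {i j : Fin 3}
    (h : ¬ (p : ℤ) ∣ (M.submatrix i.succAbove j.succAbove).det) {H : AddSubgroup (Fin 3 → ℤ)}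
    (hH : ∀ v, v ∈ H ↔ ∀ i, ((p ^ a : ℕ) : ℤ) ∣ M.mulVec v i) :
    H.index * Int.gcd M.det (p ^ a : ℕ) = p ^ (3 * a) := by
  let R := ZMod (p ^ a)
  have : NeZero (p ^ a) := ⟨pow_ne_zero _ hp.out.ne_zero⟩
  let φ := Int.castRingHom R
  let M' := M.map φ
  let r : (Fin 3 → ℤ) →+ (Fin 3 → R) := φ.toAddMonoidHom.compLeft (Fin 3)
  have hr : Function.Surjective r := fun v => by
    choose w hw using fun i => ZMod.intCast_surjective (v i)
    exact ⟨w, funext hw⟩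
  let m : (Fin 3 → R) →+ (Fin 3 → R) := M'.mulVecLin.toAddMonoidHom
  have hmr : ∀ v i, m (r v) i = φ (M.mulVec v i) := fun v i =>
    (RingHom.map_mulVec φ M v i).symm
  have hker : H = (m.comp r).ker := by
    ext v
    rw [hH, AddMonoidHom.mem_ker]
    constructor
    · intro h
      ext i
      exact (hmr v i).trans ((ZMod.intCast_zmod_eq_zero_iff_dvd _ _).2 (h i))
    · intro h i
      exact (ZMod.intCast_zmod_eq_zero_iff_dvd _ _).1 ((hmr v i).symm.trans (congrFun h i))
  have hrange : (m.comp r).range = m.range := by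
    rw [AddMonoidHom.range_comp, AddMonoidHom.range_eq_top.2 hr, AddMonoidHom.range_eq_map]
  have hu : IsUnit (M'.submatrix i.succAbove j.succAbove).det := by
    have h1 : (M'.submatrix i.succAbove j.succAbove).det =
        φ (M.submatrix i.succAbove j.succAbove).det := by
      rw [RingHom.map_det]; rfl
    rw [h1]
    have hc : IsCoprime (M.submatrix i.succAbove j.succAbove).det ((p : ℤ) ^ a) :=
      ((Nat.prime_iff_prime_int.1 hp.out).coprime_iff_not_dvd.2 h).symm.pow_right
    obtain ⟨s, t, hst⟩ := hc
    refine .of_mul_eq_one (φ s) ?_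
    rw [← map_mul]
    have h2 := congrArg φ hst
    have h3 : φ ((p : ℤ) ^ a) = 0 := by
      rw [map_pow, map_natCast, ← Nat.cast_pow]
      exact ZMod.natCast_self _
    rwa [map_add, map_mul φ t, h3, mul_zero, add_zero, map_one, mul_comm] at h2
  have hcard : Nat.card m.ker = Int.gcd M.det (p ^ a : ℕ) := by
    rw [← ZMod.card_ker_mul (N := p ^ a) M.det]
    have h1 : M'.det = (M.det : R) := (RingHom.map_det φ M).symm
    rw [← h1, ← card_ker_mulVec M' hu]
    rfl
  have h1 := AddSubgroup.card_mul_index m.ker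
  rw [AddSubgroup.index_ker, hcard, Nat.card_fun] at h1
  rw [hker, AddSubgroup.index_ker, hrange, mul_comm, h1]
  simp [R, ← pow_mul, mul_comm]

theorem exists_not_dvd_minor {W : WeierstrassCurve ℤ} (h6 : W.a₆ = 0) (hΔ : ¬ (p : ℤ) ∣ W.Δ)
    {x : Fin 3 → ℤ} (hx : IsPrimitiveMod p x) :
    ∃ i j : Fin 3, ¬ (p : ℤ) ∣ ((cubicMatrix W x).submatrix i.succAbove j.succAbove).det := by
  let φ := Int.castRingHom (ZMod p)
  have hΔ' : (W.map φ).Δ ≠ 0 := by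
    rw [WeierstrassCurve.map_Δ]
    exact fun h => hΔ ((ZMod.intCast_zmod_eq_zero_iff_dvd _ _).1 h)
  have hx' : φ ∘ x ≠ 0 := by
    obtain ⟨i, hi⟩ := hx
    exact fun h => hi ((ZMod.intCast_zmod_eq_zero_iff_dvd _ _).1 (congrFun h i))
  obtain ⟨i, j, hij⟩ := exists_minor_ne_zero (W := W.map φ) (by simp [h6]) hΔ' hx'
  refine ⟨i, j, fun h => hij ?_⟩
  have h1 := (ZMod.intCast_zmod_eq_zero_iff_dvd _ _).2 h
  rw [cubicMatrix_map]
  have h2 : (((cubicMatrix W x).map φ).submatrix i.succAbove j.succAbove).det =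
      φ ((cubicMatrix W x).submatrix i.succAbove j.succAbove).det := by
    rw [RingHom.map_det]; rfl
  rw [h2]
  exact h1

variable {W : WeierstrassCurve ℤ}

theorem index_rightAnnihilator_dvdLattice (h6 : W.a₆ = 0) (hΔ : ¬ (p : ℤ) ∣ W.Δ)
    {x : Fin 3 → ℤ} (hx : IsPrimitiveMod p x) (a : ℕ) :
    (rightAnnihilator W (dvdLattice (p ^ a) x)).index *
      Int.gcd (cubicForm W x) (p ^ a : ℕ) = p ^ (3 * a) := by
  obtain ⟨i, j, hij⟩ := exists_not_dvd_minor h6 hΔ hx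
  rw [← det_cubicMatrix]
  refine index_of_mem_iff_dvd_mulVec _ a hij fun v => ?_
  rw [← forall_dvd_dotProduct_iff]
  simp only [← dotProduct_cubicPairing]
  rfl

theorem index_leftAnnihilator_dvdLattice (h6 : W.a₆ = 0) (hΔ : ¬ (p : ℤ) ∣ W.Δ)
    {x : Fin 3 → ℤ} (hx : IsPrimitiveMod p x) (a : ℕ) :
    (leftAnnihilator W (dvdLattice (p ^ a) x)).index *
      Int.gcd (cubicForm W x) (p ^ a : ℕ) = p ^ (3 * a) := by
  obtain ⟨i, j, hij⟩ := exists_not_dvd_minor h6 hΔ hx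
  have hij' : ¬ (p : ℤ) ∣
      ((cubicMatrix W x).transpose.submatrix j.succAbove i.succAbove).det := by
    rwa [← Matrix.transpose_submatrix, Matrix.det_transpose]
  rw [← det_cubicMatrix, ← Matrix.det_transpose]
  refine index_of_mem_iff_dvd_mulVec _ a hij' fun u => ?_
  have hdot : ∀ v, v ⬝ᵥ (cubicMatrix W x).transpose.mulVec u = x ⬝ᵥ cubicPairing W u v := by
    intro v
    rw [dotProduct_cubicPairing, Matrix.mulVec_transpose, dotProduct_comm,
      ← Matrix.dotProduct_mulVec]
  rw [← forall_dvd_dotProduct_iff]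
  simp only [hdot]
  rfl

/-- The exponent of `p` in `d`, truncated at `a`. -/
noncomputable def truncVal (p a : ℕ) (d : ℤ) : ℕ := padicValNat p (Int.gcd d (p ^ a : ℕ))

theorem gcd_eq_pow_truncVal (a : ℕ) (d : ℤ) :
    truncVal p a d ≤ a ∧ Int.gcd d (p ^ a : ℕ) = p ^ truncVal p a d := by
  have hd : Int.gcd d (p ^ a : ℕ) ∣ p ^ a := Int.natCast_dvd_natCast.1 (Int.gcd_dvd_right d _)
  obtain ⟨k, hk, h⟩ := (Nat.dvd_prime_pow hp.out).1 hd
  have : truncVal p a d = k := by rw [truncVal, h, padicValNat.prime_pow]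
  rw [this]
  exact ⟨hk, h⟩

/-- The point where the curve enters: each of the two annihilators has index `p` to the power `3a`
minus the truncated valuation of the cubic at `x`. -/
theorem indexExp_annihilator_dvdLattice (h6 : W.a₆ = 0) (hΔ : ¬ (p : ℤ) ∣ W.Δ)
    {x : Fin 3 → ℤ} (hx : IsPrimitiveMod p x) (a : ℕ) :
    indexExp p (annihilator W (dvdLattice (p ^ a) x)) + 2 * truncVal p a (cubicForm W x) =
      6 * a := by
  have hP : HasPIndex p (annihilator W (dvdLattice (p ^ a) x)) :=
    hasPIndex_annihilator ⟨a, index_dvdLattice hx a⟩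
  have hl := index_leftAnnihilator_dvdLattice h6 hΔ hx a
  have hr := index_rightAnnihilator_dvdLattice h6 hΔ hx a
  have hi : (annihilator W (dvdLattice (p ^ a) x)).index * (p ^ truncVal p a (cubicForm W x)) ^ 2 =
      p ^ (6 * a) := by
    rw [annihilator, AddSubgroup.index_prod, ← (gcd_eq_pow_truncVal a (cubicForm W x)).2]
    calc _ = _ := by ring
      _ = p ^ (3 * a) * p ^ (3 * a) := congrArg₂ (· * ·) hl hr
      _ = _ := by ring
  rw [hP.index_eq, ← pow_mul, ← pow_add] at hi
  rw [← Nat.pow_right_injective hp.out.two_le hi]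
  ring

end Cyclic

/-! ### Lifting points of the cubic -/

section Gradient

variable {R : Type*} [CommRing R]

/-- The gradient of `cubicForm W`. -/
def cubicGradient (W : WeierstrassCurve R) (x : Fin 3 → R) : Fin 3 → R :=
  ![3 * x 0 ^ 2 + 2 * W.a₂ * x 0 * x 2 + W.a₄ * x 2 ^ 2 - W.a₁ * x 1 * x 2,
    -(2 * x 1 * x 2 + W.a₁ * x 0 * x 2 + W.a₃ * x 2 ^ 2),
    W.a₂ * x 0 ^ 2 + 2 * W.a₄ * x 0 * x 2 - x 1 ^ 2 - W.a₁ * x 0 * x 1 - 2 * W.a₃ * x 1 * x 2]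

/-- Taylor expansion in `t`; the witness collects the quadratic part and `t` times the cubic part.
-/
theorem cubicForm_add_smul (W : WeierstrassCurve R) (x y : Fin 3 → R) (t : R) :
    ∃ q, cubicForm W (x + t • y) = cubicForm W x + t * (cubicGradient W x ⬝ᵥ y) + t ^ 2 * q := by
  refine ⟨3 * x 0 * y 0 ^ 2 + W.a₂ * (2 * x 0 * y 0 * y 2 + x 2 * y 0 ^ 2) +
    W.a₄ * (x 0 * y 2 ^ 2 + 2 * x 2 * y 0 * y 2) - (2 * x 1 * y 1 * y 2 + x 2 * y 1 ^ 2) -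
    W.a₁ * (x 0 * y 1 * y 2 + x 1 * y 0 * y 2 + x 2 * y 0 * y 1) -
    W.a₃ * (x 1 * y 2 ^ 2 + 2 * x 2 * y 1 * y 2) + t * cubicForm W y, ?_⟩
  simp [cubicForm, cubicGradient, dotProduct, Fin.sum_univ_three]
  ring

theorem cubicGradient_map {S : Type*} [CommRing S] (f : R →+* S) (W : WeierstrassCurve R)
    (x : Fin 3 → R) : cubicGradient (W.map f) (f ∘ x) = f ∘ cubicGradient W x := by
  ext i
  fin_cases i <;> simp [cubicGradient, map_ofNat]

/-- On the line at infinity only `(0 : 1 : 0)` lies on the cubic, and there the last partial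
derivative is `-Y²`. Affine points are nonsingular because the discriminant is nonzero. -/
theorem cubicGradient_ne_zero {F : Type*} [Field F] {W : WeierstrassCurve F} (h6 : W.a₆ = 0)
    (hΔ : W.Δ ≠ 0) {x : Fin 3 → F} (hx : x ≠ 0) (h : cubicForm W x = 0) :
    cubicGradient W x ≠ 0 := by
  intro hg
  have g0 := congrFun hg 0
  have g1 := congrFun hg 1
  have g2 := congrFun hg 2
  simp only [cubicGradient, Matrix.cons_val_zero, Matrix.cons_val_one, Matrix.cons_val,
    Pi.zero_apply] at g0 g1 g2
  have heq := (equation_iff_cubicForm h6 x).2 h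
  by_cases hz : x 2 = 0
  · have h0 : x 0 = 0 := WeierstrassCurve.Projective.X_eq_zero_of_Z_eq_zero heq hz
    have h1 : x 1 = 0 := by simpa [h0, hz] using g2
    exact hx (by ext i; fin_cases i <;> simp [h0, h1, hz])
  · have hns : W.toProjective.Nonsingular x := by
      rw [WeierstrassCurve.Projective.nonsingular_of_Z_ne_zero hz]
      rw [WeierstrassCurve.Projective.equation_of_Z_ne_zero hz] at heq
      exact (WeierstrassCurve.Affine.equation_iff_nonsingular_of_Δ_ne_zero hΔ).1 heq
    rw [WeierstrassCurve.Projective.nonsingular_iff] at hns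
    rcases hns.2 with h' | h' | h'
    · exact h' (by linear_combination -g0)
    · exact h' (by linear_combination -g1)
    · refine h' ?_
      rw [show W.toProjective.a₆ = 0 from h6]
      linear_combination -g2

end Gradient

theorem isPrimitiveMod_add_smul {p a : ℕ} (ha : a ≠ 0) (x y : Fin 3 → ℤ) :
    IsPrimitiveMod p (x + ((p ^ a : ℕ) : ℤ) • y) ↔ IsPrimitiveMod p x := by
  refine exists_congr fun i => not_congr ?_
  have : (p : ℤ) ∣ ((p ^ a : ℕ) : ℤ) * y i :=
    (Int.natCast_dvd_natCast.2 (dvd_pow_self p ha)).mul_right _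
  exact (dvd_add_left this)

section Hensel

variable {p : ℕ} [hp : Fact p.Prime]

theorem card_dotProduct_eq {F : Type*} [Field F] [Fintype F] [DecidableEq F] {g : Fin 3 → F}
    (hg : g ≠ 0) (c : F) :
    (Finset.univ.filter fun b : Fin 3 → F => g ⬝ᵥ b = c).card = Fintype.card F ^ 2 := by
  obtain ⟨i, hi⟩ : ∃ i, g i ≠ 0 := Function.ne_iff.1 hg
  let f : (Fin 3 → F) →+ F := AddMonoidHom.mk' (fun b => g ⬝ᵥ b) fun b b' => dotProduct_add _ _ _
  have hs : Function.Surjective f := fun d => ⟨Pi.single i ((g i)⁻¹ * d), by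
    change g ⬝ᵥ _ = d
    rw [dotProduct_single, mul_inv_cancel_left₀ hi]⟩
  have h1 := AddSubgroup.card_mul_index f.ker
  rw [AddSubgroup.index_ker, AddMonoidHom.range_eq_top.2 hs, Nat.card_fun] at h1
  simp only [AddSubgroup.card_top, Nat.card_eq_fintype_card, Fintype.card_fin] at h1
  rw [pow_succ] at h1
  have h2 := Nat.eq_of_mul_eq_mul_right Fintype.card_pos h1
  obtain ⟨b₀, hb₀⟩ := hs c
  rw [← h2, ← Fintype.card_subtype]
  refine Fintype.card_congr ((Equiv.subRight b₀).subtypeEquiv fun b => ?_)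
  rw [AddMonoidHom.mem_ker, Equiv.subRight_apply, map_sub, hb₀, sub_eq_zero]
  rfl

theorem le_truncVal_iff {a j : ℕ} {d : ℤ} :
    j ≤ truncVal p a d ↔ j ≤ a ∧ ((p ^ j : ℕ) : ℤ) ∣ d := by
  obtain ⟨h1, h2⟩ := gcd_eq_pow_truncVal (p := p) a d
  rw [← Nat.pow_dvd_pow_iff_le_right hp.out.one_lt, ← h2, ← Int.natCast_dvd_natCast,
    Int.dvd_coe_gcd_iff, and_comm, Int.natCast_dvd_natCast,
    Nat.pow_dvd_pow_iff_le_right hp.out.one_lt]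

theorem truncVal_of_dvd {a : ℕ} {d : ℤ} (h : ((p ^ a : ℕ) : ℤ) ∣ d) : truncVal p a d = a :=
  le_antisymm (gcd_eq_pow_truncVal a d).1 (le_truncVal_iff.2 ⟨le_rfl, h⟩)

theorem truncVal_succ_of_not_dvd {a : ℕ} {d d' : ℤ} (hd : ((p ^ a : ℕ) : ℤ) ∣ d' - d)
    (h : ¬ ((p ^ a : ℕ) : ℤ) ∣ d) : truncVal p (a + 1) d' = truncVal p a d := by
  refine eq_of_forall_le_iff fun j => ?_
  rw [le_truncVal_iff, le_truncVal_iff]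
  have hj : ∀ {j}, j ≤ a → ((p ^ j : ℕ) : ℤ) ∣ d' - d := fun hj =>
    (Int.natCast_dvd_natCast.2 (pow_dvd_pow p hj)).trans hd
  constructor
  · rintro ⟨h1, h2⟩
    have hja : j ≤ a := by
      by_contra hlt
      apply h
      have h3 : ((p ^ a : ℕ) : ℤ) ∣ d' :=
        (Int.natCast_dvd_natCast.2 (pow_dvd_pow p (by omega))).trans h2
      exact (dvd_iff_dvd_of_dvd_sub hd).1 h3
    exact ⟨hja, (dvd_iff_dvd_of_dvd_sub (hj hja)).1 h2⟩
  · rintro ⟨h1, h2⟩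
    exact ⟨by omega, (dvd_iff_dvd_of_dvd_sub (hj h1)).2 h2⟩

theorem truncVal_succ_of_dvd {a : ℕ} {d : ℤ} (h : ((p ^ a : ℕ) : ℤ) ∣ d)
    (h' : ¬ ((p ^ (a + 1) : ℕ) : ℤ) ∣ d) : truncVal p (a + 1) d = a := by
  refine eq_of_forall_le_iff fun j => ?_
  rw [le_truncVal_iff]
  constructor
  · rintro ⟨h1, h2⟩
    rcases Nat.lt_or_ge a j with hj | hj
    · obtain rfl : j = a + 1 := by omega
      exact absurd h2 h'
    · exact hj
  · intro hj
    exact ⟨by omega, (Int.natCast_dvd_natCast.2 (pow_dvd_pow p hj)).trans h⟩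

/-- The integer representatives between `0` and `N - 1` of a vector modulo `N`. -/
def liftVec {N : ℕ} (v : Fin 3 → ZMod N) : Fin 3 → ℤ := fun i => ((v i).val : ℤ)

theorem intCast_liftVec {N : ℕ} [NeZero N] (v : Fin 3 → ZMod N) (i : Fin 3) :
    ((liftVec v i : ℤ) : ZMod N) = v i := by simp [liftVec]

variable (p) in
/-- Base `p` digits: residues modulo `p ^ (a + 1)` as residues modulo `p ^ a` and modulo `p`. -/
noncomputable def digitEquiv (a : ℕ) : ZMod (p ^ a) × ZMod p ≃ ZMod (p ^ (a + 1)) :=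
  have : NeZero (p ^ a) := ⟨pow_ne_zero _ hp.out.ne_zero⟩
  have : NeZero (p ^ (a + 1)) := ⟨pow_ne_zero _ hp.out.ne_zero⟩
  Equiv.ofBijective (fun x => ((x.1.val + p ^ a * x.2.val : ℕ) : ZMod (p ^ (a + 1)))) <| by
    rw [Fintype.bijective_iff_injective_and_card]
    have hlt : ∀ x : ZMod (p ^ a) × ZMod p, x.1.val + p ^ a * x.2.val < p ^ (a + 1) := by
      intro x
      have h1 := x.1.val_lt
      have h2 := x.2.val_lt
      calc x.1.val + p ^ a * x.2.val < p ^ a * (x.2.val + 1) := by rw [mul_add]; omega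
        _ ≤ p ^ a * p := Nat.mul_le_mul_left _ h2
        _ = _ := (pow_succ p a).symm
    refine ⟨fun x y hxy => ?_, by simp [ZMod.card, pow_succ]⟩
    have h := congrArg ZMod.val hxy
    simp only at h
    rw [ZMod.val_cast_of_lt (hlt x), ZMod.val_cast_of_lt (hlt y)] at h
    have hm := congrArg (· % p ^ a) h
    have hd := congrArg (· / p ^ a) h
    simp only [Nat.add_mul_mod_self_left, Nat.mod_eq_of_lt (ZMod.val_lt _)] at hm
    simp only [Nat.add_mul_div_left _ _ (NeZero.pos (p ^ a)),
      Nat.div_eq_of_lt (ZMod.val_lt _), zero_add] at hd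
    exact Prod.ext (ZMod.val_injective _ hm) (ZMod.val_injective _ hd)

theorem val_digitEquiv (a : ℕ) (x : ZMod (p ^ a)) (y : ZMod p) :
    (digitEquiv p a (x, y)).val = x.val + p ^ a * y.val := by
  have : NeZero (p ^ a) := ⟨pow_ne_zero _ hp.out.ne_zero⟩
  have h1 := x.val_lt
  have h2 := y.val_lt
  change ((x.val + p ^ a * y.val : ℕ) : ZMod (p ^ (a + 1))).val = _
  apply ZMod.val_cast_of_lt
  calc x.val + p ^ a * y.val < p ^ a * (y.val + 1) := by rw [mul_add]; omega
    _ ≤ p ^ a * p := Nat.mul_le_mul_left _ h2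
    _ = _ := (pow_succ p a).symm

instance neZero_prime_pow (a : ℕ) : NeZero (p ^ a) := ⟨pow_ne_zero _ hp.out.ne_zero⟩

/-- Splits off the top base-`p` digit of every coordinate. Working with integer representatives lets
one function `g` be used at all levels. -/
theorem sum_liftVec_succ {M : Type*} [AddCommMonoid M] (a : ℕ) (g : (Fin 3 → ℤ) → M) :
    ∑ v : Fin 3 → ZMod (p ^ (a + 1)), g (liftVec v) =
      ∑ v : Fin 3 → ZMod (p ^ a), ∑ b : Fin 3 → ZMod p,
        g (liftVec v + ((p ^ a : ℕ) : ℤ) • liftVec b) := by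
  rw [← Fintype.sum_prod_type']
  let E : (Fin 3 → ZMod (p ^ a)) × (Fin 3 → ZMod p) ≃ (Fin 3 → ZMod (p ^ (a + 1))) :=
    (Equiv.arrowProdEquivProdArrow (Fin 3) (fun _ => ZMod (p ^ a)) (fun _ => ZMod p)).symm.trans
      (Equiv.arrowCongr (Equiv.refl _) (digitEquiv p a))
  rw [← E.sum_comp]
  refine Finset.sum_congr rfl fun x _ => ?_
  congr 1
  ext i
  change ((digitEquiv p a (x.1 i, x.2 i)).val : ℤ) = _
  rw [val_digitEquiv]
  simp [liftVec]

open Classical in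
/-- The primitive vectors modulo `p ^ a`. -/
noncomputable def primitiveVecs (p a : ℕ) [Fact p.Prime] : Finset (Fin 3 → ZMod (p ^ a)) :=
  Finset.univ.filter fun v => IsPrimitiveMod p (liftVec v)

variable {W : WeierstrassCurve ℤ}

-- Hensel's lemma as a count. As `a ≥ 1`, the quadratic Taylor term vanishes modulo `pᵃ⁺¹`, and
-- after division by `pᵃ` the condition on `b` is an inhomogeneous linear equation over `𝔽_p` whose
-- coefficient vector, the gradient, is nonzero.
open Classical in
theorem card_lift_zeros (h6 : W.a₆ = 0) (hΔ : ¬ (p : ℤ) ∣ W.Δ) {x : Fin 3 → ℤ}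
    (hx : IsPrimitiveMod p x) {a : ℕ} (ha : a ≠ 0) (h : ((p ^ a : ℕ) : ℤ) ∣ cubicForm W x) :
    (Finset.univ.filter fun b : Fin 3 → ZMod p => ((p ^ (a + 1) : ℕ) : ℤ) ∣
      cubicForm W (x + ((p ^ a : ℕ) : ℤ) • liftVec b)).card = p ^ 2 := by
  let φ := Int.castRingHom (ZMod p)
  have hΔ' : (W.map φ).Δ ≠ 0 := by
    rw [WeierstrassCurve.map_Δ]
    exact fun h => hΔ ((ZMod.intCast_zmod_eq_zero_iff_dvd _ _).1 h)
  have hx' : φ ∘ x ≠ 0 := by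
    obtain ⟨i, hi⟩ := hx
    exact fun h => hi ((ZMod.intCast_zmod_eq_zero_iff_dvd _ _).1 (congrFun h i))
  have h0 : cubicForm (W.map φ) (φ ∘ x) = 0 := by
    rw [cubicForm_map]
    exact (ZMod.intCast_zmod_eq_zero_iff_dvd _ _).2
      ((Int.natCast_dvd_natCast.2 (dvd_pow_self p ha)).trans h)
  have hg := cubicGradient_ne_zero (by simp [h6]) hΔ' hx' h0
  obtain ⟨d, hd⟩ := h
  have hcard := card_dotProduct_eq hg (-(d : ZMod p))
  rw [ZMod.card] at hcard
  rw [← hcard]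
  congr 1
  ext b
  simp only [Finset.mem_filter, Finset.mem_univ, true_and]
  obtain ⟨q, hq⟩ := cubicForm_add_smul W x (liftVec b) ((p ^ a : ℕ) : ℤ)
  rw [hq, hd]
  have hpa : ((p ^ a : ℕ) : ℤ) ≠ 0 := by exact_mod_cast pow_ne_zero _ hp.out.ne_zero
  have e1 : ((p ^ a : ℕ) : ℤ) * d + ((p ^ a : ℕ) : ℤ) * (cubicGradient W x ⬝ᵥ liftVec b) +
      ((p ^ a : ℕ) : ℤ) ^ 2 * q = ((p ^ a : ℕ) : ℤ) *
        (d + cubicGradient W x ⬝ᵥ liftVec b + ((p ^ a : ℕ) : ℤ) * q) := by ring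
  have e2 : ((p ^ (a + 1) : ℕ) : ℤ) = ((p ^ a : ℕ) : ℤ) * p := by push_cast; ring
  rw [e1, e2, mul_dvd_mul_iff_left hpa, ← ZMod.intCast_zmod_eq_zero_iff_dvd]
  have e3 : ((((p ^ a : ℕ) : ℤ) : ℤ) : ZMod p) = 0 :=
    (ZMod.intCast_zmod_eq_zero_iff_dvd _ _).2 (Int.natCast_dvd_natCast.2 (dvd_pow_self p ha))
  have e4 : ((cubicGradient W x ⬝ᵥ liftVec b : ℤ) : ZMod p) =
      cubicGradient (W.map φ) (φ ∘ x) ⬝ᵥ b := by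
    rw [cubicGradient_map, dotProduct, dotProduct, Int.cast_sum]
    refine Finset.sum_congr rfl fun i _ => ?_
    rw [Int.cast_mul, intCast_liftVec]
    rfl
  rw [Int.cast_add, Int.cast_add, Int.cast_mul, e3, zero_mul, add_zero, e4, add_comm,
    eq_neg_iff_add_eq_zero]

open Classical in
/-- The number of primitive vectors modulo `p ^ a` on the cubic. -/
noncomputable def zeroCount (W : WeierstrassCurve ℤ) (p a : ℕ) [Fact p.Prime] : ℕ :=
  ((primitiveVecs p a).filter fun v => ((p ^ a : ℕ) : ℤ) ∣ cubicForm W (liftVec v)).card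

/-- The generating function of the primitive vectors modulo `p ^ a` by the value of the cubic. -/
noncomputable def valueSum (W : WeierstrassCurve ℤ) (p a : ℕ) [Fact p.Prime] (T : ℂ) : ℂ :=
  -- The exponent is `a` for the lattice plus `6a - 2 * truncVal` for its annihilator; as `truncVal
  -- ≤ a`, the subtraction is never truncated.
  ∑ v ∈ primitiveVecs p a, T ^ (7 * a - 2 * truncVal p a (cubicForm W (liftVec v)))

theorem sum_primitiveVecs_succ {M : Type*} [AddCommMonoid M] {a : ℕ} (ha : a ≠ 0)
    (g : (Fin 3 → ℤ) → M) :
    ∑ v ∈ primitiveVecs p (a + 1), g (liftVec v) =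
      ∑ v ∈ primitiveVecs p a, ∑ b : Fin 3 → ZMod p,
        g (liftVec v + ((p ^ a : ℕ) : ℤ) • liftVec b) := by
  classical
  rw [primitiveVecs, primitiveVecs, Finset.sum_filter, Finset.sum_filter,
    sum_liftVec_succ a (fun x => if IsPrimitiveMod p x then g x else 0)]
  refine Finset.sum_congr rfl fun v _ => ?_
  simp only [isPrimitiveMod_add_smul ha]
  split_ifs <;> simp

theorem dvd_cubicForm_add_smul_sub (x y : Fin 3 → ℤ) (N : ℤ) :
    N ∣ cubicForm W (x + N • y) - cubicForm W x := by
  obtain ⟨q, hq⟩ := cubicForm_add_smul W x y N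
  exact ⟨cubicGradient W x ⬝ᵥ y + N * q, by rw [hq]; ring⟩

theorem zeroCount_succ (h6 : W.a₆ = 0) (hΔ : ¬ (p : ℤ) ∣ W.Δ) {a : ℕ} (ha : a ≠ 0) :
    zeroCount W p (a + 1) = p ^ 2 * zeroCount W p a := by
  classical
  rw [zeroCount, zeroCount, Finset.card_filter, Finset.card_filter,
    sum_primitiveVecs_succ ha
      (fun x => if ((p ^ (a + 1) : ℕ) : ℤ) ∣ cubicForm W x then 1 else 0), Finset.mul_sum]
  refine Finset.sum_congr rfl fun v hv => ?_
  rw [← Finset.card_filter]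
  split_ifs with h
  · rw [mul_one]
    convert card_lift_zeros h6 hΔ (Finset.mem_filter.1 hv).2 ha h
  · rw [mul_zero, Finset.card_eq_zero, Finset.filter_eq_empty_iff]
    intro b _ hb
    have h1 : ((p ^ a : ℕ) : ℤ) ∣ cubicForm W (liftVec v + ((p ^ a : ℕ) : ℤ) • liftVec b) :=
      (Int.natCast_dvd_natCast.2 (pow_dvd_pow p (Nat.le_succ a))).trans hb
    exact h ((dvd_iff_dvd_of_dvd_sub (dvd_cubicForm_add_smul_sub _ _ _)).1 h1)

/-- Off the cubic modulo `pᵃ` all `p³` lifts keep their valuation, and the exponent grows by 7. On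
it, `p²` of the `p³` lifts gain one in valuation, which replaces `T ^ (5a + 7)` by `T ^ (5a + 5)`.
-/
theorem valueSum_succ (h6 : W.a₆ = 0) (hΔ : ¬ (p : ℤ) ∣ W.Δ) {a : ℕ} (ha : a ≠ 0) (T : ℂ) :
    valueSum W p (a + 1) T = p ^ 3 * T ^ 7 * valueSum W p a T +
      p ^ 2 * (T ^ 5 - T ^ 7) * T ^ (5 * a) * zeroCount W p a := by
  classical
  rw [valueSum, sum_primitiveVecs_succ ha
    (fun x => T ^ (7 * (a + 1) - 2 * truncVal p (a + 1) (cubicForm W x))), valueSum, zeroCount,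
    Finset.card_filter, Nat.cast_sum, Finset.mul_sum, Finset.mul_sum, ← Finset.sum_add_distrib]
  refine Finset.sum_congr rfl fun v hv => ?_
  have hle := (gcd_eq_pow_truncVal (p := p) a (cubicForm W (liftVec v))).1
  have hcard : Fintype.card (Fin 3 → ZMod p) = p ^ 3 := by simp [ZMod.card]
  split_ifs with h
  · have h2 := card_lift_zeros h6 hΔ (Finset.mem_filter.1 hv).2 ha h
    have hval : ∀ b : Fin 3 → ZMod p, T ^ (7 * (a + 1) - 2 * truncVal p (a + 1)
        (cubicForm W (liftVec v + ((p ^ a : ℕ) : ℤ) • liftVec b))) =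
        T ^ (5 * a + 7) + if ((p ^ (a + 1) : ℕ) : ℤ) ∣
          cubicForm W (liftVec v + ((p ^ a : ℕ) : ℤ) • liftVec b)
            then T ^ (5 * a + 5) - T ^ (5 * a + 7) else 0 := by
      intro b
      have h1 := (dvd_iff_dvd_of_dvd_sub (dvd_cubicForm_add_smul_sub (W := W) (liftVec v)
        (liftVec b) ((p ^ a : ℕ) : ℤ))).2 h
      split_ifs with h3
      · rw [truncVal_of_dvd h3, show 7 * (a + 1) - 2 * (a + 1) = 5 * a + 5 by omega]
        ring
      · rw [truncVal_succ_of_dvd h1 h3, show 7 * (a + 1) - 2 * a = 5 * a + 7 by omega]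
        ring
    rw [Finset.sum_congr rfl fun b _ => hval b, Finset.sum_add_distrib, ← Finset.sum_filter,
      Finset.sum_const, Finset.sum_const, h2, Finset.card_univ, hcard, truncVal_of_dvd h,
      show 7 * a - 2 * a = 5 * a by omega]
    simp only [nsmul_eq_mul]
    push_cast
    ring
  · have hval : ∀ b : Fin 3 → ZMod p, T ^ (7 * (a + 1) - 2 * truncVal p (a + 1)
        (cubicForm W (liftVec v + ((p ^ a : ℕ) : ℤ) • liftVec b))) =
        T ^ 7 * T ^ (7 * a - 2 * truncVal p a (cubicForm W (liftVec v))) := by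
      intro b
      rw [truncVal_succ_of_not_dvd (dvd_cubicForm_add_smul_sub _ _ _) h, ← pow_add]
      congr 1
      omega
    rw [Finset.sum_congr rfl fun b _ => hval b, Finset.sum_const, Finset.card_univ, hcard]
    simp only [nsmul_eq_mul]
    push_cast
    ring

/-! ### Points over the prime field -/

theorem card_nonzero_zeros {F : Type*} [Field F] [Finite F] {W : WeierstrassCurve F}
    (h6 : W.a₆ = 0) : Nat.card {v : Fin 3 → F // v ≠ 0 ∧ cubicForm W v = 0} =
      (curvePoints W).ncard * (Nat.card F - 1) := by
  rw [← Nat.card_units, ← Nat.card_coe_set_eq, ← Nat.card_prod]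
  refine (Nat.card_congr (Equiv.ofBijective
    (fun x : curvePoints W × Fˣ => ⟨x.2 • x.1.1.rep,
      (smul_ne_zero_iff_ne x.2).2 x.1.1.rep_nonzero, (equation_iff_cubicForm h6 _).1
        ((WeierstrassCurve.Projective.equation_smul _ x.2.isUnit).2 x.1.2)⟩) ⟨?_, ?_⟩)).symm
  · rintro ⟨⟨P, hP⟩, c⟩ ⟨⟨P', hP'⟩, c'⟩ h
    have h1 : c • P.rep = c' • P'.rep := congrArg Subtype.val h
    obtain rfl : P = P' := by
      rw [← P.mk_rep, ← P'.mk_rep, Projectivization.mk_eq_mk_iff]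
      exact ⟨c⁻¹ * c', by rw [mul_smul, ← h1, inv_smul_smul]⟩
    have h2 : c = c' := by
      ext
      exact smul_left_injective F P.rep_nonzero h1
    rw [h2]
  · rintro ⟨v, hv, h⟩
    obtain ⟨c, hc⟩ := Projectivization.exists_smul_eq_mk_rep F v hv
    refine ⟨⟨⟨Projectivization.mk F v hv, ?_⟩, c⁻¹⟩, Subtype.ext ?_⟩
    · change W.toProjective.Equation (Projectivization.mk F v hv).rep
      rw [← hc]
      exact (WeierstrassCurve.Projective.equation_smul _ c.isUnit).2
        ((equation_iff_cubicForm h6 v).2 h)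
    · change c⁻¹ • (Projectivization.mk F v hv).rep = v
      rw [← hc, inv_smul_smul]

theorem isPrimitiveMod_liftVec_iff (b : Fin 3 → ZMod p) : IsPrimitiveMod p (liftVec b) ↔ b ≠ 0 := by
  rw [Function.ne_iff]
  refine exists_congr fun i => not_congr ?_
  rw [← ZMod.intCast_zmod_eq_zero_iff_dvd, intCast_liftVec]
  rfl

theorem sum_primitiveVecs_one {M : Type*} [AddCommMonoid M] (g : (Fin 3 → ℤ) → M) :
    ∑ v ∈ primitiveVecs p 1, g (liftVec v) =
      ∑ b : Fin 3 → ZMod p with b ≠ 0, g (liftVec b) := by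
  classical
  -- The digit decomposition is applied at `a = 0`, where the lower part is trivial; primitivity now
  -- depends on the top digit, so `sum_primitiveVecs_succ` does not cover this case.
  have : Subsingleton (ZMod (p ^ 0)) := by rw [pow_zero]; infer_instance
  rw [primitiveVecs, Finset.sum_filter, Finset.sum_filter,
    sum_liftVec_succ 0 (fun x => if IsPrimitiveMod p x then g x else 0),
    Fintype.sum_subsingleton _ (0 : Fin 3 → ZMod (p ^ 0))]
  refine Finset.sum_congr rfl fun b _ => ?_
  have : liftVec (0 : Fin 3 → ZMod (p ^ 0)) + ((p ^ 0 : ℕ) : ℤ) • liftVec b = liftVec b := by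
    have h0 : liftVec (0 : Fin 3 → ZMod (p ^ 0)) = 0 := by
      ext i
      exact congrArg Nat.cast ZMod.val_zero
    rw [h0, pow_zero, Nat.cast_one, one_smul, zero_add]
  rw [this]
  simp only [isPrimitiveMod_liftVec_iff]

theorem dvd_cubicForm_liftVec_iff (b : Fin 3 → ZMod p) : (p : ℤ) ∣ cubicForm W (liftVec b) ↔
    cubicForm (W.map (Int.castRingHom (ZMod p))) b = 0 := by
  rw [← ZMod.intCast_zmod_eq_zero_iff_dvd]
  have : b = Int.castRingHom (ZMod p) ∘ liftVec b := by
    ext i; exact (intCast_liftVec b i).symm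
  conv_rhs => rw [this, cubicForm_map]
  rfl

theorem zeroCount_one (h6 : W.a₆ = 0) :
    zeroCount W p 1 = (redCurve p W).ncard * (p - 1) := by
  classical
  have h := card_nonzero_zeros (W := W.map (Int.castRingHom (ZMod p))) (by simp [h6])
  rw [Nat.card_zmod] at h
  rw [redCurve, ← h, zeroCount, Finset.card_filter,
    sum_primitiveVecs_one (fun x => if ((p ^ 1 : ℕ) : ℤ) ∣ cubicForm W x then 1 else 0),
    ← Finset.card_filter, Finset.filter_filter, Nat.card_eq_fintype_card, Fintype.card_subtype]
  congr 1
  ext b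
  simp only [Finset.mem_filter, Finset.mem_univ, true_and, pow_one, dvd_cubicForm_liftVec_iff]

theorem valueSum_one (T : ℂ) :
    valueSum W p 1 T = (p ^ 3 - 1) * T ^ 7 + zeroCount W p 1 * (T ^ 5 - T ^ 7) := by
  classical
  have hcard : ((primitiveVecs p 1).card : ℂ) = p ^ 3 - 1 := by
    have h1 : (primitiveVecs p 1).card + 1 = p ^ 3 := by
      rw [Finset.card_eq_sum_ones, sum_primitiveVecs_one (fun _ => 1), ← Finset.card_eq_sum_ones,
        Finset.filter_ne', Finset.card_erase_of_mem (Finset.mem_univ _), Finset.card_univ]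
      simp only [Fintype.card_pi, ZMod.card, Finset.prod_const, Finset.card_univ, Fintype.card_fin]
      exact Nat.sub_add_cancel (Nat.one_le_pow _ _ hp.out.pos)
    rw [eq_sub_iff_add_eq]
    exact_mod_cast h1
  have hval : ∀ v ∈ primitiveVecs p 1,
      T ^ (7 * 1 - 2 * truncVal p 1 (cubicForm W (liftVec v))) =
      T ^ 7 + if ((p ^ 1 : ℕ) : ℤ) ∣ cubicForm W (liftVec v) then T ^ 5 - T ^ 7 else 0 := by
    intro v _
    split_ifs with h
    · rw [truncVal_of_dvd h]
      ring
    · rw [truncVal_succ_of_dvd (a := 0) (by simp) h]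
      ring
  rw [valueSum, Finset.sum_congr rfl hval, Finset.sum_add_distrib, ← Finset.sum_filter,
    Finset.sum_const, Finset.sum_const, nsmul_eq_mul, nsmul_eq_mul, hcard, zeroCount]

end Hensel

/-! ### Linear recursions -/

/-- Unrolled, `x` is the Cauchy product of the powers of `l` with the sequence `x 0, y 0, y 1, …`,
so its summability comes for free. -/
theorem hasSum_of_linear_recursion {x y : ℕ → ℂ} {l Y : ℂ} (hl : ‖l‖ < 1) (hy : HasSum y Y)
    (h : ∀ n, x (n + 1) = l * x n + y n) : HasSum x ((x 0 + Y) / (1 - l)) := by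
  let z : ℕ → ℂ := fun n => Nat.casesOn n (x 0) y
  have hz : HasSum z (x 0 + Y) := by
    have := (hasSum_nat_add_iff (f := z) (g := Y) 1).1 hy
    simpa [z, add_comm] using this
  have hx : ∀ n, x n = ∑ kl ∈ Finset.HasAntidiagonal.antidiagonal n, l ^ kl.1 * z kl.2 := by
    intro n
    induction n with
    | zero => simp [z]
    | succ n ih =>
      rw [Finset.Nat.sum_antidiagonal_succ, h, ih, Finset.mul_sum, add_comm]
      congr 1
      · simp [z]
      · refine Finset.sum_congr rfl fun kl _ => ?_
        simp only [pow_succ']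
        ring
  have hg := hasSum_geometric_of_norm_lt_one hl
  have h1 : Summable fun n => ‖l ^ n‖ := hg.summable.norm
  have h2 : Summable fun n => ‖z n‖ := hz.summable.norm
  have h3 := tsum_mul_tsum_eq_tsum_sum_antidiagonal_of_summable_norm h1 h2
  have h4 := (summable_norm_sum_mul_antidiagonal_of_summable_norm h1 h2).of_norm
  rw [hg.tsum_eq, hz.tsum_eq] at h3
  have h5 := h4.hasSum
  rw [← h3] at h5
  rw [div_eq_inv_mul]
  exact h5.congr_fun hx

/-! ### Summation over lattices -/

theorem residueIndex_top {p : ℕ} : residueIndex p (⊤ : AddSubgroup (Fin 3 → ℤ)) = 1 := by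
  simp [residueIndex]

section Sums

variable (W : WeierstrassCurve ℤ) (p : ℕ) [hp : Fact p.Prime]

/-- The contribution of the lattice `Λ` to the zeta function. -/
noncomputable def latticeTerm (T : ℂ) (Λ : AddSubgroup (Fin 3 → ℤ)) : ℂ :=
  ((p ^ (6 * indexExp p Λ) : ℕ) : ℂ) * T ^ (indexExp p Λ + indexExp p (annihilator W Λ))

/-- The lattices of level `n`. -/
noncomputable def levelFinset (n : ℕ) : Finset (AddSubgroup (Fin 3 → ℤ)) :=
  (finite_setOf_isLevel (p := p) (AddEquiv.refl (Fin 3 → ℤ)) n).toFinset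

open Classical in
/-- The contribution of the lattices of level `n` and residue index `p ^ k`. -/
noncomputable def partSum (T : ℂ) (n k : ℕ) : ℂ :=
  ∑ Λ ∈ levelFinset p n with residueIndex p Λ = p ^ k, latticeTerm W p T Λ

variable {W p}

theorem mem_levelFinset {n : ℕ} {Λ : AddSubgroup (Fin 3 → ℤ)} :
    Λ ∈ levelFinset p n ↔ IsLevel p n Λ := by
  simp [levelFinset]

theorem hasPIndex_of_mem_levelFinset {n : ℕ} {Λ : AddSubgroup (Fin 3 → ℤ)}
    (h : Λ ∈ levelFinset p n) : HasPIndex p Λ :=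
  (mem_levelFinset.1 h).hasPIndex (AddEquiv.refl _)

theorem isLevel_succ_of_residueIndex {n k : ℕ} (hk : k ≠ 0) {Φ : AddSubgroup (Fin 3 → ℤ)}
    (h : residueIndex p Φ = p ^ k) : IsLevel p (n + 1) Φ ↔ IsLevel p n (pDiv p Φ) := by
  refine ⟨fun h => h.1, fun h1 => ⟨h1, ?_⟩⟩
  rintro rfl
  rw [residueIndex_top] at h
  exact (Nat.one_lt_pow hk hp.out.one_lt).ne h

/-- Passing from `pDiv p Φ` to `Φ` multiplies the index by `pᵏ` and the index of the annihilator by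
`p⁶`. -/
theorem latticeTerm_of_residueIndex {T : ℂ} {k : ℕ} (hk : 2 ≤ k) {Φ : AddSubgroup (Fin 3 → ℤ)}
    (hΦ : HasPIndex p Φ) (h : residueIndex p Φ = p ^ k) :
    latticeTerm W p T Φ = (p : ℂ) ^ (6 * k) * T ^ (k + 6) * latticeTerm W p T (pDiv p Φ) := by
  rw [latticeTerm, latticeTerm, indexExp_of_residueIndex hΦ.pDiv h, indexExp_annihilator hk h hΦ]
  push_cast
  ring

theorem sum_levelFinset (T : ℂ) (n : ℕ) : ∑ Λ ∈ levelFinset p n, latticeTerm W p T Λ =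
    ∑ k ∈ Finset.range 4, partSum W p T n k := by
  classical
  simp only [partSum, Finset.sum_filter]
  rw [Finset.sum_comm]
  refine Finset.sum_congr rfl fun Λ _ => ?_
  obtain ⟨k, hk, h⟩ := residueIndex_eq_pow (p := p) (AddEquiv.refl (Fin 3 → ℤ)) Λ
  rw [h, Finset.sum_eq_single_of_mem k (Finset.mem_range.2 (by omega))]
  · simp
  · intro l _ hl
    rw [if_neg fun he => hl (Nat.pow_right_injective hp.out.two_le he).symm]

theorem partSum_succ_zero (T : ℂ) (n : ℕ) : partSum W p T (n + 1) 0 = 0 := by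
  classical
  rw [partSum, Finset.filter_false_of_mem, Finset.sum_empty]
  intro Λ hΛ h
  exact (mem_levelFinset.1 hΛ).2
    (eq_top_of_residueIndex_eq_one (hasPIndex_of_mem_levelFinset hΛ) (by simpa using h))

theorem levelFinset_zero : levelFinset p 0 = {⊤} := by
  ext Λ
  rw [mem_levelFinset, Finset.mem_singleton]
  rfl

theorem annihilator_top : annihilator W ⊤ = ⊤ :=
  top_unique fun _ _ => ⟨fun _ => trivial, fun _ => trivial⟩

theorem partSum_zero_zero (T : ℂ) : partSum W p T 0 0 = 1 := by
  classical
  rw [partSum, levelFinset_zero, Finset.filter_true_of_mem (by simp [residueIndex_top])]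
  simp [latticeTerm, indexExp, annihilator_top]

theorem partSum_zero_of_ne {k : ℕ} (hk : k ≠ 0) (T : ℂ) : partSum W p T 0 k = 0 := by
  classical
  rw [partSum, levelFinset_zero, Finset.filter_false_of_mem, Finset.sum_empty]
  simp only [Finset.mem_singleton, forall_eq, residueIndex_top]
  exact (Nat.one_lt_pow hk hp.out.one_lt).ne

/-- Residue index `p³` means `Φ ≤ pℤ³`, so `Φ = pΛ` for an arbitrary lattice `Λ` of the previous
level. -/
theorem partSum_succ_three (T : ℂ) (n : ℕ) : partSum W p T (n + 1) 3 =
    (p : ℂ) ^ 18 * T ^ 9 * ∑ Λ ∈ levelFinset p n, latticeTerm W p T Λ := by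
  classical
  have e := AddEquiv.refl (Fin 3 → ℤ)
  have hres : ∀ Λ : AddSubgroup (Fin 3 → ℤ), residueIndex p (pMul p Λ) = p ^ 3 := fun Λ =>
    (le_pMul_top_iff e).1 (pMul_mono le_top)
  rw [partSum, Finset.mul_sum]
  symm
  refine Finset.sum_bij (fun Λ _ => pMul p Λ) ?_ ?_ ?_ ?_
  · intro Λ hΛ
    rw [Finset.mem_filter, mem_levelFinset, isLevel_succ_of_residueIndex three_ne_zero (hres Λ),
      pDiv_pMul e]
    exact ⟨mem_levelFinset.1 hΛ, hres Λ⟩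
  · intro Λ _ Λ' _ h
    rw [← pDiv_pMul (p := p) e Λ, h, pDiv_pMul e]
  · intro Φ hΦ
    rw [Finset.mem_filter, mem_levelFinset] at hΦ
    refine ⟨pDiv p Φ, mem_levelFinset.2 hΦ.1.1, ?_⟩
    rw [pMul_pDiv, inf_eq_left]
    exact (le_pMul_top_iff e).2 hΦ.2
  · intro Λ hΛ
    have hP : HasPIndex p (pMul p Λ) := hasPIndex_of_pDiv e (by
      rw [pDiv_pMul e]; exact hasPIndex_of_mem_levelFinset hΛ)
    rw [latticeTerm_of_residueIndex (by norm_num) hP (hres Λ), pDiv_pMul e]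

/-- The lattices are grouped by `Λ = pDiv p Φ`; each fibre has constant term and is counted by
`card_setOf_pDiv_eq`. -/
theorem partSum_succ_two (T : ℂ) (n : ℕ) : ((p : ℂ) - 1) * partSum W p T (n + 1) 2 =
    (p : ℂ) ^ 12 * T ^ 8 *
      ∑ Λ ∈ levelFinset p n, ((p : ℂ) ^ 3 - residueIndex p Λ) * latticeTerm W p T Λ := by
  classical
  have e := AddEquiv.refl (Fin 3 → ℤ)
  have hmaps : ∀ Φ ∈ (levelFinset p (n + 1)).filter (fun Φ => residueIndex p Φ = p ^ 2),
      pDiv p Φ ∈ levelFinset p n := by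
    intro Φ hΦ
    rw [Finset.mem_filter, mem_levelFinset] at hΦ
    exact mem_levelFinset.2 hΦ.1.1
  rw [partSum, ← Finset.sum_fiberwise_of_maps_to hmaps, Finset.mul_sum, Finset.mul_sum]
  refine Finset.sum_congr rfl fun Λ hΛ => ?_
  have hterm : ∀ Φ ∈ ((levelFinset p (n + 1)).filter (fun Φ => residueIndex p Φ = p ^ 2)).filter
      (fun Φ => pDiv p Φ = Λ), latticeTerm W p T Φ =
        (p : ℂ) ^ 12 * T ^ 8 * latticeTerm W p T Λ := by
    intro Φ hΦ
    rw [Finset.mem_filter, Finset.mem_filter] at hΦ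
    rw [latticeTerm_of_residueIndex le_rfl (hasPIndex_of_mem_levelFinset hΦ.1.1) hΦ.1.2, hΦ.2]
  have hset : {Φ : AddSubgroup (Fin 3 → ℤ) | pDiv p Φ = Λ ∧ residueIndex p Φ = p ^ 2} =
      (((levelFinset p (n + 1)).filter (fun Φ => residueIndex p Φ = p ^ 2)).filter
        (fun Φ => pDiv p Φ = Λ) : Finset _) := by
    ext Φ
    rw [Finset.mem_coe, Finset.mem_filter, Finset.mem_filter, mem_levelFinset]
    constructor
    · rintro ⟨h1, h2⟩
      refine ⟨⟨(isLevel_succ_of_residueIndex two_ne_zero h2).2 ?_, h2⟩, h1⟩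
      rw [h1]
      exact mem_levelFinset.1 hΛ
    · rintro ⟨⟨-, h2⟩, h1⟩
      exact ⟨h1, h2⟩
  have hcard := card_setOf_pDiv_eq (p := p) e (hasPIndex_of_mem_levelFinset hΛ)
  rw [hset, Set.ncard_coe_finset] at hcard
  have hle : residueIndex p Λ ≤ p ^ 3 := by
    obtain ⟨k, hk, h⟩ := residueIndex_eq_pow (p := p) e Λ
    rw [h]
    exact Nat.pow_le_pow_right hp.out.pos hk
  have hcard' := congrArg (Nat.cast : ℕ → ℂ) hcard
  rw [Nat.cast_mul, Nat.cast_sub hp.out.one_le, Nat.cast_sub hle, Nat.cast_one, Nat.cast_pow]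
    at hcard'
  rw [Finset.sum_congr rfl hterm, Finset.sum_const, nsmul_eq_mul, ← hcard']
  ring

theorem sum_sub_residueIndex (T : ℂ) (n : ℕ) :
    ∑ Λ ∈ levelFinset p n, ((p : ℂ) ^ 3 - residueIndex p Λ) * latticeTerm W p T Λ =
      ∑ k ∈ Finset.range 4, ((p : ℂ) ^ 3 - p ^ k) * partSum W p T n k := by
  classical
  simp only [partSum, Finset.sum_filter, Finset.mul_sum]
  rw [Finset.sum_comm]
  refine Finset.sum_congr rfl fun Λ _ => ?_
  obtain ⟨k, hk, h⟩ := residueIndex_eq_pow (p := p) (AddEquiv.refl (Fin 3 → ℤ)) Λ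
  rw [h, Finset.sum_eq_single_of_mem k (Finset.mem_range.2 (by omega))]
  · simp
  · intro l _ hl
    rw [if_neg fun he => hl (Nat.pow_right_injective hp.out.two_le he).symm, mul_zero]

/-! ### Cyclic lattices as unit classes of primitive vectors. -/

theorem not_dvd_liftVec_iff_isUnit {a : ℕ} (ha : a ≠ 0) (v : Fin 3 → ZMod (p ^ a)) (i : Fin 3) :
    ¬ (p : ℤ) ∣ liftVec v i ↔ IsUnit (v i) := by
  conv_rhs => rw [← ZMod.natCast_zmod_val (v i)]
  rw [ZMod.isUnit_iff_coprime, liftVec, Int.natCast_dvd_natCast,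
    Nat.coprime_pow_right_iff (Nat.pos_of_ne_zero ha), Nat.coprime_comm,
    hp.out.coprime_iff_not_dvd]

open Classical in
theorem card_fiber_dvdLattice {a : ℕ} (ha : a ≠ 0) {x : Fin 3 → ℤ} (hx : IsPrimitiveMod p x) :
    ((primitiveVecs p a).filter fun v => dvdLattice (p ^ a) (liftVec v) =
      dvdLattice (p ^ a) x).card = Nat.totient (p ^ a) := by
  let x' : Fin 3 → ZMod (p ^ a) := fun i => x i
  obtain ⟨i, hi⟩ := hx
  have hxi : IsUnit (x' i) := by
    have h1 : ((p : ℕ) : ℤ) ∣ x i - liftVec x' i := by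
      have h2 : ((x i - liftVec x' i : ℤ) : ZMod (p ^ a)) = 0 := by
        rw [Int.cast_sub, intCast_liftVec, sub_self]
      exact (Int.natCast_dvd_natCast.2 (dvd_pow_self p ha)).trans
        ((ZMod.intCast_zmod_eq_zero_iff_dvd _ _).1 h2)
    rw [← not_dvd_liftVec_iff_isUnit ha]
    exact fun h => hi ((dvd_iff_dvd_of_dvd_sub h1).2 h)
  rw [← ZMod.card_units_eq_totient, ← Finset.card_univ]
  symm
  refine Finset.card_bij (fun c _ => (c : ZMod (p ^ a)) • x') ?_ ?_ ?_
  · intro c _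
    have hprim : IsPrimitiveMod p (liftVec ((c : ZMod (p ^ a)) • x')) := by
      refine ⟨i, ?_⟩
      rw [not_dvd_liftVec_iff_isUnit ha]
      exact c.isUnit.mul hxi
    rw [Finset.mem_filter, primitiveVecs, Finset.mem_filter]
    refine ⟨⟨Finset.mem_univ _, hprim⟩, ?_⟩
    rw [eq_comm, dvdLattice_eq_iff ⟨i, hi⟩ hprim]
    refine ⟨c, fun j => ?_⟩
    rw [intCast_liftVec]
    rfl
  · intro c _ c' _ h
    ext
    exact hxi.mul_right_cancel (congrFun h i)
  · intro v hv
    rw [Finset.mem_filter, primitiveVecs, Finset.mem_filter] at hv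
    obtain ⟨c, hc⟩ := (dvdLattice_eq_iff ⟨i, hi⟩ hv.1.2 a).1 hv.2.symm
    refine ⟨c, Finset.mem_univ _, ?_⟩
    ext j
    rw [← intCast_liftVec v j, hc j]
    rfl

/-- Summing over primitive vectors counts each lattice with cyclic quotient once for every unit
modulo `pᵃ`. -/
theorem totient_mul_partSum_one (h6 : W.a₆ = 0) (hΔ : ¬ (p : ℤ) ∣ W.Δ) {a : ℕ} (ha : a ≠ 0)
    (T : ℂ) : (Nat.totient (p ^ a) : ℂ) * partSum W p T a 1 = (p : ℂ) ^ (6 * a) *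
      valueSum W p a T := by
  classical
  obtain ⟨b, rfl⟩ : ∃ b, a = b + 1 := ⟨a - 1, by omega⟩
  have hmaps : ∀ v ∈ primitiveVecs p (b + 1), dvdLattice (p ^ (b + 1)) (liftVec v) ∈
      (levelFinset p (b + 1)).filter fun Λ => residueIndex p Λ = p ^ 1 := by
    intro v hv
    have hv' := (Finset.mem_filter.1 hv).2
    rw [Finset.mem_filter, mem_levelFinset, pow_one]
    exact ⟨isLevel_dvdLattice hv' _, residueIndex_dvdLattice hv' b⟩
  rw [valueSum, ← Finset.sum_fiberwise_of_maps_to hmaps, partSum, Finset.mul_sum, Finset.mul_sum]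
  refine Finset.sum_congr rfl fun Φ hΦ => ?_
  rw [Finset.mem_filter, mem_levelFinset, pow_one] at hΦ
  obtain ⟨x, hx, rfl⟩ := exists_eq_dvdLattice hΦ.1 hΦ.2
  have hterm : ∀ v ∈ (primitiveVecs p (b + 1)).filter fun v =>
      dvdLattice (p ^ (b + 1)) (liftVec v) = dvdLattice (p ^ (b + 1)) x,
      T ^ (7 * (b + 1) - 2 * truncVal p (b + 1) (cubicForm W (liftVec v))) =
        T ^ (b + 1 + indexExp p (annihilator W (dvdLattice (p ^ (b + 1)) x))) := by
    intro v hv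
    rw [Finset.mem_filter, primitiveVecs, Finset.mem_filter] at hv
    have h := indexExp_annihilator_dvdLattice h6 hΔ hv.1.2 (b + 1)
    rw [hv.2] at h
    congr 1
    omega
  rw [Finset.sum_congr rfl hterm, Finset.sum_const, nsmul_eq_mul]
  have hc := card_fiber_dvdLattice ha hx
  rw [hc, latticeTerm, indexExp_eq (index_dvdLattice hx (b + 1))]
  push_cast
  ring

/-! ### Convergence and summation of the recursions. -/

theorem norm_pow_mul_pow_lt_one {T : ℂ} (hT : ‖T‖ < ((p : ℝ) ^ 9)⁻¹) {m k : ℕ} (hk : k ≠ 0)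
    (h : m ≤ 9 * k) : ‖(p : ℂ) ^ m * T ^ k‖ < 1 := by
  have hp1 : (1 : ℝ) ≤ p := by exact_mod_cast hp.out.one_le
  have hpos : (0 : ℝ) < (p : ℝ) ^ 9 := by positivity
  have h1 : (p : ℝ) ^ 9 * ‖T‖ < 1 := by
    rwa [mul_comm, ← lt_div_iff₀ hpos, one_div]
  rw [norm_mul, norm_pow, norm_pow, Complex.norm_natCast]
  calc (p : ℝ) ^ m * ‖T‖ ^ k ≤ (p : ℝ) ^ (9 * k) * ‖T‖ ^ k := by gcongr
    _ = ((p : ℝ) ^ 9 * ‖T‖) ^ k := by rw [pow_mul, mul_pow]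
    _ < 1 := pow_lt_one₀ (by positivity) h1 hk

theorem one_sub_pow_mul_pow_ne_zero {T : ℂ} (hT : ‖T‖ < ((p : ℝ) ^ 9)⁻¹) {m k : ℕ} (hk : k ≠ 0)
    (h : m ≤ 9 * k) : 1 - (p : ℂ) ^ m * T ^ k ≠ 0 := by
  intro h0
  have := norm_pow_mul_pow_lt_one hT hk h
  rw [← sub_eq_zero.1 h0] at this
  simp at this

theorem totient_prime_pow_succ_cast (n : ℕ) :
    (Nat.totient (p ^ (n + 1)) : ℂ) = (p : ℂ) ^ n * (p - 1) := by
  rw [Nat.totient_prime_pow_succ hp.out, Nat.cast_mul, Nat.cast_pow,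
    Nat.cast_sub hp.out.one_le, Nat.cast_one]

/-- The contribution of the lattices with nontrivial cyclic quotient, where `P = p` and `N` is the
number of points of the reduced curve. -/
noncomputable def cyclicSum (P N T : ℂ) : ℂ :=
  (P ^ 6 * ((P ^ 2 + P + 1) * T ^ 7 + N * (T ^ 5 - T ^ 7)) +
    P ^ 7 * (T ^ 5 - T ^ 7) * (P ^ 6 * T ^ 5 * N / (1 - P ^ 7 * T ^ 5))) / (1 - P ^ 8 * T ^ 7)

/-- The contribution of the lattices whose reduction is a line. -/
noncomputable def lineSum (P N T : ℂ) : ℂ :=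
  P ^ 12 * T ^ 8 * (P ^ 2 + P + 1 + (P ^ 2 + P) * cyclicSum P N T) / (1 - P ^ 14 * T ^ 8)

/-- The contribution of all lattices. -/
noncomputable def latticeSum (P N T : ℂ) : ℂ :=
  (1 + cyclicSum P N T + lineSum P N T) / (1 - P ^ 18 * T ^ 9)

theorem hasSum_partSum_zero (T : ℂ) : HasSum (fun n => partSum W p T n 0) 1 := by
  have h := hasSum_single (f := fun n => partSum W p T n 0) 0 fun n hn => by
    obtain ⟨m, rfl⟩ := Nat.exists_eq_succ_of_ne_zero hn
    exact partSum_succ_zero T m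
  rwa [partSum_zero_zero] at h

/-- Two nested recursions. The zero counts, normalised by the totient, form a geometric series of
ratio `p⁷T⁵`; they are the inhomogeneous term of a recursion of ratio `p⁸T⁷` for the value sums. -/
theorem hasSum_partSum_one (h6 : W.a₆ = 0) (hΔ : ¬ (p : ℤ) ∣ W.Δ) {T : ℂ}
    (hT : ‖T‖ < ((p : ℝ) ^ 9)⁻¹) :
    HasSum (fun n => partSum W p T n 1) (cyclicSum p (redCurve p W).ncard T) := by
  have hp0 : (p : ℂ) ≠ 0 := by exact_mod_cast hp.out.ne_zero
  have hp1 : (p : ℂ) - 1 ≠ 0 := sub_ne_zero.2 (by exact_mod_cast hp.out.one_lt.ne')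
  let f : ℕ → ℂ := fun n => (p : ℂ) ^ (6 * (n + 1)) * T ^ (5 * (n + 1)) * zeroCount W p (n + 1) /
    Nat.totient (p ^ (n + 1))
  have hf0 : f 0 = p ^ 6 * T ^ 5 * (redCurve p W).ncard := by
    simp only [f]
    rw [totient_prime_pow_succ_cast, zeroCount_one h6, Nat.cast_mul, Nat.cast_sub hp.out.one_le]
    field_simp
    push_cast
    ring
  have hf : HasSum f (p ^ 6 * T ^ 5 * (redCurve p W).ncard / (1 - p ^ 7 * T ^ 5)) := by
    have h := hasSum_of_linear_recursion (x := f) (y := fun _ => 0)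
      (norm_pow_mul_pow_lt_one hT (m := 7) (k := 5) (by norm_num) (by norm_num)) hasSum_zero
      (fun n => by
        simp only [f]
        rw [totient_prime_pow_succ_cast, totient_prime_pow_succ_cast,
          zeroCount_succ h6 hΔ (Nat.succ_ne_zero n)]
        push_cast
        field_simp
        ring)
    rwa [hf0, add_zero] at h
  have hV : ∀ n, partSum W p T (n + 1) 1 =
      (p : ℂ) ^ (6 * (n + 1)) * valueSum W p (n + 1) T / Nat.totient (p ^ (n + 1)) := by
    intro n
    rw [← totient_mul_partSum_one h6 hΔ (Nat.succ_ne_zero n), mul_div_cancel_left₀]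
    rw [totient_prime_pow_succ_cast]
    exact mul_ne_zero (pow_ne_zero _ hp0) hp1
  have hg0 : partSum W p T (0 + 1) 1 = (p : ℂ) ^ 6 * (((p : ℂ) ^ 2 + p + 1) * T ^ 7 +
      (redCurve p W).ncard * (T ^ 5 - T ^ 7)) := by
    rw [hV, totient_prime_pow_succ_cast, valueSum_one, zeroCount_one h6, Nat.cast_mul,
      Nat.cast_sub hp.out.one_le]
    field_simp
    push_cast
    ring
  have hg := hasSum_of_linear_recursion (x := fun n => partSum W p T (n + 1) 1)
      (y := fun n => (p : ℂ) ^ 7 * (T ^ 5 - T ^ 7) * f n)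
      (norm_pow_mul_pow_lt_one hT (m := 8) (k := 7) (by norm_num) (by norm_num))
      (hf.mul_left _) (fun n => by
        simp only [f]
        rw [hV, hV, valueSum_succ h6 hΔ (Nat.succ_ne_zero n), totient_prime_pow_succ_cast,
          totient_prime_pow_succ_cast]
        field_simp
        ring)
  rw [hg0] at hg
  have := (hasSum_nat_add_iff (f := fun n => partSum W p T n 1) 1).1 hg
  simpa [partSum_zero_of_ne, cyclicSum] using this

/-- The quotients of `p³ - pᵏ` by `p - 1` are `p² + p + 1`, `p² + p`, `p²` and `0`. The third
produces the ratio `p¹⁴T⁸`, the first two the inhomogeneous term. -/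
theorem hasSum_partSum_two (h6 : W.a₆ = 0) (hΔ : ¬ (p : ℤ) ∣ W.Δ) {T : ℂ}
    (hT : ‖T‖ < ((p : ℝ) ^ 9)⁻¹) :
    HasSum (fun n => partSum W p T n 2) (lineSum p (redCurve p W).ncard T) := by
  have hp1 : (p : ℂ) - 1 ≠ 0 := sub_ne_zero.2 (by exact_mod_cast hp.out.one_lt.ne')
  have h := hasSum_of_linear_recursion (x := fun n => partSum W p T n 2)
    (y := fun n => (p : ℂ) ^ 12 * T ^ 8 * (((p : ℂ) ^ 2 + p + 1) * partSum W p T n 0 +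
      ((p : ℂ) ^ 2 + p) * partSum W p T n 1))
    (norm_pow_mul_pow_lt_one hT (m := 14) (k := 8) (by norm_num) (by norm_num))
    ((((hasSum_partSum_zero T).mul_left _).add
      ((hasSum_partSum_one h6 hΔ hT).mul_left _)).mul_left _) (fun n => by
        apply mul_left_cancel₀ hp1
        rw [partSum_succ_two, sum_sub_residueIndex]
        simp only [Finset.sum_range_succ, Finset.sum_range_zero]
        ring)
  rw [partSum_zero_of_ne two_ne_zero, zero_add, mul_one] at h
  exact h

theorem hasSum_levelSum (h6 : W.a₆ = 0) (hΔ : ¬ (p : ℤ) ∣ W.Δ) {T : ℂ}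
    (hT : ‖T‖ < ((p : ℝ) ^ 9)⁻¹) :
    HasSum (fun n => ∑ Λ ∈ levelFinset p n, latticeTerm W p T Λ)
      (latticeSum p (redCurve p W).ncard T) := by
  have h2 := ((hasSum_partSum_zero (W := W) (p := p) T).add (hasSum_partSum_one h6 hΔ hT)).add
    (hasSum_partSum_two h6 hΔ hT)
  have h3 := hasSum_of_linear_recursion (x := fun n => partSum W p T n 3)
    (norm_pow_mul_pow_lt_one hT (m := 18) (k := 9) (by norm_num) (by norm_num))
    (h2.mul_left ((p : ℂ) ^ 18 * T ^ 9)) (fun n => by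
      rw [partSum_succ_three, sum_levelFinset]
      simp only [Finset.sum_range_succ, Finset.sum_range_zero]
      ring)
  have h4 := h2.add h3
  have hne := one_sub_pow_mul_pow_ne_zero hT (m := 18) (k := 9) (by norm_num) (by norm_num)
  -- The total `S` satisfies `S = S' + p¹⁸T⁹ S`, with `S'` the sum of the parts `k ≤ 2`.
  have hS : latticeSum p (redCurve p W).ncard T =
      1 + cyclicSum p (redCurve p W).ncard T + lineSum p (redCurve p W).ncard T +
      (partSum W p T 0 3 + (p : ℂ) ^ 18 * T ^ 9 * (1 + cyclicSum p (redCurve p W).ncard T +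
        lineSum p (redCurve p W).ncard T)) / (1 - (p : ℂ) ^ 18 * T ^ 9) := by
    rw [partSum_zero_of_ne three_ne_zero, latticeSum]
    field_simp
    ring
  rw [hS]
  refine h4.congr_fun fun n => ?_
  rw [sum_levelFinset]
  simp only [Finset.sum_range_succ, Finset.sum_range_zero, zero_add]

theorem hasGF_lattices (h6 : W.a₆ = 0) (hΔ : ¬ (p : ℤ) ∣ W.Δ) :
    HasGF ((p : ℝ) ^ 9)⁻¹ (fun Λ : {Λ : AddSubgroup (Fin 3 → ℤ) // HasPIndex p Λ} =>
      p ^ (6 * indexExp p Λ.1)) (fun Λ => indexExp p Λ.1 + indexExp p (annihilator W Λ.1))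
      (fun T => latticeSum p (redCurve p W).ncard T) := by
  let E : (Σ n : ℕ, {Λ // Λ ∈ levelFinset p n}) ≃
      {Λ : AddSubgroup (Fin 3 → ℤ) // HasPIndex p Λ} :=
    Equiv.ofBijective (fun t => ⟨t.2.1, hasPIndex_of_mem_levelFinset t.2.2⟩) <| by
      constructor
      · rintro ⟨n, Λ, hΛ⟩ ⟨m, Λ', hΛ'⟩ h
        obtain rfl : Λ = Λ' := congrArg Subtype.val h
        obtain rfl := (mem_levelFinset.1 hΛ).unique (mem_levelFinset.1 hΛ')
        rfl
      · rintro ⟨Λ, hΛ⟩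
        obtain ⟨n, hn⟩ := exists_isLevel hΛ
        exact ⟨⟨n, Λ, mem_levelFinset.2 hn⟩, rfl⟩
  have main : HasGF ((p : ℝ) ^ 9)⁻¹ (fun t : Σ n : ℕ, {Λ // Λ ∈ levelFinset p n} =>
      p ^ (6 * indexExp p t.2.1)) (fun t => indexExp p t.2.1 + indexExp p (annihilator W t.2.1))
      (fun T => latticeSum p (redCurve p W).ncard T) := by
    refine HasGF.sigma (g := fun n T => ∑ Λ ∈ levelFinset p n, latticeTerm W p T Λ)
      (fun n T _ => ?_) (fun T hT => hasSum_levelSum h6 hΔ hT)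
    exact Finset.hasSum (levelFinset p n) (latticeTerm W p T)
  refine (main.equiv E.symm).congr (fun Λ => ?_) (fun Λ => ?_) (fun _ => rfl)
  all_goals
    obtain ⟨t, rfl⟩ := E.surjective Λ
    rw [Function.comp_apply, E.symm_apply_apply]
    rfl

end Sums

/-! ### The Lie ring and the group attached to the cubic -/

/-- The lattice `ℤ⁹`, written as `(ℤ³ × ℤ³) × ℤ³`; the last factor will be central. -/
abbrev TripleLattice : Type := ((Fin 3 → ℤ) × (Fin 3 → ℤ)) × (Fin 3 → ℤ)

/-- The Lie ring on `ℤ⁹` with bracket given by `cubicPairing W`. -/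
def CubicLie (_W : WeierstrassCurve ℤ) : Type := TripleLattice

/-- The group on the set `ℤ⁹` with commutator given by `cubicPairing W`. -/
@[ext]
structure CubicGroup (W : WeierstrassCurve ℤ) : Type where
  /-- The underlying vector. -/
  toVec : TripleLattice

/-- The commutator form on `ℤ⁹`. -/
def cubicBracket (W : WeierstrassCurve ℤ) (x y : TripleLattice) : TripleLattice :=
  (0, cubicPairing W x.1.1 y.1.2 - cubicPairing W y.1.1 x.1.2)

/-- The multiplication of `CubicGroup W`. -/
def cubicMul (W : WeierstrassCurve ℤ) (x y : TripleLattice) : TripleLattice :=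
  (x.1 + y.1, x.2 + y.2 - cubicPairing W y.1.1 x.1.2)

section Construction

variable (W : WeierstrassCurve ℤ)

instance : AddCommGroup (CubicLie W) := inferInstanceAs (AddCommGroup TripleLattice)

instance : LieRing (CubicLie W) where
  bracket := cubicBracket W
  add_lie x y z := by
    change cubicBracket W (x + y) z = cubicBracket W x z + cubicBracket W y z
    refine Prod.ext (by simp [cubicBracket]) ?_
    change cubicPairing W (x.1.1 + y.1.1) z.1.2 - cubicPairing W z.1.1 (x.1.2 + y.1.2) = _
    rw [cubicPairing_add_left, cubicPairing_add_right]
    change _ = (_ - _) + (_ - _)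
    abel
  lie_add x y z := by
    change cubicBracket W x (y + z) = cubicBracket W x y + cubicBracket W x z
    refine Prod.ext (by simp [cubicBracket]) ?_
    change cubicPairing W x.1.1 (y.1.2 + z.1.2) - cubicPairing W (y.1.1 + z.1.1) x.1.2 = _
    rw [cubicPairing_add_left, cubicPairing_add_right]
    change _ = (_ - _) + (_ - _)
    abel
  lie_self x := Prod.ext rfl (sub_self _)
  leibniz_lie x y z := by
    change cubicBracket W x (cubicBracket W y z) = cubicBracket W (cubicBracket W x y) z +
      cubicBracket W y (cubicBracket W x z)
    simp [cubicBracket, cubicPairing_zero_left, cubicPairing_zero_right]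

/-- A Heisenberg-type extension by a bilinear cocycle. Antisymmetrising the cocycle gives the
bracket without dividing by 2, so `p = 2` needs no separate treatment. -/
instance : Group (CubicGroup W) :=
  letI : Mul (CubicGroup W) := ⟨fun x y => ⟨cubicMul W x.toVec y.toVec⟩⟩
  letI : One (CubicGroup W) := ⟨⟨0⟩⟩
  letI : Inv (CubicGroup W) :=
    ⟨fun x => ⟨(-x.toVec.1, -x.toVec.2 - cubicPairing W x.toVec.1.1 x.toVec.1.2)⟩⟩
  Group.ofLeftAxioms
    (fun x y z => by
      refine CubicGroup.ext (Prod.ext (add_assoc _ _ _) ?_)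
      obtain ⟨x⟩ := x
      obtain ⟨y⟩ := y
      obtain ⟨z⟩ := z
      change x.2 + y.2 - cubicPairing W y.1.1 x.1.2 + z.2 -
        cubicPairing W z.1.1 (x.1.2 + y.1.2) = x.2 + (y.2 + z.2 - cubicPairing W z.1.1 y.1.2) -
          cubicPairing W (y.1.1 + z.1.1) x.1.2
      rw [cubicPairing_add_left, cubicPairing_add_right]
      abel)
    (fun x => by
      refine CubicGroup.ext ?_
      change cubicMul W 0 x.toVec = x.toVec
      simp [cubicMul, cubicPairing_zero_right])
    (fun x => by
      refine CubicGroup.ext ?_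
      change cubicMul W (-x.toVec.1, -x.toVec.2 - cubicPairing W x.toVec.1.1 x.toVec.1.2)
        x.toVec = 0
      simp only [cubicMul, Prod.snd_neg, cubicPairing_neg_right, neg_add_cancel]
      refine Prod.ext rfl ?_
      change _ - _ + _ - -_ = (0 : Fin 3 → ℤ)
      abel)

namespace CubicGroup

variable {W}

theorem toVec_mul (x y : CubicGroup W) : (x * y).toVec = cubicMul W x.toVec y.toVec := rfl

theorem toVec_one : (1 : CubicGroup W).toVec = 0 := rfl

theorem toVec_inv (x : CubicGroup W) :
    x⁻¹.toVec = (-x.toVec.1, -x.toVec.2 - cubicPairing W x.toVec.1.1 x.toVec.1.2) := rfl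

theorem toVec_conj (x y : CubicGroup W) :
    (x * y * x⁻¹).toVec = (y.toVec.1, y.toVec.2 + (cubicBracket W x.toVec y.toVec).2) := by
  rw [toVec_mul, toVec_mul, toVec_inv]
  generalize x.toVec = x
  generalize y.toVec = y
  refine Prod.ext ?_ ?_
  · change x.1 + y.1 + -x.1 = y.1
    abel
  · change x.2 + y.2 - cubicPairing W y.1.1 x.1.2 + (-x.2 - cubicPairing W x.1.1 x.1.2) -
      cubicPairing W (-x.1.1) (x.1.2 + y.1.2) =
        y.2 + (cubicPairing W x.1.1 y.1.2 - cubicPairing W y.1.1 x.1.2)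
    rw [cubicPairing_neg_left, cubicPairing_add_right]
    abel

theorem commutator_eq (x y : CubicGroup W) :
    x * y * x⁻¹ * y⁻¹ = ⟨cubicBracket W x.toVec y.toVec⟩ := by
  rw [mul_inv_eq_iff_eq_mul]
  refine CubicGroup.ext ?_
  rw [toVec_conj, toVec_mul]
  refine Prod.ext (zero_add _).symm ?_
  change _ = (cubicBracket W x.toVec y.toVec).2 + y.toVec.2 - cubicPairing W y.toVec.1.1 0
  rw [cubicPairing_zero_right, sub_zero, add_comm]

theorem mem_center {x : CubicGroup W} (h : x.toVec.1 = 0) :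
    x ∈ Subgroup.center (CubicGroup W) := by
  rw [Subgroup.mem_center_iff]
  intro y
  rw [← mul_inv_eq_iff_eq_mul]
  refine CubicGroup.ext ?_
  rw [toVec_conj]
  refine Prod.ext rfl ?_
  simp [cubicBracket, h, cubicPairing_zero_left, cubicPairing_zero_right]

/-- The projection modulo the central factor. -/
def fstHom : CubicGroup W →* Multiplicative ((Fin 3 → ℤ) × (Fin 3 → ℤ)) where
  toFun x := Multiplicative.ofAdd x.toVec.1
  map_one' := rfl
  map_mul' _ _ := rfl

theorem zpow_eq {x : TripleLattice} (h : cubicPairing W x.1.1 x.1.2 = 0) (n : ℤ) :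
    (⟨x⟩ : CubicGroup W) ^ n = ⟨n • x⟩ := by
  let f : Multiplicative ℤ →* CubicGroup W :=
    { toFun := fun n => ⟨n.toAdd • x⟩
      map_one' := CubicGroup.ext (zero_smul ℤ x)
      map_mul' := fun m n => by
        refine CubicGroup.ext (Prod.ext (add_smul m.toAdd n.toAdd x.1) ?_)
        change (m.toAdd + n.toAdd) • x.2 = m.toAdd • x.2 + n.toAdd • x.2 -
          cubicPairing W (n.toAdd • x.1.1) (m.toAdd • x.1.2)
        rw [cubicPairing_smul_left, cubicPairing_smul_right, h, smul_zero, smul_zero, sub_zero,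
          add_smul] }
  have h1 : f (Multiplicative.ofAdd 1) = ⟨x⟩ := CubicGroup.ext (one_smul ℤ x)
  rw [← h1, ← map_zpow, ← ofAdd_zsmul, smul_eq_mul, mul_one]
  rfl

theorem isTorsionFreeClassTwo : IsTorsionFreeClassTwo (CubicGroup W) := by
  have hker : (fstHom (W := W)).ker ≤ Subgroup.center (CubicGroup W) := fun x hx =>
    mem_center (Multiplicative.ofAdd.injective hx)
  have hnil : Group.IsNilpotent (CubicGroup W) := Subgroup.isNilpotent_of_ker_le_center _ hker
  refine ⟨Infinite.of_injective (CubicGroup.mk (W := W)) fun x y h => congrArg toVec h,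
    fun g hg hfin => ?_, hnil, ?_⟩
  · obtain ⟨n, hn, hgn⟩ := isOfFinOrder_iff_pow_eq_one.1 hfin
    have h1 : g.toVec.1 = 0 := by
      have h2 := congrArg fstHom hgn
      rw [map_pow, map_one] at h2
      have h3 : n • g.toVec.1 = 0 := h2
      exact (smul_eq_zero.1 h3).resolve_left hn.ne'
    have h4 := zpow_eq (W := W) (x := g.toVec) (by rw [h1]; exact cubicPairing_zero_left _ _) n
    rw [zpow_natCast] at h4
    have h5 : (n : ℤ) • g.toVec = 0 := congrArg toVec (h4.symm.trans hgn)
    exact hg (CubicGroup.ext ((smul_eq_zero.1 h5).resolve_left (by exact_mod_cast hn.ne')))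
  · have hle := (Group.nilpotencyClass_le_of_ker_le_center _ hker).trans
      (Nat.add_le_add_right CommGroup.nilpotencyClass_le_one 1)
    refine le_antisymm hle ?_
    by_contra hlt
    have hcomm := Group.IsNilpotent.nilpotencyClass_le_one_iff.1
      (show Group.nilpotencyClass (CubicGroup W) ≤ 1 by omega)
    -- The pairing of these two vectors has first coordinate 1 on every curve, so the group is not
    -- abelian.
    let x : CubicGroup W := ⟨((![1, 0, 0], 0), 0)⟩
    let y : CubicGroup W := ⟨((0, ![1, 0, 0]), 0)⟩
    have h1 := commutator_eq x y
    rw [hcomm.is_comm.comm x y, mul_assoc, mul_assoc, mul_inv_cancel_left, mul_inv_cancel] at h1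
    have h2 := congrFun (congrArg Prod.snd (congrArg toVec h1)) 0
    have h3 : (cubicBracket W x.toVec y.toVec).2 0 = 1 := by
      simp [cubicBracket, x, y, cubicPairing]
    exact one_ne_zero (h3.symm.trans h2.symm)

end CubicGroup

/-! ### Malcev coordinates -/

variable {W}

/-- Coordinates on `ℤ⁹`. -/
def tripleEquiv : (Fin 9 → ℤ) ≃ₗ[ℤ] TripleLattice where
  toFun n := ((![n 0, n 1, n 2], ![n 3, n 4, n 5]), ![n 6, n 7, n 8])
  invFun x := ![x.1.1 0, x.1.1 1, x.1.1 2, x.1.2 0, x.1.2 1, x.1.2 2, x.2 0, x.2 1, x.2 2]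
  map_add' m n := by
    refine Prod.ext (Prod.ext ?_ ?_) ?_ <;> ext i <;> fin_cases i <;> rfl
  map_smul' c n := by
    refine Prod.ext (Prod.ext ?_ ?_) ?_ <;> ext i <;> fin_cases i <;> rfl
  left_inv n := by ext i; fin_cases i <;> rfl
  right_inv x := by
    refine Prod.ext (Prod.ext ?_ ?_) ?_ <;> ext i <;> fin_cases i <;> rfl

/-- The standard generators. -/
def cubicGen (W : WeierstrassCurve ℤ) (k : Fin 9) : CubicGroup W :=
  ⟨tripleEquiv (Pi.single k 1)⟩

theorem cubicGen_zpow (k : Fin 9) (n : ℤ) :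
    cubicGen W k ^ n = ⟨tripleEquiv (Pi.single k n)⟩ := by
  rw [cubicGen, CubicGroup.zpow_eq]
  · rw [← map_smul, ← Pi.single_smul, smul_eq_mul, mul_one]
  · fin_cases k <;> simp [tripleEquiv, cubicPairing]

/-- The cocycle pairs the `u`-part of the right factor with the `v`-part of the left one. In the
ordered product the `u`-generators come first, so no correction arises. -/
theorem cubicGen_prod (n : Fin 9 → ℤ) :
    (List.ofFn fun k => cubicGen W k ^ n k).prod = ⟨tripleEquiv n⟩ := by
  refine CubicGroup.ext ?_
  simp only [cubicGen_zpow, List.ofFn_succ, List.ofFn_zero, List.prod_cons, List.prod_nil,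
    CubicGroup.toVec_mul, CubicGroup.toVec_one]
  refine Prod.ext (Prod.ext ?_ ?_) ?_ <;> ext i <;> fin_cases i <;>
    simp [cubicMul, tripleEquiv, cubicPairing]

theorem isAssociatedLieRing_cubic : IsAssociatedLieRing 9 (CubicGroup W) (CubicLie W) := by
  let e : Module.Basis (Fin 9) ℤ (CubicLie W) :=
    Module.Basis.ofEquivFun (M := CubicLie W) (tripleEquiv.symm : TripleLattice ≃ₗ[ℤ] _)
  have he : ∀ k, e k = (cubicGen W k).toVec := fun k =>
    congrFun (Module.Basis.coe_ofEquivFun (M := CubicLie W) _) k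
  let a : Fin 9 → Fin 9 → Fin 9 → ℤ := fun i j =>
    tripleEquiv.symm (cubicBracket W (cubicGen W i).toVec (cubicGen W j).toVec)
  have hbij : Function.Bijective
      (fun n : Fin 9 → ℤ => (List.ofFn fun k => cubicGen W k ^ n k).prod) := by
    simp only [cubicGen_prod]
    exact ⟨fun m n h => tripleEquiv.injective (congrArg CubicGroup.toVec h), fun g =>
      ⟨tripleEquiv.symm g.toVec, CubicGroup.ext (tripleEquiv.apply_symm_apply _)⟩⟩
  refine ⟨cubicGen W, e, a, ?_, hbij, ?_, ?_, ?_⟩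
  · refine top_unique fun g _ => ?_
    obtain ⟨n, rfl⟩ := hbij.2 g
    refine Subgroup.list_prod_mem _ fun y hy => ?_
    obtain ⟨k, rfl⟩ := List.mem_ofFn.1 hy
    exact Subgroup.zpow_mem _ (Subgroup.subset_closure (Set.mem_range_self k)) _
  · intro i j
    rw [CubicGroup.commutator_eq, cubicGen_prod]
    exact CubicGroup.ext (tripleEquiv.apply_symm_apply _).symm
  · intro i j k hk
    apply CubicGroup.mem_center
    fin_cases k
    -- Brackets lie in the last factor, so the first six structure constants are zero by definition.
    iterate 6 exact absurd rfl hk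
    all_goals
      refine Prod.ext ?_ ?_ <;> ext i <;> fin_cases i <;> rfl
  · intro i j
    rw [← e.sum_repr ⁅e i, e j⁆]
    refine Finset.sum_congr rfl fun k _ => ?_
    congr 1
    rw [he, he]
    rfl

end Construction

/-! ### Ideals and normal subgroups -/

section Ideals

variable {W : WeierstrassCurve ℤ}

/-- `I` is stable under the brackets with all elements. -/
def IsBracketStable (W : WeierstrassCurve ℤ) (I : AddSubgroup TripleLattice) : Prop :=
  I.map (AddMonoidHom.fst _ _) ≤ annihilator W (I.comap (AddMonoidHom.inr _ _))

namespace IsBracketStable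

variable {I : AddSubgroup TripleLattice}

theorem left_mem (h : IsBracketStable W I) {y : TripleLattice} (hy : y ∈ I) (v : Fin 3 → ℤ) :
    ((0, cubicPairing W y.1.1 v) : TripleLattice) ∈ I :=
  (h ⟨y, hy, rfl⟩).1 v

theorem right_mem (h : IsBracketStable W I) {y : TripleLattice} (hy : y ∈ I) (u : Fin 3 → ℤ) :
    ((0, cubicPairing W u y.1.2) : TripleLattice) ∈ I :=
  (h ⟨y, hy, rfl⟩).2 u

theorem bracket_mem (h : IsBracketStable W I) (x : TripleLattice) {y : TripleLattice}
    (hy : y ∈ I) : cubicBracket W x y ∈ I := by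
  have h1 := I.sub_mem (h.right_mem hy x.1.1) (h.left_mem hy x.1.2)
  rwa [Prod.mk_sub_mk, sub_zero] at h1

theorem of_bracket_mem (h : ∀ x, ∀ y ∈ I, cubicBracket W x y ∈ I) : IsBracketStable W I := by
  rintro _ ⟨y, hy, rfl⟩
  refine ⟨fun v => ?_, fun u => ?_⟩
  · have h1 := h ((0, -v), 0) y hy
    rwa [cubicBracket, cubicPairing_zero_left, cubicPairing_neg_right, zero_sub, neg_neg] at h1
  · have h1 := h ((u, 0), 0) y hy
    rwa [cubicBracket, cubicPairing_zero_right, sub_zero] at h1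

end IsBracketStable

/-- Ideals of the Lie ring are the bracket-stable lattices. -/
def lieIdealEquiv (W : WeierstrassCurve ℤ) (p : ℕ) :
    {I : LieIdeal ℤ (CubicLie W) // ∃ n : ℕ, I.toSubmodule.toAddSubgroup.index = p ^ n} ≃
      {I : AddSubgroup TripleLattice // HasPIndex p I ∧ IsBracketStable W I} where
  toFun I := ⟨I.1.toSubmodule.toAddSubgroup, I.2,
    .of_bracket_mem fun x _ hy => lie_mem_right ℤ (CubicLie W) I.1 x _ hy⟩
  invFun I := ⟨{ AddSubgroup.toIntSubmodule (M := CubicLie W) I.1 with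
    lie_mem := fun {x _} hm => I.2.2.bracket_mem x hm }, I.2.1⟩
  left_inv _ := rfl
  right_inv _ := rfl

/-! ### Normal subgroups of the group as lattices. -/

namespace CubicGroup

theorem mul_central (g : CubicGroup W) (c : Fin 3 → ℤ) :
    g * ⟨(0, c)⟩ = ⟨g.toVec + (0, c)⟩ := by
  refine CubicGroup.ext ?_
  rw [toVec_mul, cubicMul]
  refine Prod.ext rfl ?_
  change _ - cubicPairing W 0 _ = _
  rw [cubicPairing_zero_left, sub_zero]
  rfl

/-- Addition and group multiplication differ by a central pairing with the `u`-part of `y`, which by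
`left_mem` lies in every normal subgroup containing `y`. -/
theorem mk_add (x y : TripleLattice) :
    (⟨x + y⟩ : CubicGroup W) = ⟨x⟩ * ⟨y⟩ * ⟨(0, cubicPairing W y.1.1 x.1.2)⟩ := by
  rw [mul_central]
  refine CubicGroup.ext (Prod.ext (add_zero _).symm ?_)
  exact (sub_add_cancel _ _).symm

theorem mk_neg (x : TripleLattice) :
    (⟨-x⟩ : CubicGroup W) = ⟨x⟩⁻¹ * ⟨(0, cubicPairing W x.1.1 x.1.2)⟩ := by
  rw [mul_central]
  refine CubicGroup.ext (Prod.ext (add_zero _).symm ?_)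
  exact (sub_add_cancel _ _).symm

theorem bracket_mem {H : Subgroup (CubicGroup W)} (hH : H.Normal) (x : TripleLattice)
    {y : TripleLattice} (hy : (⟨y⟩ : CubicGroup W) ∈ H) :
    (⟨cubicBracket W x y⟩ : CubicGroup W) ∈ H := by
  rw [← commutator_eq ⟨x⟩ ⟨y⟩]
  exact H.mul_mem (hH.conj_mem _ hy _) (H.inv_mem hy)

theorem left_mem {H : Subgroup (CubicGroup W)} (hH : H.Normal) {y : TripleLattice}
    (hy : (⟨y⟩ : CubicGroup W) ∈ H) (v : Fin 3 → ℤ) :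
    (⟨(0, cubicPairing W y.1.1 v)⟩ : CubicGroup W) ∈ H := by
  have h1 := bracket_mem hH ((0, -v), 0) hy
  rwa [cubicBracket, cubicPairing_zero_left, cubicPairing_neg_right, zero_sub, neg_neg] at h1

/-- The lattice underlying a normal subgroup. -/
def toLattice (H : Subgroup (CubicGroup W)) (hH : H.Normal) : AddSubgroup TripleLattice where
  carrier := {x | (⟨x⟩ : CubicGroup W) ∈ H}
  zero_mem' := H.one_mem
  add_mem' {x y} hx hy := by
    change (⟨x + y⟩ : CubicGroup W) ∈ H
    rw [mk_add]
    exact H.mul_mem (H.mul_mem hx hy) (left_mem hH hy _)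
  neg_mem' {x} hx := by
    change (⟨-x⟩ : CubicGroup W) ∈ H
    rw [mk_neg]
    exact H.mul_mem (H.inv_mem hx) (left_mem hH hx _)

theorem isBracketStable_toLattice (H : Subgroup (CubicGroup W)) (hH : H.Normal) :
    IsBracketStable W (toLattice H hH) :=
  .of_bracket_mem fun x _ hy => bracket_mem hH x hy

/-- The subgroup underlying a bracket-stable lattice. -/
def ofLattice (I : AddSubgroup TripleLattice) (hI : IsBracketStable W I) :
    Subgroup (CubicGroup W) where
  carrier := {x | x.toVec ∈ I}
  one_mem' := I.zero_mem
  mul_mem' {x y} hx hy := by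
    have h := I.sub_mem (I.add_mem hx hy) (hI.left_mem hy x.toVec.1.2)
    change cubicMul W x.toVec y.toVec ∈ I
    convert h using 1
    exact Prod.ext (sub_zero _).symm rfl
  inv_mem' {x} hx := by
    have h := I.sub_mem (I.neg_mem hx) (hI.left_mem hx x.toVec.1.2)
    change (x⁻¹).toVec ∈ I
    rw [toVec_inv]
    convert h using 1
    exact Prod.ext (sub_zero _).symm rfl

theorem normal_ofLattice (I : AddSubgroup TripleLattice) (hI : IsBracketStable W I) :
    (ofLattice I hI).Normal := by
  refine ⟨fun y hy x => ?_⟩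
  change (x * y * x⁻¹).toVec ∈ I
  have h := I.add_mem hy (hI.bracket_mem x.toVec hy)
  rw [toVec_conj]
  convert h using 1
  exact Prod.ext (add_zero _).symm rfl

/-- The left cosets of `H` and the cosets of its lattice are the same sets, because `x⁻¹ y` and `-x
+ y` differ by a central pairing that lies in `H` as soon as either does. -/
theorem index_toLattice (H : Subgroup (CubicGroup W)) (hH : H.Normal) :
    (toLattice H hH).index = H.index := by
  symm
  refine Nat.card_congr (Quotient.congr
    { toFun := toVec, invFun := CubicGroup.mk, left_inv := fun _ => rfl,
      right_inv := fun _ => rfl } fun x y => ?_)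
  change (QuotientGroup.leftRel H) x y ↔
    (QuotientAddGroup.leftRel (toLattice H hH)) x.toVec y.toVec
  rw [QuotientGroup.leftRel_apply, QuotientAddGroup.leftRel_apply]
  obtain ⟨x⟩ := x
  obtain ⟨y⟩ := y
  change _ ↔ (⟨-x + y⟩ : CubicGroup W) ∈ H
  have key : (⟨x⟩⁻¹ * ⟨y⟩ : CubicGroup W) =
      ⟨-x + y⟩ * ⟨(0, cubicPairing W (-x + y).1.1 x.1.2)⟩ := by
    rw [mul_central]
    refine CubicGroup.ext (Prod.ext (add_zero _).symm ?_)
    change -x.2 - cubicPairing W x.1.1 x.1.2 + y.2 - cubicPairing W y.1.1 (-x.1.2) =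
      -x.2 + y.2 + cubicPairing W (-x.1.1 + y.1.1) x.1.2
    rw [cubicPairing_neg_right, cubicPairing_add_left, cubicPairing_neg_left]
    abel
  constructor
  · intro h
    have h0 : (⟨x⟩⁻¹ * ⟨y⟩ : CubicGroup W).toVec.1 = (-x + y).1 := rfl
    have h1 := left_mem hH (y := (⟨x⟩⁻¹ * ⟨y⟩ : CubicGroup W).toVec) h x.1.2
    rw [h0] at h1
    rw [key] at h
    exact (H.mul_mem_cancel_right h1).1 h
  · intro h
    rw [key]
    exact H.mul_mem h (left_mem hH h _)

/-- Normal subgroups are the bracket-stable lattices. -/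
def normalEquiv (W : WeierstrassCurve ℤ) (p : ℕ) :
    {H : Subgroup (CubicGroup W) // H.Normal ∧ ∃ n : ℕ, H.index = p ^ n} ≃
      {I : AddSubgroup TripleLattice // HasPIndex p I ∧ IsBracketStable W I} where
  toFun H := ⟨toLattice H.1 H.2.1, by
    rw [HasPIndex, index_toLattice]; exact H.2.2, isBracketStable_toLattice _ _⟩
  invFun I := ⟨ofLattice I.1 I.2.2, normal_ofLattice _ _, by
    rw [← index_toLattice _ (normal_ofLattice _ I.2.2)]; exact I.2.1⟩
  left_inv _ := rfl
  right_inv _ := rfl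

end CubicGroup

end Ideals

/-! ### The local zeta functions -/

section Zeta

theorem natCast_pow_cpow (p n : ℕ) (s : ℂ) : ((p ^ n : ℕ) : ℂ) ^ s = ((p : ℂ) ^ s) ^ n := by
  induction n with
  | zero => simp
  | succ n ih =>
    rw [pow_succ, pow_succ, Nat.cast_mul, Complex.natCast_mul_natCast_cpow, ih]

variable {W : WeierstrassCurve ℤ} {p : ℕ} [hp : Fact p.Prime]

/-- The common value of the local zeta functions; `P`, `N`, `T` stand for `p`, `|E(𝔽_p)|`,
`p ^ (-s)`. -/
noncomputable def zetaValue (P N T : ℂ) : ℂ :=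
  latticeSum P N T * ∏ i ∈ Finset.range 6, (1 - P ^ i * T)⁻¹

/-- The fibration of `ℤ⁶ × ℤ³` over the trace on `ℤ³`, with the annihilator bounding the image. -/
theorem hasGF_bracketStable (h6 : W.a₆ = 0) (hΔ : ¬ (p : ℤ) ∣ W.Δ) :
    HasGF ((p : ℝ) ^ 9)⁻¹
      (fun _ : {I : AddSubgroup TripleLattice // HasPIndex p I ∧ IsBracketStable W I} => 1)
      (fun I => indexExp p I.1) (fun T => zetaValue p (redCurve p W).ncard T) := by
  have hp1 : (1 : ℝ) ≤ p := by exact_mod_cast hp.out.one_lt.le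
  have hp0 : (0 : ℝ) < p := by linarith
  refine hasGF_fibration prodVecEquiv (annihilator W) (fun Λ hΛ => hasPIndex_annihilator hΛ)
    (fun B hB => ?_) (hasGF_lattices h6 hΔ)
  obtain ⟨e⟩ := nonempty_addEquiv_of_index_ne_zero prodVecEquiv (H := B) (by
    obtain ⟨n, hn⟩ := hB
    rw [hn]
    exact pow_ne_zero _ hp.out.ne_zero)
  refine (hasGF_subgroups 6 e).mono ?_
  gcongr
  norm_num

theorem norm_cpow_neg_lt {s : ℂ} (hs : 9 < s.re) : ‖(p : ℂ) ^ (-s)‖ < ((p : ℝ) ^ 9)⁻¹ := by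
  have hp1 : (1 : ℝ) < p := by exact_mod_cast hp.out.one_lt
  rw [Complex.norm_natCast_cpow_of_pos hp.out.pos, Complex.neg_re, Real.rpow_neg (by linarith)]
  refine inv_strictAnti₀ (by positivity) ?_
  rw [← Real.rpow_natCast]
  exact Real.rpow_lt_rpow_of_exponent_lt hp1 (by exact_mod_cast hs)

theorem hasSum_bracketStable (h6 : W.a₆ = 0) (hΔ : ¬ (p : ℤ) ∣ W.Δ) {s : ℂ} (hs : 9 < s.re) :
    HasSum (fun I : {I : AddSubgroup TripleLattice // HasPIndex p I ∧ IsBracketStable W I} =>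
      (I.1.index : ℂ) ^ (-s)) (zetaValue p (redCurve p W).ncard ((p : ℂ) ^ (-s))) := by
  refine (hasGF_bracketStable h6 hΔ _ (norm_cpow_neg_lt hs)).congr_fun fun I => ?_
  rw [I.2.1.index_eq, natCast_pow_cpow, Nat.cast_one, one_mul]

theorem hasLieZeta_cubicLie (h6 : W.a₆ = 0) (hΔ : ¬ (p : ℤ) ∣ W.Δ) {s : ℂ} (hs : 9 < s.re) :
    HasLieZeta p (CubicLie W) s (zetaValue p (redCurve p W).ncard ((p : ℂ) ^ (-s))) :=
  (lieIdealEquiv W p).hasSum_iff.2 (hasSum_bracketStable h6 hΔ hs)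

theorem hasGroupZeta_cubicGroup (h6 : W.a₆ = 0) (hΔ : ¬ (p : ℤ) ∣ W.Δ) {s : ℂ}
    (hs : 9 < s.re) :
    HasGroupZeta p (CubicGroup W) s (zetaValue p (redCurve p W).ncard ((p : ℂ) ^ (-s))) := by
  refine ((CubicGroup.normalEquiv W p).hasSum_iff.2 (hasSum_bracketStable h6 hΔ hs)).congr_fun
    fun H => ?_
  change _ = ((CubicGroup.toLattice H.1 H.2.1).index : ℂ) ^ (-s)
  rw [CubicGroup.index_toLattice]

end Zeta

/-! ### The rational functions -/

section RationalFunctions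

/-- The common denominator of the rational functions in the zeta function. -/
def zetaDenom {R : Type*} [CommRing R] (x y : R) : R :=
  (1 - x ^ 7 * y ^ 5) * (1 - x ^ 8 * y ^ 7) * (1 - x ^ 14 * y ^ 8) * (1 - x ^ 18 * y ^ 9) *
    ∏ i ∈ Finset.range 6, (1 - x ^ i * y)

/-- The numerator of the part of the zeta function independent of the curve. -/
def zetaNumConst {R : Type*} [CommRing R] (x y : R) : R :=
  (1 - x ^ 7 * y ^ 5) * ((1 + x ^ 12 * y ^ 8 * (1 + x)) * (1 - x ^ 8 * y ^ 7) +
    x ^ 6 * (x ^ 2 + x + 1) * y ^ 7 * (1 + x ^ 13 * y ^ 8))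

/-- The numerator of the coefficient of the number of points. -/
def zetaNumCurve {R : Type*} [CommRing R] (x y : R) : R :=
  x ^ 6 * y ^ 5 * (1 - y ^ 2) * (1 + x ^ 13 * y ^ 8)

variable {R S : Type*} [CommRing R] [CommRing S]

theorem map_zetaDenom (f : R →+* S) (x y : R) :
    f (zetaDenom x y) = zetaDenom (f x) (f y) := by
  simp [zetaDenom, map_prod]

theorem map_zetaNumConst (f : R →+* S) (x y : R) :
    f (zetaNumConst x y) = zetaNumConst (f x) (f y) := by
  simp [zetaNumConst]

theorem map_zetaNumCurve (f : R →+* S) (x y : R) :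
    f (zetaNumCurve x y) = zetaNumCurve (f x) (f y) := by
  simp [zetaNumCurve]

theorem zetaDenom_ne_zero {p : ℕ} [hp : Fact p.Prime] {T : ℂ}
    (hT : ‖T‖ < ((p : ℝ) ^ 9)⁻¹) : zetaDenom (p : ℂ) T ≠ 0 := by
  have h : ∀ m k : ℕ, k ≠ 0 → m ≤ 9 * k → 1 - (p : ℂ) ^ m * T ^ k ≠ 0 := fun m k hk hm =>
    one_sub_pow_mul_pow_ne_zero hT hk hm
  refine mul_ne_zero (mul_ne_zero (mul_ne_zero (mul_ne_zero ?_ ?_) ?_) ?_)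
    (Finset.prod_ne_zero_iff.2 fun i hi => ?_)
  iterate 4 exact h _ _ (by norm_num) (by norm_num)
  have := h i 1 one_ne_zero (by have := Finset.mem_range.1 hi; omega)
  rwa [pow_one] at this

/-- The number `N` of points enters `cyclicSum`, hence `lineSum` and `latticeSum`, affinely; the two
numerators are its constant and linear parts over the common denominator. -/
theorem zetaValue_eq {P N T : ℂ} (h : zetaDenom P T ≠ 0) :
    zetaValue P N T = zetaNumConst P T / zetaDenom P T +
      N * (zetaNumCurve P T / zetaDenom P T) := by
  rw [zetaDenom] at h
  simp only [mul_ne_zero_iff] at h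
  obtain ⟨⟨⟨⟨h1, h2⟩, h3⟩, h4⟩, h5⟩ := h
  rw [zetaValue, Finset.prod_inv_distrib, zetaDenom]
  generalize ∏ i ∈ Finset.range 6, (1 - P ^ i * T) = D at h5 ⊢
  rw [latticeSum, lineSum, cyclicSum, zetaNumConst, zetaNumCurve]
  field_simp
  ring

theorem hasValueAt_div (f g : MvPolynomial (Fin 2) ℚ) {u v : ℂ}
    (h : MvPolynomial.aeval ![u, v] g ≠ 0) :
    HasValueAt (algebraMap _ RatFunc₂ f / algebraMap _ RatFunc₂ g) u v
      (MvPolynomial.aeval ![u, v] f / MvPolynomial.aeval ![u, v] g) := by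
  refine ⟨f, g, div_mul_cancel₀ _ fun h0 => h ?_, h, rfl⟩
  rw [IsFractionRing.injective (MvPolynomial (Fin 2) ℚ) RatFunc₂ (h0.trans (map_zero _).symm),
    map_zero]

theorem hasValueAt_zero (u v : ℂ) : HasValueAt 0 u v 0 :=
  ⟨0, 1, by simp, by simp, by simp⟩

/-- The rational function `zetaNumConst / zetaDenom`. -/
noncomputable def constRatFunc : RatFunc₂ :=
  algebraMap (MvPolynomial (Fin 2) ℚ) RatFunc₂
      (zetaNumConst (MvPolynomial.X 0) (MvPolynomial.X 1)) /
    algebraMap (MvPolynomial (Fin 2) ℚ) RatFunc₂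
      (zetaDenom (MvPolynomial.X 0) (MvPolynomial.X 1))

/-- The rational function `zetaNumCurve / zetaDenom`. -/
noncomputable def curveRatFunc : RatFunc₂ :=
  algebraMap (MvPolynomial (Fin 2) ℚ) RatFunc₂
      (zetaNumCurve (MvPolynomial.X 0) (MvPolynomial.X 1)) /
    algebraMap (MvPolynomial (Fin 2) ℚ) RatFunc₂
      (zetaDenom (MvPolynomial.X 0) (MvPolynomial.X 1))

theorem aeval_zetaDenom (u v : ℂ) :
    MvPolynomial.aeval ![u, v] (zetaDenom (MvPolynomial.X 0) (MvPolynomial.X 1) :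
      MvPolynomial (Fin 2) ℚ) = zetaDenom u v := by
  refine (map_zetaDenom (MvPolynomial.aeval (R := ℚ) ![u, v] :
    MvPolynomial (Fin 2) ℚ →ₐ[ℚ] ℂ).toRingHom _ _).trans ?_
  simp

theorem aeval_zetaNumConst (u v : ℂ) :
    MvPolynomial.aeval ![u, v] (zetaNumConst (MvPolynomial.X 0) (MvPolynomial.X 1) :
      MvPolynomial (Fin 2) ℚ) = zetaNumConst u v := by
  refine (map_zetaNumConst (MvPolynomial.aeval (R := ℚ) ![u, v] :
    MvPolynomial (Fin 2) ℚ →ₐ[ℚ] ℂ).toRingHom _ _).trans ?_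
  simp

theorem aeval_zetaNumCurve (u v : ℂ) :
    MvPolynomial.aeval ![u, v] (zetaNumCurve (MvPolynomial.X 0) (MvPolynomial.X 1) :
      MvPolynomial (Fin 2) ℚ) = zetaNumCurve u v := by
  refine (map_zetaNumCurve (MvPolynomial.aeval (R := ℚ) ![u, v] :
    MvPolynomial (Fin 2) ℚ →ₐ[ℚ] ℂ).toRingHom _ _).trans ?_
  simp

theorem hasValueAt_constRatFunc {u v : ℂ} (h : zetaDenom u v ≠ 0) :
    HasValueAt constRatFunc u v (zetaNumConst u v / zetaDenom u v) := by
  rw [← aeval_zetaDenom] at h ⊢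
  rw [← aeval_zetaNumConst]
  exact hasValueAt_div _ _ h

theorem hasValueAt_curveRatFunc {u v : ℂ} (h : zetaDenom u v ≠ 0) :
    HasValueAt curveRatFunc u v (zetaNumCurve u v / zetaDenom u v) := by
  rw [← aeval_zetaDenom] at h ⊢
  rw [← aeval_zetaNumCurve]
  exact hasValueAt_div _ _ h

theorem curveRatFunc_ne_zero : curveRatFunc ≠ 0 := by
  have hinj := IsFractionRing.injective (MvPolynomial (Fin 2) ℚ) RatFunc₂
  refine div_ne_zero ((map_ne_zero_iff _ hinj).2 fun h => ?_)
    ((map_ne_zero_iff _ hinj).2 fun h => ?_)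
  -- Nonvanishing is tested at one point: `(1, 2)` for the numerator, `(0, 0)` for the denominator.
  · have h1 := aeval_zetaNumCurve 1 2
    rw [h, map_zero, zetaNumCurve] at h1
    norm_num at h1
  · have h1 := aeval_zetaDenom 0 0
    rw [h, map_zero, zetaDenom] at h1
    norm_num at h1

end RationalFunctions

/-! ### Integral models -/

section Models

/-- Translating the point to the origin kills `a₆`, and the shear `s = -a₁/2` kills `a₁`. Rescaling
with `u⁻¹ = d₂d₃d₄`, a common denominator, multiplies `aᵢ` by its `i`-th power and clears
denominators. -/
theorem exists_isIntegralModelAt (W : WeierstrassCurve ℚ) {x y : ℚ}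
    (hxy : W.toAffine.Equation x y) :
    ∃ W₀ : WeierstrassCurve ℤ, IsIntegralModelAt W x y W₀ ∧ W₀.a₁ = 0 := by
  have hclear : ∀ q : ℚ, ∃ d n : ℤ, (d : ℚ) ≠ 0 ∧ (n : ℚ) = d * q := fun q =>
    ⟨q.den, q.num, by exact_mod_cast q.den_ne_zero, by
      rw [Int.cast_natCast, mul_comm]; exact (Rat.mul_den_eq_num q).symm⟩
  obtain ⟨d₂, n₂, h₂, e₂⟩ := hclear (W.a₂ - (-W.a₁ / 2) * W.a₁ + 3 * x - (-W.a₁ / 2) ^ 2)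
  obtain ⟨d₃, n₃, h₃, e₃⟩ := hclear (W.a₃ + x * W.a₁ + 2 * y)
  obtain ⟨d₄, n₄, h₄, e₄⟩ := hclear (W.a₄ - (-W.a₁ / 2) * W.a₃ + 2 * x * W.a₂ -
    (y + x * (-W.a₁ / 2)) * W.a₁ + 3 * x ^ 2 - 2 * (-W.a₁ / 2) * y)
  have heq := (WeierstrassCurve.Affine.equation_iff x y).1 hxy
  refine ⟨⟨0, (d₂ * d₃ * d₄) * (d₃ * d₄ * n₂), (d₂ * d₃ * d₄) ^ 2 * (d₂ * d₄ * n₃),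
    (d₂ * d₃ * d₄) ^ 3 * (d₂ * d₃ * n₄), 0⟩,
    ⟨⟨(Units.mk0 (d₂ * d₃ * d₄ : ℚ) (mul_ne_zero (mul_ne_zero h₂ h₃) h₄))⁻¹, x, -W.a₁ / 2, y⟩,
      ?_, rfl, rfl⟩, rfl⟩
  ext
  all_goals
    simp only [WeierstrassCurve.variableChange_def, WeierstrassCurve.map, inv_inv, Units.val_mk0,
      eq_intCast, Int.cast_mul, Int.cast_pow, Int.cast_zero, e₂, e₃, e₄]
  iterate 4 ring
  -- The remaining coefficient `a₆` vanishes because the point lies on the curve.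
  linear_combination -(d₂ * d₃ * d₄ : ℚ) ^ 6 * heq

variable {W : WeierstrassCurve ℚ} {x y : ℚ} {W₀ : WeierstrassCurve ℤ}

theorem IsIntegralModelAt.a₆_eq_zero (h : IsIntegralModelAt W x y W₀)
    (hxy : W.toAffine.Equation x y) : W₀.a₆ = 0 := by
  obtain ⟨C, hC, rfl, rfl⟩ := h
  have heq := (WeierstrassCurve.Affine.equation_iff _ _).1 hxy
  have h1 := congrArg WeierstrassCurve.a₆ hC
  simp only [WeierstrassCurve.variableChange_def, WeierstrassCurve.map, eq_intCast] at h1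
  have h2 : W.a₆ + C.r * W.a₄ + C.r ^ 2 * W.a₂ + C.r ^ 3 - C.t * W.a₃ - C.t ^ 2 -
      C.r * C.t * W.a₁ = 0 := by
    linear_combination -heq
  rw [h2, mul_zero] at h1
  exact_mod_cast h1.symm

theorem IsIntegralModelAt.Δ_ne_zero [W.IsElliptic] (h : IsIntegralModelAt W x y W₀) :
    W₀.Δ ≠ 0 := by
  obtain ⟨C, hC, -, -⟩ := h
  intro h0
  have h1 := congrArg WeierstrassCurve.Δ hC
  rw [WeierstrassCurve.variableChange_Δ, WeierstrassCurve.map_Δ, h0, map_zero] at h1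
  have h2 := W.isUnit_Δ.ne_zero
  simp [h2] at h1

theorem finite_setOf_prime_dvd {c : ℤ} (hc : c ≠ 0) : {p : ℕ | (p : ℤ) ∣ c}.Finite := by
  refine (Set.finite_Iic c.natAbs).subset fun p hp => ?_
  exact Nat.le_of_dvd (Int.natAbs_pos.2 hc) (Int.natCast_dvd.1 hp)

theorem finite_not_isGoodPrime (hΔ : W₀.Δ ≠ 0) :
    {p : ℕ | p.Prime ∧ ¬ IsGoodPrime W₀ p}.Finite := by
  have hfin : ({c ∈ ({W₀.a₁, W₀.a₂, W₀.a₃, W₀.a₄, W₀.a₆} : Set ℤ) | c ≠ 0}).Finite :=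
    (Set.toFinite _).subset (Set.sep_subset _ _)
  refine ((finite_setOf_prime_dvd hΔ).union (hfin.biUnion fun c hc =>
    finite_setOf_prime_dvd hc.2)).subset fun p hp => ?_
  by_contra h
  simp only [Set.mem_union, Set.mem_iUnion, not_or, not_exists] at h
  exact hp.2 ⟨h.1, fun c hc hc0 hd => h.2 c ⟨hc, hc0⟩ hd⟩

end Models

/-- The line terms do not contribute for the determinantal representation `cubicMatrix`, whence the
vanishing of `P₃`, `P₄` and `P₅`. -/
theorem theorem1 (W : WeierstrassCurve ℚ) [W.IsElliptic] (x y : ℚ)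
    (hxy : W.toAffine.Equation x y) :
    (∃ W₀ : WeierstrassCurve ℤ, IsIntegralModelAt W x y W₀ ∧ W₀.a₁ = 0) ∧
    ∀ W₀ : WeierstrassCurve ℤ, IsIntegralModelAt W x y W₀ →
      {p : ℕ | p.Prime ∧ ¬ IsGoodPrime W₀ p}.Finite ∧
      ∃ (G : Type) (_ : Group G) (L : Type) (_ : LieRing L)
        (M₁ M₂ : Fin 3 → ℤ) (P₁ P₂ P₃ P₄ P₅ : RatFunc₂),
        IsTorsionFreeClassTwo G ∧ IsAssociatedLieRing 9 G L ∧
        IsPrimitiveVec M₁ ∧ IsPrimitiveVec M₂ ∧ LinearIndependent ℤ ![M₁, M₂] ∧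
        P₂ ≠ 0 ∧
        ∀ (p : ℕ) [Fact p.Prime], IsGoodPrime W₀ p → ∀ s : ℂ, 9 < s.re →
          ∃ z₁ z₂ z₃ z₄ z₅ : ℂ,
            HasValueAt P₁ p ((p : ℂ) ^ (-s)) z₁ ∧
            HasValueAt P₂ p ((p : ℂ) ^ (-s)) z₂ ∧
            HasValueAt P₃ p ((p : ℂ) ^ (-s)) z₃ ∧
            HasValueAt P₄ p ((p : ℂ) ^ (-s)) z₄ ∧
            HasValueAt P₅ p ((p : ℂ) ^ (-s)) z₅ ∧
            HasGroupZeta p G s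
              (z₁ + (redCurve p W₀).ncard * z₂
                + (redLine p M₁ ∩ redCurve p W₀).ncard * z₃
                + (redLine p M₂ ∩ redCurve p W₀).ncard * z₄
                + (redLine p M₁ ∩ redLine p M₂ ∩ redCurve p W₀).ncard * z₅) ∧
            HasLieZeta p L s
              (z₁ + (redCurve p W₀).ncard * z₂
                + (redLine p M₁ ∩ redCurve p W₀).ncard * z₃
                + (redLine p M₂ ∩ redCurve p W₀).ncard * z₄
                + (redLine p M₁ ∩ redLine p M₂ ∩ redCurve p W₀).ncard * z₅) := by
  refine ⟨exists_isIntegralModelAt W hxy, fun W₀ hW₀ =>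
    ⟨finite_not_isGoodPrime hW₀.Δ_ne_zero, CubicGroup W₀, inferInstance, CubicLie W₀,
      -- The lines `X = 0` and `Y = 0` are an arbitrary choice, as their terms have coefficient
      -- zero.
      inferInstance, ![1, 0, 0], ![0, 1, 0], constRatFunc, curveRatFunc, 0, 0, 0,
      CubicGroup.isTorsionFreeClassTwo, isAssociatedLieRing_cubic, by unfold IsPrimitiveVec; decide,
      by unfold IsPrimitiveVec; decide, ?_, curveRatFunc_ne_zero, fun p _ hp s hs => ?_⟩⟩
  · rw [LinearIndependent.pair_iff]
    intro a b hab
    have h0 := congrFun hab 0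
    have h1 := congrFun hab 1
    simp at h0 h1
    exact ⟨h0, h1⟩
  · have hD := zetaDenom_ne_zero (norm_cpow_neg_lt (p := p) hs)
    have h6 := hW₀.a₆_eq_zero hxy
    refine ⟨_, _, 0, 0, 0, hasValueAt_constRatFunc hD, hasValueAt_curveRatFunc hD,
      hasValueAt_zero _ _, hasValueAt_zero _ _, hasValueAt_zero _ _, ?_, ?_⟩
    all_goals simp only [mul_zero, add_zero]; rw [← zetaValue_eq hD]
    · exact hasGroupZeta_cubicGroup h6 hp.1 hs
    · exact hasLieZeta_cubicLie h6 hp.1 hs
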